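/- Let $\mathbb{K}$ be an algebraically closed field of characteristic $0$, let $n \ge 2$, and let $\Gamma \subset \mathbb{P}^n = \mathbb{P}^n_{\mathbb{K}}$ be a finite closed subscheme with ideal sheaf $\mathcal{I}_\Gamma$. For a finite subscheme $Z$ write $|Z| = \operatorname{length}(\mathcal{O}_Z) = h^0(Z,\mathcal{O}_Z)$, its degree. Let $d = |\Gamma|$. Assume that $d \ge 4n^2+6n+1$ and that $\Gamma$ is in linearly general position, i.e. the smallest integer $t$ for which there is a $t$-dimensional linear subspace $\Lambda \subset \mathbb{P}^n$ with $|\Gamma \cap \Lambda| \ge t+2$ is $t = n$. (Intersections are scheme-theoretic.) Write $d = nq+r+2$ with integers $q$ and $0 \le r \le n-1$. Let $\operatorname{reg}(\Gamma)$ be the least integer $p$ such that $H^i(\mathbb{P}^n, \mathcal{I}_\Gamma(p-i)) = 0$ for all $i \ge 1$, and let $\rho(\Gamma)$ be the maximum of $|\Gamma \cap C|$ over all rational normal curves $C$ (of degree $n$) in $\mathbb{P}^n$. Then $$\operatorname{reg}(\Gamma) = \left\lceil \frac{d-1}{n} \right\rceil + 1 \quad\text{if and only if}\quad \rho(\Gamma)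 \ge d-r.$$ In particular, if $r = 0$ and $\operatorname{reg}(\Gamma) = \left\lceil \frac{d-1}{n} \right\rceil + 1$, then $\Gamma$ is a closed subscheme of a rational normal curve in $\mathbb{P}^n$, and $\Gamma$ is in uniform position: $\Gamma$ is nondegenerate (contained in no hyperplane) and $h_Y(\ell) = \min\{|Y|, h_\Gamma(\ell)\}$ for every closed subscheme $Y \subseteq \Gamma$ and every integer $\ell \ge 0$, where $h_Y(\ell)$ is the dimension of the degree $\ell$ part of the homogeneous coordinate ring $\mathbb{K}[x_0,\dots,x_n]/I(Y)$, with $I(Y)$ the saturated homogeneous ideal of $Y$. (When $\Gamma$ is reduced, its closed subschemes are its subsets, and this is the usual definition for finite sets of points.) -/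

import Mathlib

noncomputable section

namespace ProjSub

open MvPolynomial

variable {K : Type*} [Field K] {n : ℕ}

/-- A closed subscheme of `ℙⁿ` over `K`, given by its saturated homogeneous ideal in the homogeneous
coordinate ring `K[x₀, …, xₙ]` (closed subschemes of `ℙⁿ` correspond bijectively to these ideals).
The empty subscheme is given by the unit ideal. -/
@[ext]
structure ClosedSubscheme (K : Type*) [Field K] (n : ℕ) where
  /-- the saturated homogeneous ideal `I(Γ)` -/
  ideal : Ideal (MvPolynomial (Fin (n + 1)) K)
  homogeneous : ∀ f ∈ ideal, ∀ m : ℕ, homogeneousComponent m f ∈ ideal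
  saturated : ∀ f, (∀ i, ∃ N : ℕ, X i ^ N * f ∈ ideal) → f ∈ ideal

/-! ### Sections of twisted ideal sheaves and Čech cohomology -/

/-- The ring `K[x₀^{±1}, …, xₙ^{±1}]` of Laurent polynomials. -/
abbrev Laurent (K : Type*) [Field K] (n : ℕ) : Type _ :=
  AddMonoidAlgebra K (Fin (n + 1) → ℤ)

/-- The variable `xᵢ` as a Laurent polynomial. -/
def Laurent.x (K : Type*) [Field K] {n : ℕ} (i : Fin (n + 1)) : Laurent K n :=
  AddMonoidAlgebra.single (Pi.single i 1) 1

/-- The inclusion of the homogeneous coordinate ring into the Laurent polynomials. -/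
def toLaurent (K : Type*) [Field K] (n : ℕ) :
    MvPolynomial (Fin (n + 1)) K →ₐ[K] Laurent K n :=
  aeval (Laurent.x K)

/-- Let `ℐ` be the ideal sheaf on `ℙⁿ` of the homogeneous ideal `I`. For a set `S` of variables with
product `x_S`, this is `Γ(D₊(x_S), ℐ(m))`, that is, the degree `m` part of the localization of `I`
at `x_S`, inside the Laurent polynomials. For `I = ⊤` it is `Γ(D₊(x_S), 𝒪(m))`. -/
def sections (I : Ideal (MvPolynomial (Fin (n + 1)) K)) (m : ℤ) (S : Finset (Fin (n + 1))) :
    Submodule K (Laurent K n) where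
  carrier := {f | (∀ e ∈ Finsupp.support f.coeff, ∑ i, e i = m) ∧
    ∃ N : ℕ, ∃ g ∈ I, (∏ i ∈ S, Laurent.x K i) ^ N * f = toLaurent K n g}
  zero_mem' := by
    refine ⟨by simp, 0, 0, I.zero_mem, by simp⟩
  add_mem' := by
    classical
    rintro f₁ f₂ ⟨h₁, N₁, g₁, hg₁, e₁⟩ ⟨h₂, N₂, g₂, hg₂, e₂⟩
    refine ⟨fun e he => ?_, N₁ + N₂,
      (∏ i ∈ S, X i) ^ N₂ * g₁ + (∏ i ∈ S, X i) ^ N₁ * g₂,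
      I.add_mem (I.mul_mem_left _ hg₁) (I.mul_mem_left _ hg₂), ?_⟩
    · rcases Finset.mem_union.1 (Finsupp.support_add he) with h | h
      exacts [h₁ e h, h₂ e h]
    · have hx : toLaurent K n (∏ i ∈ S, X i) = ∏ i ∈ S, Laurent.x K i := by
        simp [toLaurent]
      rw [map_add, map_mul, map_mul, map_pow, map_pow, hx, ← e₁, ← e₂]
      ring
  smul_mem' := by
    rintro a f ⟨h, N, g, hg, e⟩
    refine ⟨fun e' he => h e' (Finsupp.support_smul he), N, a • g, ?_, ?_⟩
    · rw [smul_eq_C_mul]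
      exact I.mul_mem_left _ hg
    · rw [map_smul, ← e, mul_smul_comm]

/-- The (ordered) Čech cochains of degree `p` of `ℐ(m)` for the covering of `ℙⁿ` by the standard
affine opens `D₊(x₀), …, D₊(xₙ)`: a section over each `D₊(x_{s 0} ⋯ x_{s p})`,
`s 0 < ⋯ < s p`. -/
def cochains (I : Ideal (MvPolynomial (Fin (n + 1)) K)) (m : ℤ) (p : ℕ) :
    Submodule K ((Fin (p + 1) ↪o Fin (n + 1)) → Laurent K n) :=
  Submodule.pi Set.univ fun s => sections I m (Finset.univ.map s.toEmbedding)

/-- The Čech coboundary `(dc)(s) = ∑ₖ (-1)ᵏ c(s with its k-th entry omitted)`. -/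
def coboundary (K : Type*) [Field K] (n p : ℕ) :
    ((Fin (p + 1) ↪o Fin (n + 1)) → Laurent K n) →ₗ[K]
      ((Fin (p + 2) ↪o Fin (n + 1)) → Laurent K n) :=
  LinearMap.pi fun s => ∑ k : Fin (p + 2),
    (-1 : K) ^ (k : ℕ) • LinearMap.proj ((Fin.succAboveOrderEmb k).trans s)

/-- Čech cocycles of `ℐ(m)`. -/
def cocycles (I : Ideal (MvPolynomial (Fin (n + 1)) K)) (m : ℤ) (p : ℕ) :
    Submodule K ((Fin (p + 1) ↪o Fin (n + 1)) → Laurent K n) :=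
  cochains I m p ⊓ LinearMap.ker (coboundary K n p)

/-- Čech coboundaries of `ℐ(m)`. -/
def coboundaries (I : Ideal (MvPolynomial (Fin (n + 1)) K)) (m : ℤ) : (p : ℕ) →
    Submodule K ((Fin (p + 1) ↪o Fin (n + 1)) → Laurent K n)
  | 0 => ⊥
  | p + 1 => (cochains I m p).map (coboundary K n p)

/-- The cohomology `Hᵖ(ℙⁿ, ℐ(m))` of the twisted ideal sheaf. -/
abbrev cohomology (I : Ideal (MvPolynomial (Fin (n + 1)) K)) (m : ℤ) (p : ℕ) : Type _ :=
  cocycles I m p ⧸ (coboundaries I m p).submoduleOf (cocycles I m p)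

/-- The `0`-cochains of `𝒪(m)` whose classes modulo `ℐ(m)` agree on the overlaps, i.e. which
give a global section of `𝒪(m)/ℐ(m)`. -/
def quotientCocycles (I : Ideal (MvPolynomial (Fin (n + 1)) K)) (m : ℤ) :
    Submodule K ((Fin 1 ↪o Fin (n + 1)) → Laurent K n) :=
  cochains ⊤ m 0 ⊓ (cochains I m 1).comap (coboundary K n 0)

/-- `H⁰(Z, 𝒪_Z)` for the subscheme `Z` of `ℙⁿ` defined by the homogeneous ideal `I`: families of
regular functions on the `D₊(xᵢ)` agreeing modulo `ℐ` on overlaps, modulo families of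
sections of `ℐ`. -/
abbrev globalSections (I : Ideal (MvPolynomial (Fin (n + 1)) K)) : Type _ :=
  quotientCocycles I 0 ⧸ (cochains I 0 0).submoduleOf (quotientCocycles I 0)

/-- `h⁰(Z, 𝒪_Z)` for the subscheme `Z` of `ℙⁿ` defined by the homogeneous ideal `I` (which need not
be saturated). For a finite scheme `Z` this is the length of `𝒪_Z`. -/
def length (I : Ideal (MvPolynomial (Fin (n + 1)) K)) : ℕ :=
  Module.finrank K (globalSections I)

namespace ClosedSubscheme

/-- `Γ` is finite over `K`: its intersection with each standard affine open `D₊(xᵢ)` is the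
spectrum of a finite dimensional `K`-algebra. -/
def IsFinite (Γ : ClosedSubscheme K n) : Prop :=
  ∀ i : Fin (n + 1), FiniteDimensional K
    (sections (⊤ : Ideal (MvPolynomial (Fin (n + 1)) K)) 0 {i} ⧸
      (sections Γ.ideal 0 {i}).submoduleOf (sections ⊤ 0 {i}))

/-- The degree `|Γ|` of a finite subscheme: the length of `𝒪_Γ`. -/
def degree (Γ : ClosedSubscheme K n) : ℕ := length Γ.ideal

/-- The degree `|Γ ∩ Z|` of the scheme-theoretic intersection, which is defined by the sum of the
two ideal sheaves. -/
def interDegree (Γ Z : ClosedSubscheme K n) : ℕ := length (Γ.ideal ⊔ Z.ideal)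

/-- `Y` is a closed subscheme of `Γ`. -/
def IsSubscheme (Y Γ : ClosedSubscheme K n) : Prop := Γ.ideal ≤ Y.ideal

/-- `Γ` is `p`-regular in the sense of Castelnuovo and Mumford. -/
def IsRegular (Γ : ClosedSubscheme K n) (p : ℤ) : Prop :=
  ∀ i : ℕ, 1 ≤ i → Subsingleton (cohomology Γ.ideal (p - i) i)

/-- The Castelnuovo–Mumford regularity of `Γ`: the least integer `p` such that `Γ` is
`p`-regular. -/
def reg (Γ : ClosedSubscheme K n) : ℤ := sInf {p : ℤ | Γ.IsRegular p}

/-- `Z` is a linear subspace of `ℙⁿ` of dimension `t`: its ideal is generated by a space of linear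
forms of dimension `n - t`. -/
def IsPlane (Z : ClosedSubscheme K n) (t : ℕ) : Prop :=
  ∃ L : Submodule K (MvPolynomial (Fin (n + 1)) K),
    L ≤ homogeneousSubmodule (Fin (n + 1)) K 1 ∧ Module.finrank K L + t = n ∧
      Z.ideal = Ideal.span (L : Set (MvPolynomial (Fin (n + 1)) K))

/-- `t(Γ)`, the smallest `t` such that `Γ` admits a `(t+2)`-secant `t`-plane. -/
def secantIndex (Γ : ClosedSubscheme K n) : ℕ :=
  sInf {t : ℕ | ∃ Z : ClosedSubscheme K n, Z.IsPlane t ∧ t + 2 ≤ Γ.interDegree Z}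

/-- `Γ ⊆ ℙⁿ` is in linearly general position. -/
def InLinearlyGeneralPosition (Γ : ClosedSubscheme K n) : Prop :=
  Γ.secantIndex = n

/-- `C` is a rational normal curve (of degree `n`) in `ℙⁿ`: the image of the embedding
`ℙ¹ → ℙⁿ`, `(s : t) ↦ (F₀(s,t) : ⋯ : Fₙ(s,t))`, for a basis `F₀, …, Fₙ` of the binary forms of
degree `n`. -/
def IsRationalNormalCurve (C : ClosedSubscheme K n) : Prop :=
  ∃ F : Module.Basis (Fin (n + 1)) K (homogeneousSubmodule (Fin 2) K n),
    C.ideal = RingHom.ker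
      (aeval fun i => (F i : MvPolynomial (Fin 2) K) :
        MvPolynomial (Fin (n + 1)) K →ₐ[K] MvPolynomial (Fin 2) K)

/-- `ρ(Γ)`, the maximum of `|Γ ∩ C|` over all rational normal curves `C` in `ℙⁿ`. -/
def rho (Γ : ClosedSubscheme K n) : ℕ :=
  sSup {k : ℕ | ∃ C : ClosedSubscheme K n, C.IsRationalNormalCurve ∧ Γ.interDegree C = k}

/-- The Hilbert function: the dimension of the image of the forms of degree `l` in `K[x]/I(Γ)`. -/
def hilbertFunction (Γ : ClosedSubscheme K n) (l : ℕ) : ℕ :=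
  Module.finrank K ((homogeneousSubmodule (Fin (n + 1)) K l).map
    (Ideal.Quotient.mkₐ K Γ.ideal).toLinearMap)

/-- `Γ` is not contained in a hyperplane. -/
def IsNondegenerate (Γ : ClosedSubscheme K n) : Prop :=
  ∀ f ∈ homogeneousSubmodule (Fin (n + 1)) K 1, f ∈ Γ.ideal → f = 0

/-- `Γ` is in uniform position: it is finite and nondegenerate, and
`h_Y(l) = min {|Y|, h_Γ(l)}` for every closed subscheme `Y` of `Γ` and every `l ≥ 0`. When `Γ` is
reduced, i.e. a finite set of points, its closed subschemes are its subsets. -/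
def InUniformPosition (Γ : ClosedSubscheme K n) : Prop :=
  Γ.IsFinite ∧ Γ.IsNondegenerate ∧
    ∀ Y : ClosedSubscheme K n, Y.IsSubscheme Γ → ∀ l : ℕ,
      Y.hilbertFunction l = min Y.degree (Γ.hilbertFunction l)

end ClosedSubscheme

end ProjSub

end

/-!
Choose a linear form `L` vanishing at no point of `Γ`.  Dehomogenizing by `L` turns `Γ` into a
`K`-algebra `A = K[x] / (I(Γ), L - 1)` of dimension `d`, generated by the image `V ∋ 1` of the
linear forms; the forms of degree `m` become `V ^ m`, and `H¹(ℐ_Γ(m)) = 0` if and only if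
`V ^ m = A`.  Linearly general position says that `V` surjects onto every quotient of `A` of
dimension at most `n + 1`, and by residuation `V ^ m` surjects onto every quotient of dimension at
most `n * m + 1`.  Hence `reg Γ ≤ ⌈(d - 1) / n⌉ + 1`, with equality if and only if `V ^ q ≠ A`.

If `V ^ q ≠ A`, pass to a smallest quotient `B` of `A` in which `V ^ q ≠ B`; its dimension is at
least `n * q + 2 = d - r`.  By minimality a nonzero element of `V` annihilates no nonzero element of
`V ^ l` for `l ≤ q - 1`, so the Hilbert function `l ↦ dim V ^ l` grows by at least `n` at each step,
and since it stays below `dim B` it grows by exactly `n` twice in a row.  There the multiplications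
by two elements of `V` vanishing on a subscheme of length `n - 1` form a pencil of matrices with a
single Kronecker block, which yields a basis of `V` with `v i * v (j + 1) = v (i + 1) * v j`, and
thus a rational normal curve containing `Spec B`.  Conversely, the Hilbert function of a rational
normal curve `C` is at most `n * q + 1` in degree `q`, so `|Γ ∩ C| ≥ n * q + 2` prevents
`V ^ q = A`.
-/

namespace ProjSub

open Module

section FiniteAlgebra

variable {K : Type*} [Field K] {A : Type*} [CommRing A] [Algebra K A]

theorem finrank_map_eq_of_forall {M N N' : Type*} [AddCommGroup M] [Module K M]
    [AddCommGroup N] [Module K N] [AddCommGroup N'] [Module K N'] {W : Submodule K M}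
    {f : M →ₗ[K] N} {g : M →ₗ[K] N'} (h : ∀ x ∈ W, f x = 0 ↔ g x = 0) :
    finrank K (W.map f) = finrank K (W.map g) := by
  have hker : LinearMap.ker (f.domRestrict W) = LinearMap.ker (g.domRestrict W) := by
    ext x
    exact h x x.2
  rw [← LinearMap.range_domRestrict, ← LinearMap.range_domRestrict,
    ← (LinearMap.quotKerEquivRange (f.domRestrict W)).finrank_eq, hker,
    (LinearMap.quotKerEquivRange (g.domRestrict W)).finrank_eq]

theorem finrank_quotient_add_finrank_ideal [FiniteDimensional K A] (J : Ideal A) :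
    finrank K (A ⧸ J) + finrank K (J.restrictScalars K) = finrank K A := by
  rw [← (Submodule.Quotient.restrictScalarsEquiv K J).finrank_eq]
  exact (J.restrictScalars K).finrank_quotient_add_finrank

theorem finrank_quotient_le_of_le {J J' : Ideal A} [FiniteDimensional K (A ⧸ J)] (h : J ≤ J') :
    finrank K (A ⧸ J') ≤ finrank K (A ⧸ J) :=
  (Ideal.Quotient.factorₐ K h).toLinearMap.finrank_le_finrank_of_surjective
    (Ideal.Quotient.factor_surjective h)

theorem finiteDimensional_quotient_of_le {J J' : Ideal A} [FiniteDimensional K (A ⧸ J)]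
    (h : J ≤ J') : FiniteDimensional K (A ⧸ J') :=
  Module.Finite.of_surjective (Ideal.Quotient.factorₐ K h).toLinearMap
    (Ideal.Quotient.factor_surjective h)

theorem le_of_finrank_quotient_le {J J' : Ideal A} [FiniteDimensional K (A ⧸ J)] (h : J ≤ J')
    (hle : finrank K (A ⧸ J) ≤ finrank K (A ⧸ J')) : J' ≤ J := by
  have : FiniteDimensional K (A ⧸ J') := finiteDimensional_quotient_of_le h
  have hinj : Function.Injective (Ideal.Quotient.factorₐ K h).toLinearMap :=
    (LinearMap.injective_iff_surjective_of_finrank_eq_finrank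
      (hle.antisymm (finrank_quotient_le_of_le h))).2 (Ideal.Quotient.factor_surjective h)
  intro x hx
  refine Ideal.Quotient.eq_zero_iff_mem.1 (hinj ?_)
  rw [map_zero]
  exact Ideal.Quotient.eq_zero_iff_mem.2 hx

theorem finrank_eq_one_of_isSimpleModule [IsAlgClosed K] [FiniteDimensional K A] (M : Type*)
    [AddCommGroup M] [Module A M] [Module K M] [IsScalarTower K A M] [IsSimpleModule A M] :
    finrank K M = 1 := by
  obtain ⟨m, hm, ⟨e⟩⟩ := isSimpleModule_iff_quot_maximal.1 ‹IsSimpleModule A M›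
  let := Ideal.Quotient.field m
  rw [(e.restrictScalars K).finrank_eq, ← finrank_self K]
  exact (LinearEquiv.ofBijective (Algebra.linearMap K (A ⧸ m))
    IsAlgClosed.algebraMap_bijective_of_isIntegral).finrank_eq.symm

theorem finrank_quotient_eq_succ_of_covBy [IsAlgClosed K] [FiniteDimensional K A] {J J' : Ideal A}
    (h : J ⋖ J') : finrank K (A ⧸ J) = finrank K (A ⧸ J') + 1 := by
  have : IsSimpleModule A (J' ⧸ Submodule.submoduleOf J J') := (covBy_iff_quot_is_simple h.le).1 h
  have hone : finrank K (J' ⧸ Submodule.submoduleOf J J') = 1 :=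
    finrank_eq_one_of_isSimpleModule (A := A) _
  have hsub : finrank K (Submodule.submoduleOf J J') = finrank K (J.restrictScalars K) :=
    ((Submodule.submoduleOfEquivOfLe h.le).restrictScalars K).finrank_eq
  have hquot : finrank K (J' ⧸ Submodule.submoduleOf J J') +
      finrank K (Submodule.submoduleOf J J') = finrank K (J'.restrictScalars K) :=
    ((Submodule.submoduleOf J J').restrictScalars K).finrank_quotient_add_finrank
  have hJ := finrank_quotient_add_finrank_ideal (K := K) J
  have hJ' := finrank_quotient_add_finrank_ideal (K := K) J'
  omega

theorem finrank_quotient_top : finrank K (A ⧸ (⊤ : Ideal A)) = 0 :=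
  have : Subsingleton (A ⧸ (⊤ : Ideal A)) := Ideal.Quotient.subsingleton_iff.2 rfl
  finrank_zero_of_subsingleton

theorem finrank_quotient_bot : finrank K (A ⧸ (⊥ : Ideal A)) = finrank K A :=
  (AlgEquiv.quotientBot K A).toLinearEquiv.finrank_eq

theorem exists_ideal_mem_Icc_finrank_quotient_eq [IsAlgClosed K] [FiniteDimensional K A]
    {J₀ J₁ : Ideal A} (h : J₀ ≤ J₁) {k : ℕ} (h₁ : finrank K (A ⧸ J₁) ≤ k)
    (h₀ : k ≤ finrank K (A ⧸ J₀)) : ∃ J ∈ Set.Icc J₀ J₁, finrank K (A ⧸ J) = k := by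
  have : IsNoetherianRing A := IsNoetherianRing.of_finite K A
  induction k, h₁ using Nat.le_induction with
  | base => exact ⟨J₁, ⟨h, le_rfl⟩, rfl⟩
  | succ k _ ih =>
    obtain ⟨J, ⟨hJ₀, hJ₁⟩, hJ⟩ := ih (by omega)
    have hlt : J₀ < J := lt_of_le_of_ne hJ₀ (by rintro rfl; omega)
    obtain ⟨J', hJ', hcov⟩ := exists_le_covBy_of_lt hlt
    exact ⟨J', ⟨hJ', hcov.le.trans hJ₁⟩, by rw [finrank_quotient_eq_succ_of_covBy hcov, hJ]⟩

theorem finrank_quotient_colon_add [FiniteDimensional K A] (J : Ideal A) (v : A) :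
    finrank K (A ⧸ Submodule.colon J {v}) + finrank K (A ⧸ (J ⊔ Ideal.span {v})) =
      finrank K (A ⧸ J) := by
  let mulV : A →ₗ[K] A ⧸ J := (Ideal.Quotient.mkₐ K J).toLinearMap ∘ₗ LinearMap.mulRight K v
  let proj : (A ⧸ J) →ₗ[K] A ⧸ (J ⊔ Ideal.span {v}) :=
    (Ideal.Quotient.factorₐ K le_sup_left).toLinearMap
  have hker : LinearMap.ker mulV = (Submodule.colon J {v}).restrictScalars K := by
    ext a
    rw [LinearMap.mem_ker]
    exact Ideal.Quotient.eq_zero_iff_mem.trans Submodule.mem_colon_singleton.symm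
  have hexact : LinearMap.range mulV = LinearMap.ker proj := by
    refine le_antisymm ?_ fun y hy => ?_
    · rintro _ ⟨a, rfl⟩
      exact Ideal.Quotient.eq_zero_iff_mem.2
        (Ideal.mem_sup_right (Ideal.mul_mem_left _ a (Ideal.mem_span_singleton_self v)))
    · obtain ⟨a, rfl⟩ := Ideal.Quotient.mk_surjective y
      obtain ⟨z, hz, _, hw, rfl⟩ := Submodule.mem_sup.1 (Ideal.Quotient.eq_zero_iff_mem.1 hy)
      obtain ⟨b, rfl⟩ := Ideal.mem_span_singleton'.1 hw
      exact ⟨b, (Ideal.Quotient.eq.2 (by simpa using J.neg_mem hz)).symm⟩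
  have hrange : finrank K (LinearMap.range mulV) = finrank K (A ⧸ Submodule.colon J {v}) := by
    have hcolon := finrank_quotient_add_finrank_ideal (K := K) (Submodule.colon J {v})
    have := mulV.finrank_range_add_finrank_ker
    rw [hker] at this
    omega
  have hproj : finrank K (LinearMap.range proj) = finrank K (A ⧸ (J ⊔ Ideal.span {v})) := by
    rw [LinearMap.range_eq_top.2 (Ideal.Quotient.factor_surjective le_sup_left), finrank_top]
  rw [← hrange, ← hproj, hexact, add_comm, proj.finrank_range_add_finrank_ker]

variable {V W : Submodule K A} {J : Ideal A}

theorem exists_mem_add_mul_mem {v : A} (h : V ⊔ (Ideal.span {v}).restrictScalars K = ⊤) (a : A) :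
    ∃ w ∈ V, ∃ b, a = w + b * v := by
  obtain ⟨w, hw, z, hz, rfl⟩ := Submodule.mem_sup.1 (h ▸ Submodule.mem_top (x := a))
  obtain ⟨b, rfl⟩ := Ideal.mem_span_singleton'.1 hz
  exact ⟨w, hw, b, rfl⟩

theorem sup_eq_top_of_sup_colon_eq_top {U : Submodule K A} {v : A} (hVU : V ≤ U)
    (hWU : ∀ w ∈ W, w * v ∈ U) (hV : V ⊔ (Ideal.span {v}).restrictScalars K = ⊤)
    (hW : W ⊔ (Submodule.colon J {v}).restrictScalars K = ⊤) : U ⊔ J.restrictScalars K = ⊤ := by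
  refine eq_top_iff.2 fun a _ => ?_
  obtain ⟨u, hu, b, rfl⟩ := exists_mem_add_mul_mem hV a
  obtain ⟨w, hw, c, hc, rfl⟩ := Submodule.mem_sup.1 (hW ▸ Submodule.mem_top (x := b))
  exact Submodule.mem_sup.2 ⟨u + w * v, U.add_mem (hVU hu) (hWU w hw), c * v,
    Submodule.mem_colon_singleton.1 hc, by ring⟩

theorem finrank_inf_add_finrank_quotient [FiniteDimensional K A]
    (h : W ⊔ J.restrictScalars K = ⊤) :
    finrank K ↥(W ⊓ J.restrictScalars K) + finrank K (A ⧸ J) = finrank K W := by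
  have hsum := Submodule.finrank_sup_add_finrank_inf_eq W (J.restrictScalars K)
  have := finrank_quotient_add_finrank_ideal (K := K) J
  rw [h, finrank_top] at hsum
  omega

theorem exists_mem_ideal_of_finrank_lt [FiniteDimensional K A]
    (h : finrank K (A ⧸ J) < finrank K V) : ∃ v ∈ V, v ∈ J ∧ v ≠ 0 := by
  have hsum := Submodule.finrank_sup_add_finrank_inf_eq V (J.restrictScalars K)
  have := (V ⊔ J.restrictScalars K).finrank_le
  have := finrank_quotient_add_finrank_ideal (K := K) J
  obtain ⟨v, ⟨hv, hvJ⟩, hv0⟩ := Submodule.exists_mem_ne_zero_of_ne_bot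
    (p := V ⊓ J.restrictScalars K) fun hbot => by rw [hbot, finrank_bot] at hsum; omega
  exact ⟨v, hv, hvJ, hv0⟩

theorem map_mk_eq_top_iff :
    V.map (Ideal.Quotient.mkₐ K J).toLinearMap = ⊤ ↔ V ⊔ J.restrictScalars K = ⊤ := by
  have hker : LinearMap.ker (Ideal.Quotient.mkₐ K J).toLinearMap = J.restrictScalars K :=
    Submodule.ext fun _ => Ideal.Quotient.eq_zero_iff_mem
  rw [LinearMap.map_eq_top_iff (LinearMap.range_eq_top.2 (Ideal.Quotient.mkₐ_surjective K J)), hker]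

/-- `V` imposes independent conditions on the subschemes of length at most `k` of the finite scheme
`Spec A`: the functions in `V` surject onto the functions on each of them. For `V` coming from the
sections of a line bundle, this is `(k - 1)`-very ampleness. -/
def SpansQuotients (V : Submodule K A) (k : ℕ) : Prop :=
  ∀ J : Ideal A, finrank K (A ⧸ J) ≤ k → V ⊔ J.restrictScalars K = ⊤

theorem spansQuotients_finrank [IsAlgClosed K] [FiniteDimensional K A]
    (hA : finrank K V ≤ finrank K A)
    (h : ∀ v ∈ V, v ≠ 0 → finrank K (A ⧸ Ideal.span {v}) < finrank K V) :
    SpansQuotients V (finrank K V) := by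
  intro J hJ
  obtain ⟨J', ⟨-, hle⟩, hJ'⟩ :=
    exists_ideal_mem_Icc_finrank_quotient_eq bot_le hJ (hA.trans finrank_quotient_bot.ge)
  have hinf : V ⊓ J'.restrictScalars K = ⊥ := by
    refine (Submodule.eq_bot_iff _).2 fun v ⟨hv, hvJ⟩ => by_contra fun hv0 => ?_
    have := h v hv hv0
    have : finrank K (A ⧸ J') ≤ finrank K (A ⧸ Ideal.span {v}) :=
      finrank_quotient_le_of_le ((Ideal.span_singleton_le_iff_mem _).2 hvJ)
    omega
  have hsum := Submodule.finrank_sup_add_finrank_inf_eq V (J'.restrictScalars K)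
  have := finrank_quotient_add_finrank_ideal (K := K) J'
  rw [hinf, finrank_bot] at hsum
  have htop : V ⊔ J'.restrictScalars K = ⊤ := Submodule.eq_top_of_finrank_eq (by omega)
  have hle' : J'.restrictScalars K ≤ J.restrictScalars K := hle
  exact top_le_iff.1 (htop.ge.trans (sup_le_sup_left hle' V))

theorem spansQuotients_one [FiniteDimensional K A] : SpansQuotients (1 : Submodule K A) 1 := by
  intro J hJ
  refine eq_top_iff.2 fun a _ => ?_
  by_cases htop : J = ⊤
  · exact Submodule.mem_sup_right (htop ▸ Submodule.mem_top)
  have : Nontrivial (A ⧸ J) := Ideal.Quotient.nontrivial_iff.2 htop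
  obtain ⟨c, hc⟩ := exists_smul_eq_of_finrank_eq_one
    (le_antisymm hJ finrank_pos) (one_ne_zero (α := A ⧸ J)) (Ideal.Quotient.mk J a)
  refine Submodule.mem_sup.2 ⟨algebraMap K A c, Submodule.algebraMap_mem c, a - algebraMap K A c,
    Ideal.Quotient.eq.1 ?_, by ring⟩
  rw [← hc, Algebra.smul_def, mul_one]
  rfl

namespace SpansQuotients

variable {n : ℕ}

theorem mono {k m : ℕ} (h : SpansQuotients V k) (hVW : V ≤ W) (hmk : m ≤ k) :
    SpansQuotients W m :=
  fun J hJ => top_le_iff.1 ((h J (hJ.trans hmk)).ge.trans (sup_le_sup_right hVW _))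

variable {B : Type*} [CommRing B] [Algebra K B] {k : ℕ} {φ : A →ₐ[K] B}

theorem map_eq_top (h : SpansQuotients V k) (hφ : Function.Surjective φ) (hB : finrank K B ≤ k) :
    V.map φ.toLinearMap = ⊤ := by
  rw [LinearMap.map_eq_top_iff (LinearMap.range_eq_top.2 hφ)]
  exact h (RingHom.ker φ)
    ((Ideal.quotientKerAlgEquivOfSurjective hφ).toLinearEquiv.finrank_eq.trans_le hB)

theorem map (h : SpansQuotients V k) (hφ : Function.Surjective φ) :
    SpansQuotients (V.map φ.toLinearMap) k := by
  intro J hJ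
  rw [← map_mk_eq_top_iff, ← Submodule.map_comp]
  exact h.map_eq_top (φ := (Ideal.Quotient.mkₐ K J).comp φ)
    ((Ideal.Quotient.mkₐ_surjective K J).comp hφ) hJ

theorem eq_top (h : SpansQuotients V k) (hA : finrank K A ≤ k) : V = ⊤ := by
  simpa using h ⊥ (finrank_quotient_bot.trans_le hA)

variable [IsAlgClosed K] [FiniteDimensional K A]

theorem finrank_quotient_span_lt (h : SpansQuotients V (finrank K V)) {v : A} (hv : v ∈ V)
    (hv0 : v ≠ 0) : finrank K (A ⧸ Ideal.span {v}) < finrank K V := by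
  by_contra! hle
  obtain ⟨J, ⟨hvJ, -⟩, hJ⟩ := exists_ideal_mem_Icc_finrank_quotient_eq
    (le_top : Ideal.span {v} ≤ ⊤) (finrank_quotient_top (K := K).trans_le (Nat.zero_le _)) hle
  have hinf := finrank_inf_add_finrank_quotient (h J hJ.le)
  have hbot : V ⊓ J.restrictScalars K = ⊥ := Submodule.finrank_eq_zero.1 (by omega)
  exact hv0 ((Submodule.eq_bot_iff _).1 hbot v ⟨hv, (Ideal.span_singleton_le_iff_mem _).1 hvJ⟩)

theorem sup_span_eq_top (h : SpansQuotients V (finrank K V)) {v : A} (hv : v ∈ V) (hv0 : v ≠ 0) :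
    V ⊔ (Ideal.span {v}).restrictScalars K = ⊤ :=
  h _ (h.finrank_quotient_span_lt hv hv0).le

-- A section `v ∈ V` vanishing on a subscheme of length `n` of `Spec (A ⧸ J)` leaves a residual
-- subscheme of length at most `n * l + 1`, on which `V ^ l` imposes independent conditions.
theorem pow (h : SpansQuotients V (n + 1)) (hV : finrank K V = n + 1) (h1 : 1 ∈ V) (l : ℕ) :
    SpansQuotients (V ^ l) (n * l + 1) := by
  induction l with
  | zero => simpa using spansQuotients_one
  | succ l ih =>
    intro J hJ
    have hle : V ≤ V ^ (l + 1) := le_self_pow₀ (Submodule.one_le.2 h1) l.succ_ne_zero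
    by_cases hJn : finrank K (A ⧸ J) < n
    · exact h.mono hle le_rfl J (by omega)
    obtain ⟨J₁, ⟨hJJ₁, -⟩, hJ₁⟩ := exists_ideal_mem_Icc_finrank_quotient_eq (le_top : J ≤ ⊤)
      (finrank_quotient_top (K := K).trans_le (Nat.zero_le n)) (not_lt.1 hJn)
    obtain ⟨v, hv, hvJ, hv0⟩ := exists_mem_ideal_of_finrank_lt (V := V) (J := J₁) (by omega)
    have hge : n ≤ finrank K (A ⧸ (J ⊔ Ideal.span {v})) :=
      hJ₁.symm.trans_le (finrank_quotient_le_of_le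
        (sup_le hJJ₁ ((Ideal.span_singleton_le_iff_mem _).2 hvJ)))
    have hcolon := finrank_quotient_colon_add (K := K) J v
    refine sup_eq_top_of_sup_colon_eq_top hle (fun w hw => ?_)
      (sup_span_eq_top (hV ▸ h) hv hv0) (ih _ (by rw [mul_add] at hJ; omega))
    exact pow_succ V l ▸ Submodule.mul_mem_mul hw hv

theorem min_finrank_le (h : SpansQuotients V k) : min k (finrank K A) ≤ finrank K V := by
  obtain ⟨J, -, hJ⟩ := exists_ideal_mem_Icc_finrank_quotient_eq (bot_le : (⊥ : Ideal A) ≤ ⊤)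
    (finrank_quotient_top.trans_le (Nat.zero_le _))
    ((min_le_right k (finrank K A)).trans finrank_quotient_bot.ge)
  have hinf := finrank_inf_add_finrank_quotient (h J (hJ.trans_le (min_le_left _ _)))
  omega

theorem finrank_map (h : SpansQuotients V (finrank K V)) (hφ : Function.Surjective φ)
    (hB : finrank K V ≤ finrank K B) : finrank K (V.map φ.toLinearMap) = finrank K V := by
  have : FiniteDimensional K B := Module.Finite.of_surjective φ.toLinearMap hφ
  refine le_antisymm (Submodule.finrank_map_le _ _) ?_
  have hmin := (h.map hφ).min_finrank_le
  omega

end SpansQuotients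

end FiniteAlgebra

section Pencil

open Polynomial

variable {K : Type*} [Field K] {W W₂ : Type*} [AddCommGroup W] [Module K W]
  [AddCommGroup W₂] [Module K W₂] {F G : W →ₗ[K] W₂}

/-- The pencil of linear maps spanned by `F` and `G` has no eigenvector, neither for a finite
eigenvalue `c` nor for the infinite one. -/
structure HasNoEigenvector (F G : W →ₗ[K] W₂) : Prop where
  injective : Function.Injective F
  eq_zero : ∀ (c : K) (w : W), G w = c • F w → w = 0

/-- The first `m` terms of `x` are a chain of the pencil spanned by `F` and `G`: the sequence
`x 0, …, x (m - 1)` is a polynomial `∑ x i * t ^ i` in the kernel of `F - t * G`, up to its terms of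
degree `0` and `m`. -/
def IsChain (F G : W →ₗ[K] W₂) (m : ℕ) (x : ℕ → W) : Prop :=
  ∀ i, i + 1 < m → F (x (i + 1)) = G (x i)

/-- The linear map sending `X ^ i` to `x i` for `i < m` and to `0` for `m ≤ i`. -/
noncomputable def evalSeq (x : ℕ → W) (m : ℕ) : K[X] →ₗ[K] W :=
  ∑ i ∈ Finset.range m, (lcoeff K i).smulRight (x i)

theorem evalSeq_apply (x : ℕ → W) (m : ℕ) (p : K[X]) :
    evalSeq x m p = ∑ i ∈ Finset.range m, p.coeff i • x i := by
  simp [evalSeq, LinearMap.sum_apply]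

theorem evalSeq_X_pow (x : ℕ → W) {m k : ℕ} (hk : k < m) : evalSeq x m (X ^ k : K[X]) = x k := by
  simp [evalSeq_apply, coeff_X_pow, hk]

-- The kernel of the map sending `x` to the differences `F (x (i + 1)) - G (x i)` is nonzero for
-- dimension reasons.
theorem exists_isChain [FiniteDimensional K W] [FiniteDimensional K W₂] (hW : 0 < finrank K W)
    (hFG : finrank K ↥(LinearMap.range F ⊔ LinearMap.range G) ≤ finrank K W + 1) :
    ∃ x : ℕ → W, IsChain F G (finrank K W) x ∧ ∃ i < finrank K W, x i ≠ 0 := by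
  obtain ⟨k, hk⟩ : ∃ k, finrank K W = k + 1 := ⟨finrank K W - 1, by omega⟩
  let T := LinearMap.range F ⊔ LinearMap.range G
  let F' : W →ₗ[K] T := F.codRestrict T fun w => Submodule.mem_sup_left ⟨w, rfl⟩
  let G' : W →ₗ[K] T := G.codRestrict T fun w => Submodule.mem_sup_right ⟨w, rfl⟩
  let Ψ : (Fin (k + 1) → W) →ₗ[K] (Fin k → T) := LinearMap.pi fun i =>
    F' ∘ₗ LinearMap.proj i.succ - G' ∘ₗ LinearMap.proj i.castSucc
  have hker : LinearMap.ker Ψ ≠ ⊥ := by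
    refine LinearMap.ker_ne_bot_of_finrank_lt ?_
    simp only [finrank_pi_fintype, Finset.sum_const, Finset.card_univ, Fintype.card_fin,
      smul_eq_mul, hk]
    calc k * finrank K T ≤ k * (k + 1 + 1) := Nat.mul_le_mul_left _ (hk ▸ hFG)
      _ < (k + 1) * (k + 1) := by nlinarith
  obtain ⟨u, hu, hu0⟩ := Submodule.exists_mem_ne_zero_of_ne_bot hker
  obtain ⟨i, hi⟩ := Function.ne_iff.1 hu0
  let x : ℕ → W := fun i => if h : i < k + 1 then u ⟨i, h⟩ else 0
  have hx : ∀ i (h : i < k + 1), x i = u ⟨i, h⟩ := fun i h => dif_pos h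
  refine ⟨x, fun j hj => ?_, i, i.2.trans_eq hk.symm, by rwa [hx i i.2]⟩
  have hΨ : Ψ u ⟨j, by omega⟩ = 0 := by rw [LinearMap.mem_ker.1 hu, Pi.zero_apply]
  rw [hx _ (by omega), hx _ (by omega)]
  exact sub_eq_zero.1 (congrArg Subtype.val hΨ)

namespace IsChain

variable {m n : ℕ} {x : ℕ → W}

theorem map_evalSeq (h : IsChain F G (m + 1) x) (p : K[X]) :
    G (evalSeq x (m + 1) p) = F (evalSeq x (m + 1) (X * p)) + p.coeff m • G (x m) := by
  rw [evalSeq_apply, evalSeq_apply, Finset.sum_range_succ, Finset.sum_range_succ']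
  simp only [coeff_X_mul, coeff_X_mul_zero, zero_smul, add_zero, map_add, map_sum, map_smul]
  exact congrArg (· + _)
    (Finset.sum_congr rfl fun i hi => by rw [h i (by simpa using hi)])

theorem ne_zero (h : IsChain F G m x) (hF : Function.Injective F) (hx : ∃ i < m, x i ≠ 0) :
    x 0 ≠ 0 := by
  intro h0
  have hzero : ∀ i < m, x i = 0 := by
    intro i
    induction i with
    | zero => exact fun _ => h0
    | succ i ih => exact fun hi => hF (by rw [h i hi, ih (by omega), map_zero, map_zero])
  obtain ⟨i, hi, hxi⟩ := hx
  exact hxi (hzero i hi)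

variable [IsAlgClosed K]

-- If `p = (X - c) * r` is sent to `0`, then `r` is sent to an eigenvector for `c`.
theorem eq_zero_of_evalSeq_eq_zero (h : IsChain F G (m + 1) x) (hFG : HasNoEigenvector F G)
    (hx : x 0 ≠ 0) {p : K[X]} (hpm : p.natDegree < m + 1) (hp : evalSeq x (m + 1) p = 0) :
    p = 0 := by
  induction hk : p.natDegree generalizing p with
  | zero =>
    rw [eq_C_of_natDegree_eq_zero hk] at hp ⊢
    rw [evalSeq_apply, Finset.sum_range_succ'] at hp
    have : p.coeff 0 = 0 := by simpa [coeff_C, hx] using hp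
    rw [this, C_0]
  | succ k ih =>
    have hpos : 0 < p.natDegree := by omega
    obtain ⟨c, hc⟩ := IsAlgClosed.exists_root p (natDegree_pos_iff_degree_pos.1 hpos).ne'
    obtain ⟨r, rfl⟩ := dvd_iff_isRoot.2 hc
    have hr0 : r ≠ 0 := by rintro rfl; simp at hk
    have hdeg : r.natDegree = k := by
      rw [natDegree_mul (X_sub_C_ne_zero c) hr0, natDegree_X_sub_C] at hk
      omega
    have hr : evalSeq x (m + 1) r = 0 := by
      refine hFG.eq_zero c _ ?_
      rw [h.map_evalSeq, coeff_eq_zero_of_natDegree_lt (by omega), zero_smul, add_zero,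
        ← sub_eq_zero, ← map_smul, ← map_smul, ← map_sub, ← map_sub, smul_eq_C_mul, ← sub_mul, hp,
        map_zero]
    exact absurd (ih (by omega) hr hdeg) hr0

theorem linearIndependent (h : IsChain F G m x) (hFG : HasNoEigenvector F G) (hx : x 0 ≠ 0) :
    LinearIndependent K fun i : Fin m => x i := by
  obtain _ | m := m
  · exact linearIndependent_empty_type
  have hinj : LinearMap.ker (evalSeq x (m + 1) ∘ₗ (degreeLT K (m + 1)).subtype) = ⊥ :=
    LinearMap.ker_eq_bot'.2 fun p hp => Subtype.ext <| h.eq_zero_of_evalSeq_eq_zero hFG hx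
      (Nat.lt_succ_of_le (natDegree_le_of_degree_le
        (Order.lt_succ_iff.1 (mem_degreeLT.1 p.2)))) hp
  have heval : (evalSeq x (m + 1) ∘ₗ (degreeLT K (m + 1)).subtype) ∘ degreeLT.basis K (m + 1) =
      fun i : Fin (m + 1) => x i :=
    funext fun i => (congrArg _ (degreeLT.basis_val i)).trans (evalSeq_X_pow x i.2)
  exact heval ▸ (degreeLT.basis K (m + 1)).linearIndependent.map' _ hinj

variable [FiniteDimensional K W]

theorem le_finrank (h : IsChain F G m x) (hFG : HasNoEigenvector F G) (hx : x 0 ≠ 0) :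
    m ≤ finrank K W := by
  simpa using (h.linearIndependent hFG hx).fintype_card_le_finrank

theorem map_ne_of_succ_eq_finrank (h : IsChain F G (m + 1) x) (hFG : HasNoEigenvector F G)
    (hx : x 0 ≠ 0) (hm : m + 1 = finrank K W) (t : W) : F t ≠ G (x m) := by
  intro ht
  have hlong : IsChain F G (m + 2) (Function.update x (m + 1) t) := by
    intro i hi
    obtain rfl | hi : i = m ∨ i < m := by omega
    · simpa using ht
    · simpa [Function.update_of_ne (show i + 1 ≠ m + 1 by omega),
        Function.update_of_ne (show i ≠ m + 1 by omega)] using h i (by omega)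
  have := hlong.le_finrank hFG (by simpa using hx)
  omega

variable {y z : ℕ → W}

theorem span_range_eq_top (hy : IsChain F G (finrank K W) y) (hFG : HasNoEigenvector F G)
    (hy0 : y 0 ≠ 0) : Submodule.span K (Set.range fun i : Fin (finrank K W) => y i) = ⊤ :=
  (hy.linearIndependent hFG hy0).span_eq_top_of_card_eq_finrank' (Fintype.card_fin _)

theorem exists_evalSeq_eq (hy : IsChain F G (finrank K W) y) (hFG : HasNoEigenvector F G)
    (hy0 : y 0 ≠ 0) (w : W) :
    ∃ p ∈ degreeLT K (finrank K W), evalSeq y (finrank K W) p = w := by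
  have hle : ⊤ ≤ (degreeLT K (finrank K W)).map (evalSeq y (finrank K W)) := by
    rw [← hy.span_range_eq_top hFG hy0, Submodule.span_le]
    rintro _ ⟨i, rfl⟩
    exact ⟨X ^ (i : ℕ), mem_degreeLT.2 (by simp), evalSeq_X_pow y i.2⟩
  exact hle (Submodule.mem_top (x := w))

-- If the degree of `X ^ i * p` reached `finrank K W - 1` too early, then `y` could be extended to a
-- chain longer than the dimension of the space.
theorem eq_evalSeq_X_pow_mul (hy : IsChain F G (finrank K W) y) (hz : IsChain F G m z)
    (hFG : HasNoEigenvector F G) (hy0 : y 0 ≠ 0) {p : K[X]} (hp : p ∈ degreeLT K (finrank K W))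
    (hpz : z 0 = evalSeq y (finrank K W) p) {i : ℕ} (hi : i < m) :
    X ^ i * p ∈ degreeLT K (finrank K W) ∧ z i = evalSeq y (finrank K W) (X ^ i * p) := by
  induction i with
  | zero => simpa using ⟨hp, hpz⟩
  | succ i ih =>
    obtain ⟨hdeg, hzi⟩ := ih (by omega)
    have : Nontrivial W := ⟨_, _, hy0⟩
    obtain ⟨k, hk⟩ : ∃ k, finrank K W = k + 1 := Nat.exists_eq_succ_of_ne_zero finrank_pos.ne'
    have hy' : IsChain F G (k + 1) y := hk ▸ hy
    set s := X ^ i * p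
    rw [pow_succ', mul_assoc]
    have hdiff : F (z (i + 1) - evalSeq y (finrank K W) (X * s)) = s.coeff k • G (y k) := by
      rw [map_sub, hz i hi, hzi, hk, hy'.map_evalSeq, add_sub_cancel_left]
    have hcoeff : s.coeff k = 0 := by
      by_contra hc
      refine hy'.map_ne_of_succ_eq_finrank hFG hy0 hk.symm
        ((s.coeff k)⁻¹ • (z (i + 1) - evalSeq y (finrank K W) (X * s))) ?_
      rw [map_smul, hdiff, inv_smul_smul₀ hc]
    rw [hcoeff, zero_smul] at hdiff
    refine ⟨?_, sub_eq_zero.1 (hFG.injective (hdiff.trans (map_zero F).symm))⟩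
    rw [hk, mem_degreeLT, degree_lt_iff_coeff_zero] at hdeg ⊢
    intro j hj
    obtain ⟨j, rfl⟩ : ∃ j', j = j' + 1 := ⟨j - 1, by omega⟩
    rw [coeff_X_mul]
    obtain rfl | hlt : j = k ∨ k + 1 ≤ j := by omega
    exacts [hcoeff, hdeg j hlt]

theorem mem_range_of_forall_exists_isChain {U : Type*} [AddCommGroup U] [Module K U]
    (hy : IsChain F G (finrank K W) y) (hFG : HasNoEigenvector F G)
    (hy0 : y 0 ≠ 0) {μ : U →ₗ[K] W} (hμ : Function.Injective μ) (hU : finrank K U = n + 1)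
    (hW : finrank K W = m + 1 + n) (hchain : ∀ u, ∃ z, IsChain F G (m + 1) z ∧ z 0 = μ u)
    {j : ℕ} (hj : j ≤ n) : y j ∈ LinearMap.range μ := by
  let ev : degreeLT K (n + 1) →ₗ[K] W := evalSeq y (finrank K W) ∘ₗ (degreeLT K (n + 1)).subtype
  have hle : LinearMap.range μ ≤ LinearMap.range ev := by
    rintro _ ⟨u, rfl⟩
    obtain ⟨z, hz, hzu⟩ := hchain u
    obtain ⟨p, hp, hpu⟩ := hy.exists_evalSeq_eq hFG hy0 (μ u)
    obtain ⟨hdeg, -⟩ := hy.eq_evalSeq_X_pow_mul hz hFG hy0 hp (hzu.trans hpu.symm) m.lt_succ_self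
    refine ⟨⟨p, ?_⟩, hpu⟩
    rw [mem_degreeLT, degree_lt_iff_coeff_zero] at hdeg ⊢
    exact fun i hi => coeff_X_pow_mul p m i ▸ hdeg (i + m) (by omega)
  have heq : LinearMap.range μ = LinearMap.range ev := by
    refine Submodule.eq_of_le_of_finrank_le hle ((LinearMap.finrank_range_le ev).trans ?_)
    rw [LinearMap.finrank_range_of_inj hμ, hU, (degreeLTEquiv K (n + 1)).finrank_eq,
      finrank_fin_fun]
  rw [heq]
  exact ⟨⟨X ^ j, mem_degreeLT.2 (by simpa using Nat.cast_lt.2 (Nat.lt_succ_of_le hj))⟩,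
    evalSeq_X_pow y (by omega)⟩

end IsChain

end Pencil

section Castelnuovo

variable {K : Type*} [Field K] {A : Type*} [CommRing A] [Algebra K A] {V W : Submodule K A}
  {n q l : ℕ}

/-- No nonzero ideal of `A` is contained in `W`. For `W = V ^ q` with `Spec A` a finite scheme in
projective space and `V` the linear forms on it, this is a Cayley–Bacharach property in degree
`q`. -/
def HasTrivialConductor (W : Submodule K A) : Prop :=
  ∀ J : Ideal A, J.restrictScalars K ≤ W → J = ⊥

/-- The nonzero elements of `V` act injectively from `V ^ l` to `V ^ (l + 1)` for `l < q`. -/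
def CancelsBelow (V : Submodule K A) (q : ℕ) : Prop :=
  ∀ l < q, ∀ v ∈ V, v ≠ 0 → ∀ x ∈ V ^ l, v * x = 0 → x = 0

theorem HasTrivialConductor.eq_zero_of_mul_eq_zero (hW : HasTrivialConductor W) {v x : A}
    (hv : V ⊔ (Ideal.span {v}).restrictScalars K = ⊤) (hx : ∀ w ∈ V, w * x ∈ W)
    (hvx : v * x = 0) : x = 0 := by
  refine Ideal.span_singleton_eq_bot.1 (hW _ fun y hy => ?_)
  obtain ⟨a, rfl⟩ := Ideal.mem_span_singleton'.1 hy
  obtain ⟨w, hw, b, rfl⟩ := exists_mem_add_mul_mem hv a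
  rw [add_mul, mul_assoc, hvx, mul_zero, add_zero]
  exact hx w hw

theorem SpansQuotients.cancelsBelow [IsAlgClosed K] [FiniteDimensional K A]
    (h : SpansQuotients V (finrank K V)) (h1 : 1 ∈ V) (hq : HasTrivialConductor (V ^ q)) :
    CancelsBelow V q := by
  refine fun l hl v hv hv0 x hx hvx => hq.eq_zero_of_mul_eq_zero (h.sup_span_eq_top hv hv0)
    (fun w hw => ?_) hvx
  exact pow_le_pow_right₀ (Submodule.one_le.2 h1) hl (pow_succ' V l ▸ Submodule.mul_mem_mul hw hx)

theorem SpansQuotients.finrank_pow_add_le [IsAlgClosed K] [FiniteDimensional K A]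
    (h : SpansQuotients V n) (hV : n < finrank K V) (h1 : 1 ∈ V) (hq : CancelsBelow V q)
    (hA : n ≤ finrank K A) (hl : l < q) : finrank K ↥(V ^ l) + n ≤ finrank K ↥(V ^ (l + 1)) := by
  obtain ⟨J, -, hJ⟩ := exists_ideal_mem_Icc_finrank_quotient_eq (bot_le : (⊥ : Ideal A) ≤ ⊤)
    (finrank_quotient_top.trans_le (Nat.zero_le _)) (hA.trans finrank_quotient_bot.ge)
  obtain ⟨v, hv, hvJ, hv0⟩ := exists_mem_ideal_of_finrank_lt (hJ.trans_lt hV)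
  have hsup := h.mono (le_self_pow₀ (Submodule.one_le.2 h1) l.succ_ne_zero) le_rfl J hJ.le
  let f : ↥(V ^ l) →ₗ[K] ↥(V ^ (l + 1) ⊓ J.restrictScalars K) :=
    (LinearMap.mulLeft K v ∘ₗ (V ^ l).subtype).codRestrict _ fun x =>
      ⟨pow_succ' V l ▸ Submodule.mul_mem_mul hv x.2, J.mul_mem_right _ hvJ⟩
  have hf : Function.Injective f := LinearMap.ker_eq_bot.1 <| LinearMap.ker_eq_bot'.2 fun x hx =>
    Subtype.ext (hq l hl v hv hv0 x x.2 (congrArg Subtype.val hx))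
  rw [← finrank_inf_add_finrank_quotient hsup, hJ]
  exact Nat.add_le_add_right (LinearMap.finrank_le_finrank_of_injective hf) n

theorem exists_consecutive_minimal_steps {a : ℕ → ℕ} (h0 : a 0 = 1)
    (hstep : ∀ l < q, a l + n ≤ a (l + 1)) (hnq : 2 * n ≤ q) (hq : a q ≤ n * q + n) :
    ∃ l, l + 2 ≤ q ∧ a (l + 1) = a l + n ∧ a (l + 2) = a (l + 1) + n := by
  by_contra! hcon
  have hgrow : ∀ k, 2 * k ≤ q → (2 * n + 1) * k + 1 ≤ a (2 * k) := by
    intro k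
    induction k with
    | zero => simp [h0]
    | succ k ih =>
      intro hk
      have := ih (by omega)
      have := hstep (2 * k) (by omega)
      have : a (2 * k + 1) + n ≤ a (2 * k + 2) := hstep (2 * k + 1) (by omega)
      have := hcon (2 * k) hk
      rw [Nat.mul_succ, Nat.mul_succ]
      omega
  have hlast : ∀ m, 2 * n + m ≤ q → a (2 * n) + n * m ≤ a (2 * n + m) := by
    intro m
    induction m with
    | zero => simp
    | succ m ih =>
      intro hm
      have := ih (by omega)
      have := hstep (2 * n + m) (by omega)
      rw [← add_assoc, mul_add]
      omega
  obtain ⟨m, rfl⟩ := Nat.exists_eq_add_of_le hnq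
  have := hlast m le_rfl
  have := hgrow n (by omega)
  nlinarith

theorem exists_mem_forall_ne_smul {P : Submodule K A} (hP : 2 ≤ finrank K P) :
    ∃ f ∈ P, ∃ g ∈ P, f ≠ 0 ∧ ∀ c : K, g - c • f ≠ 0 := by
  obtain ⟨b, hb⟩ := exists_linearIndependent_of_le_finrank hP
  have hne : ∀ c : K, b 1 - c • b 0 ≠ 0 := by
    intro c hc
    have hpair : LinearIndependent K ![b 0, b 1] := by
      convert hb using 1
      ext i
      fin_cases i <;> rfl
    exact one_ne_zero (LinearIndependent.pair_iff.1 hpair (-c) 1 (by rw [← hc]; module)).2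
  exact ⟨b 0, (b 0).2, b 1, (b 1).2, Subtype.coe_ne_coe.2 (hb.ne_zero 0),
    fun c hc => hne c (Subtype.ext hc)⟩

theorem exists_mem_ideal_forall_ne_smul [IsAlgClosed K] [FiniteDimensional K A] {k : ℕ}
    (hV : k + 2 ≤ finrank K V) (hA : k ≤ finrank K A) :
    ∃ Z : Ideal A, finrank K (A ⧸ Z) = k ∧ ∃ f ∈ V ⊓ Z.restrictScalars K,
      ∃ g ∈ V ⊓ Z.restrictScalars K, f ≠ 0 ∧ ∀ c : K, g - c • f ≠ 0 := by
  obtain ⟨Z, -, hZ⟩ := exists_ideal_mem_Icc_finrank_quotient_eq (bot_le : (⊥ : Ideal A) ≤ ⊤)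
    (finrank_quotient_top.trans_le (Nat.zero_le _)) (hA.trans finrank_quotient_bot.ge)
  have hsum := Submodule.finrank_sup_add_finrank_inf_eq V (Z.restrictScalars K)
  have := (V ⊔ Z.restrictScalars K).finrank_le
  have := finrank_quotient_add_finrank_ideal (K := K) Z
  exact ⟨Z, hZ, exists_mem_forall_ne_smul (by omega)⟩

/-- Multiplication by `f`, as a linear map on the subspace `W` of `A`. -/
def mulOn (f : A) (W : Submodule K A) : W →ₗ[K] A := LinearMap.mulLeft K f ∘ₗ W.subtype

variable {f g : A}

theorem CancelsBelow.hasNoEigenvector_mulOn (hq : CancelsBelow V q) (hl : l < q) (hf : f ∈ V)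
    (hg : g ∈ V) (hf0 : f ≠ 0) (hfg : ∀ c : K, g - c • f ≠ 0) :
    HasNoEigenvector (mulOn f (V ^ l)) (mulOn g (V ^ l)) where
  injective := LinearMap.ker_eq_bot.1 <| LinearMap.ker_eq_bot'.2 fun x hx =>
    Subtype.ext (hq l hl f hf hf0 x x.2 hx)
  eq_zero c w hw := by
    refine Subtype.ext
      (hq l hl _ (V.sub_mem hg (V.smul_mem c hf)) (hfg c) w w.2 ?_)
    have hw' : g * (w : A) = c • (f * (w : A)) := hw
    rw [sub_mul, hw', smul_mul_assoc, sub_self]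

theorem finrank_range_mulOn_sup_add_le [FiniteDimensional K A] {Z : Ideal A}
    (hf : f ∈ V ⊓ Z.restrictScalars K) (hg : g ∈ V ⊓ Z.restrictScalars K)
    (hZ : V ^ (l + 1) ⊔ Z.restrictScalars K = ⊤) :
    finrank K ↥(LinearMap.range (mulOn f (V ^ l)) ⊔ LinearMap.range (mulOn g (V ^ l))) +
      finrank K (A ⧸ Z) ≤ finrank K ↥(V ^ (l + 1)) := by
  have hrange : ∀ u ∈ V ⊓ Z.restrictScalars K,
      LinearMap.range (mulOn u (V ^ l)) ≤ V ^ (l + 1) ⊓ Z.restrictScalars K := by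
    rintro u hu _ ⟨x, rfl⟩
    exact ⟨pow_succ' V l ▸ Submodule.mul_mem_mul hu.1 x.2, Z.mul_mem_right _ hu.2⟩
  rw [← finrank_inf_add_finrank_quotient hZ]
  exact Nat.add_le_add_right (Submodule.finrank_mono (sup_le (hrange f hf) (hrange g hg))) _

theorem exists_isChain_mulOn [Nontrivial A] [FiniteDimensional K A] {Z : Ideal A} (h1 : 1 ∈ V)
    (hinj : Function.Injective (mulOn f (V ^ l))) (hf : f ∈ V ⊓ Z.restrictScalars K)
    (hg : g ∈ V ⊓ Z.restrictScalars K) (hZ : V ^ (l + 1) ⊔ Z.restrictScalars K = ⊤)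
    (hdim : finrank K ↥(V ^ (l + 1)) ≤ finrank K ↥(V ^ l) + finrank K (A ⧸ Z) + 1) :
    ∃ x, IsChain (mulOn f (V ^ l)) (mulOn g (V ^ l)) (finrank K ↥(V ^ l)) x ∧ x 0 ≠ 0 := by
  have h1l : (1 : A) ∈ V ^ l := one_pow (M := A) l ▸ Submodule.pow_mem_pow V h1 l
  have : Nontrivial ↥(V ^ l) := ⟨⟨1, h1l⟩, 0, fun e => one_ne_zero (congrArg Subtype.val e)⟩
  have := finrank_range_mulOn_sup_add_le hf hg hZ
  obtain ⟨x, hx, hx0⟩ :=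
    exists_isChain (F := mulOn f (V ^ l)) (G := mulOn g (V ^ l)) finrank_pos (by omega)
  exact ⟨x, hx, hx.ne_zero hinj hx0⟩

variable {x : ℕ → ↥(V ^ l)} {y : ℕ → ↥(V ^ (l + 1))} {v : ℕ → A}

theorem CancelsBelow.exists_mul_eq [IsAlgClosed K] [FiniteDimensional K A]
    (hq : CancelsBelow V q) (hl : l < q)
    (hV : finrank K V = n + 1) (hdim : finrank K ↥(V ^ (l + 1)) = finrank K ↥(V ^ l) + n)
    (hFG : HasNoEigenvector (mulOn f (V ^ (l + 1))) (mulOn g (V ^ (l + 1))))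
    (hx : IsChain (mulOn f (V ^ l)) (mulOn g (V ^ l)) (finrank K ↥(V ^ l)) x) (hx0 : x 0 ≠ 0)
    (hy : IsChain (mulOn f (V ^ (l + 1))) (mulOn g (V ^ (l + 1))) (finrank K ↥(V ^ (l + 1))) y)
    (hy0 : y 0 ≠ 0) : ∃ v : ℕ → A, (∀ j, v j ∈ V) ∧ ∀ j ≤ n, v j * x 0 = y j := by
  have : Nontrivial ↥(V ^ l) := ⟨_, _, hx0⟩
  obtain ⟨m, hm⟩ : ∃ m, finrank K ↥(V ^ l) = m + 1 :=
    Nat.exists_eq_succ_of_ne_zero finrank_pos.ne'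
  let z : V → ℕ → ↥(V ^ (l + 1)) := fun v i =>
    ⟨v * x i, pow_succ' V l ▸ Submodule.mul_mem_mul v.2 (x i).2⟩
  have hz : ∀ v, IsChain (mulOn f (V ^ (l + 1))) (mulOn g (V ^ (l + 1))) (m + 1) (z v) := by
    intro v i hi
    have hxi : f * (x (i + 1) : A) = g * (x i : A) := hx i (hm ▸ hi)
    change f * (v * (x (i + 1) : A)) = g * (v * (x i : A))
    linear_combination (v : A) * hxi
  let μ : V →ₗ[K] ↥(V ^ (l + 1)) :=
    (LinearMap.mulRight K (x 0 : A) ∘ₗ V.subtype).codRestrict _ fun v => (z v 0).2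
  have hμ : Function.Injective μ := by
    refine LinearMap.ker_eq_bot.1 (LinearMap.ker_eq_bot'.2 fun v hv => by_contra fun hv0 => ?_)
    exact hx0 (Subtype.ext (hq l hl v v.2 (by simpa using hv0) _ (x 0).2 (congrArg Subtype.val hv)))
  have hex : ∀ j, ∃ v : V, j ≤ n → μ v = y j := fun j => by
    by_cases hj : j ≤ n
    · obtain ⟨v, hv⟩ := hy.mem_range_of_forall_exists_isChain hFG hy0 hμ hV (hm ▸ hdim)
        (fun v => ⟨z v, hz v, rfl⟩) hj
      exact ⟨v, fun _ => hv⟩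
    · exact ⟨0, fun h => absurd h hj⟩
  choose v hv using hex
  exact ⟨fun j => v j, fun j => (v j).2, fun j hj => congrArg Subtype.val (hv j hj)⟩

theorem mul_eq_of_isChain {w : ℕ} (hf : Function.Injective (mulOn f (V ^ (l + 1))))
    (hx : IsChain (mulOn f (V ^ l)) (mulOn g (V ^ l)) w x)
    (hy : IsChain (mulOn f (V ^ (l + 1))) (mulOn g (V ^ (l + 1))) (w + n) y)
    (hv : ∀ j, v j ∈ V) (hvx : ∀ j ≤ n, v j * x 0 = y j) {i j : ℕ} (hi : i < w) (hj : j ≤ n) :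
    v j * x i = y (i + j) := by
  induction i with
  | zero => rw [hvx j hj, zero_add]
  | succ i ih =>
    have hxi : f * (x (i + 1) : A) = g * (x i : A) := hx i hi
    have hyi : f * (y (i + j + 1) : A) = g * (y (i + j) : A) := hy (i + j) (by omega)
    have hmem : v j * x (i + 1) ∈ V ^ (l + 1) :=
      pow_succ' V l ▸ Submodule.mul_mem_mul (hv j) (x (i + 1)).2
    have hmul : f * (v j * x (i + 1)) = f * (y (i + 1 + j) : A) := by
      rw [add_right_comm, hyi, ← ih (by omega)]
      linear_combination v j * hxi
    exact congrArg Subtype.val (@hf ⟨_, hmem⟩ (y (i + 1 + j)) hmul)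

theorem mul_succ_eq_of_isChain {w : ℕ} (hx : Submodule.span K (Set.range fun i : Fin w => x i) = ⊤)
    (h1 : 1 ∈ V) (hy : IsChain (mulOn f (V ^ (l + 1))) (mulOn g (V ^ (l + 1))) (w + n) y)
    (hvx : ∀ i < w, ∀ j ≤ n, v j * x i = y (i + j)) {j : ℕ} (hj : j < n) :
    f * v (j + 1) = g * v j := by
  have heq : mulOn (f * v (j + 1)) (V ^ l) = mulOn (g * v j) (V ^ l) := by
    refine LinearMap.ext_on hx ?_
    rintro _ ⟨i, rfl⟩
    have hyi : f * (y (i + j + 1) : A) = g * (y (i + j) : A) := hy (i + j) (by omega)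
    change f * v (j + 1) * x i = g * v j * x i
    rw [mul_assoc, mul_assoc, hvx _ i.2 _ hj, hvx _ i.2 _ hj.le, ← hyi, add_assoc]
  have h1l : (1 : A) ∈ V ^ l := one_pow (M := A) l ▸ Submodule.pow_mem_pow V h1 l
  simpa [mulOn] using LinearMap.congr_fun heq ⟨1, h1l⟩

theorem linearIndependent_of_mul_eq {u v : ℕ → A} {k m : ℕ} {c : A}
    (hu : LinearIndependent K fun i : Fin m => u i) (hkm : k ≤ m)
    (huv : ∀ i < k, v i * c = u i) : LinearIndependent K fun i : Fin k => v i := by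
  refine LinearIndependent.of_comp (LinearMap.mulRight K c) ?_
  have hcomp : (LinearMap.mulRight K c ∘ fun i : Fin k => v i) =
      (fun i : Fin m => u i) ∘ Fin.castLE hkm := funext fun i => huv i i.2
  exact hcomp ▸ hu.comp _ (Fin.castLE_injective hkm)

-- The Hilbert function `l ↦ finrank (V ^ l)` is so small that it grows by the minimal amount `n`
-- twice in a row. There the pencil of multiplications by two elements of `V` vanishing on a
-- subscheme of length `n - 1` consists of a single Kronecker block, which parametrizes `V`.
theorem SpansQuotients.exists_linearIndependent_mul_eq_mul [IsAlgClosed K] [FiniteDimensional K A]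
    (h : SpansQuotients V (n + 1)) (hV : finrank K V = n + 1) (h1 : 1 ∈ V) (hn : 1 ≤ n)
    (hq : HasTrivialConductor (V ^ q)) (hA : n + 1 ≤ finrank K A)
    (hnq : 2 * n ≤ q) (hq3 : 3 ≤ q) (hdim : finrank K ↥(V ^ q) ≤ n * q + n) :
    ∃ v : ℕ → A, (∀ i ≤ n, v i ∈ V) ∧ (LinearIndependent K fun i : Fin (n + 1) => v i) ∧
      ∀ i < n, ∀ j < n, v i * v (j + 1) = v (i + 1) * v j := by
  have hspan : SpansQuotients V (finrank K V) := hV ▸ h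
  have hcancel := hspan.cancelsBelow h1 hq
  have hle : ∀ l, V ≤ V ^ (l + 1) := fun l => le_self_pow₀ (Submodule.one_le.2 h1) l.succ_ne_zero
  have hnt : Nontrivial A := nontrivial_of_finrank_pos (R := K) (by omega)
  obtain ⟨l, hl, hl₁, hl₂⟩ := exists_consecutive_minimal_steps (a := fun l => finrank K ↥(V ^ l))
    (by rw [pow_zero, Submodule.one_eq_span, finrank_span_singleton one_ne_zero])
    (fun l hl => (h.mono le_rfl n.le_succ).finrank_pow_add_le (by omega) h1 hcancel (by omega) hl)
    hnq hdim
  obtain ⟨Z, hZ, f, hf, g, hg, hf0, hfg⟩ :=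
    exists_mem_ideal_forall_ne_smul (K := K) (V := V) (k := n - 1) (by omega) (by omega)
  have hFG : ∀ k < q, HasNoEigenvector (mulOn f (V ^ k)) (mulOn g (V ^ k)) := fun k hk =>
    hcancel.hasNoEigenvector_mulOn hk hf.1 hg.1 hf0 hfg
  have hchain : ∀ k < q, finrank K ↥(V ^ (k + 1)) = finrank K ↥(V ^ k) + n → ∃ x,
      IsChain (mulOn f (V ^ k)) (mulOn g (V ^ k)) (finrank K ↥(V ^ k)) x ∧ x 0 ≠ 0 :=
    fun k hk hdim => exists_isChain_mulOn h1 (hFG k hk).injective hf hg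
      (h.mono (hle k) le_rfl Z (by omega)) (by omega)
  obtain ⟨x, hx, hx0⟩ := hchain l (by omega) hl₁
  obtain ⟨y, hy, hy0⟩ := hchain (l + 1) (by omega) hl₂
  have hFG' := hFG (l + 1) (by omega)
  obtain ⟨v, hv, hvx⟩ := hcancel.exists_mul_eq (by omega) hV hl₁ hFG' hx hx0 hy hy0
  have hli : LinearIndependent K fun i : Fin (finrank K ↥(V ^ (l + 1))) => (y i : A) :=
    (hy.linearIndependent hFG' hy0).map' _ (Submodule.ker_subtype _)
  have hpos : 0 < finrank K ↥(V ^ l) := finrank_pos_iff_exists_ne_zero.2 ⟨_, hx0⟩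
  rw [hl₁] at hy
  have hrel : ∀ j < n, f * v (j + 1) = g * v j := fun j hj =>
    mul_succ_eq_of_isChain (hx.span_range_eq_top (hFG l (by omega)) hx0) h1 hy
      (fun i hi j hj => mul_eq_of_isChain hFG'.injective hx hy hv hvx hi hj) hj
  refine ⟨v, fun i _ => hv i, ?_, fun i hi j hj => sub_eq_zero.1 ?_⟩
  · exact linearIndependent_of_mul_eq (u := fun j => (y j : A)) (c := (x 0 : A)) hli
      (by omega) fun j hj => hvx j (by omega)
  · refine hcancel 2 (by omega) f hf.1 hf0 _ ?_
      (by linear_combination v i * hrel j hj - v j * hrel i hi)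
    rw [pow_two]
    exact Submodule.sub_mem _ (Submodule.mul_mem_mul (hv i) (hv (j + 1)))
      (Submodule.mul_mem_mul (hv (i + 1)) (hv j))

theorem exists_hasTrivialConductor_map_quotient [IsNoetherianRing A] (hW : W ≠ ⊤) :
    ∃ J : Ideal A, W.map (Ideal.Quotient.mkₐ K J).toLinearMap ≠ ⊤ ∧
      HasTrivialConductor (W.map (Ideal.Quotient.mkₐ K J).toLinearMap) := by
  obtain ⟨J, hJ, hmax⟩ := set_has_maximal_iff_noetherian.2 ‹IsNoetherianRing A›
    {J : Ideal A | W ⊔ J.restrictScalars K ≠ ⊤} ⟨⊥, by simpa using hW⟩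
  refine ⟨J, map_mk_eq_top_iff.not.2 hJ, fun J' hJ' => ?_⟩
  have hle : J ≤ J'.comap (Ideal.Quotient.mk J) := fun x hx => by
    rw [Ideal.mem_comap, Ideal.Quotient.eq_zero_iff_mem.2 hx]
    exact zero_mem J'
  have hcomap : (J'.comap (Ideal.Quotient.mk J)).restrictScalars K ≤ W ⊔ J.restrictScalars K := by
    intro x hx
    obtain ⟨w, hw, hwx⟩ := hJ' hx
    have hsub : x - w ∈ J := Ideal.Quotient.eq.1 hwx.symm
    exact Submodule.mem_sup.2 ⟨w, hw, x - w, hsub, add_sub_cancel w x⟩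
  have heq : J = J'.comap (Ideal.Quotient.mk J) := hle.eq_of_not_lt
    (hmax _ fun htop => hJ (top_le_iff.1 (htop.ge.trans (sup_le le_sup_left hcomap))))
  rw [← Ideal.map_comap_of_surjective _ Ideal.Quotient.mk_surjective J', ← heq,
    Ideal.map_quotient_self]

theorem SpansQuotients.exists_quotient_linearIndependent_mul_eq_mul [IsAlgClosed K]
    [FiniteDimensional K A] (h : SpansQuotients V (n + 1)) (hV : finrank K V = n + 1)
    (h1 : 1 ∈ V) (hn : 1 ≤ n) (hnq : 2 * n ≤ q) (hq3 : 3 ≤ q)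
    (hdim : finrank K A ≤ n * q + n + 1) (hq : V ^ q ≠ ⊤) :
    ∃ (J : Ideal A) (v : ℕ → A ⧸ J), n * q + 2 ≤ finrank K (A ⧸ J) ∧
      (∀ i ≤ n, v i ∈ V.map (Ideal.Quotient.mkₐ K J).toLinearMap) ∧
      (LinearIndependent K fun i : Fin (n + 1) => v i) ∧
      ∀ i < n, ∀ j < n, v i * v (j + 1) = v (i + 1) * v j := by
  have : IsNoetherianRing A := IsNoetherianRing.of_finite K A
  obtain ⟨J, hJ, hcond⟩ := exists_hasTrivialConductor_map_quotient hq
  have hlen : n * q + 2 ≤ finrank K (A ⧸ J) := by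
    by_contra! hlt
    exact hJ ((h.pow hV h1 q).map_eq_top (Ideal.Quotient.mkₐ_surjective K J) (by omega))
  have hnq' : n ≤ n * q := Nat.le_mul_of_pos_right n (by omega)
  have hle : finrank K (A ⧸ J) ≤ finrank K A :=
    (Ideal.Quotient.mkₐ K J).toLinearMap.finrank_le_finrank_of_surjective
      (Ideal.Quotient.mkₐ_surjective K J)
  have hlt := Submodule.finrank_lt hJ
  rw [Submodule.map_pow] at hcond hlt
  have hmap : finrank K (V.map (Ideal.Quotient.mkₐ K J).toLinearMap) = n + 1 :=
    hV ▸ (hV ▸ h).finrank_map (Ideal.Quotient.mkₐ_surjective K J) (by omega)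
  obtain ⟨v, hv, hli, hrel⟩ :=
    (h.map (Ideal.Quotient.mkₐ_surjective K J)).exists_linearIndependent_mul_eq_mul hmap
    ⟨1, h1, map_one (Ideal.Quotient.mkₐ K J)⟩ hn hcond (by omega) hnq hq3 (by omega)
  exact ⟨J, v, hlen, hv, hli, hrel⟩

end Castelnuovo

open MvPolynomial

section HomogeneousIdeals

variable {K : Type*} [Field K] {n : ℕ} {σ τ : Type*}

/-- A homogeneous ideal of a polynomial ring, in the form used by `ClosedSubscheme`. -/
def IsHomogeneousIdeal (I : Ideal (MvPolynomial σ K)) : Prop :=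
  ∀ f ∈ I, ∀ m : ℕ, homogeneousComponent m f ∈ I

theorem IsHomogeneousIdeal.sup {I J : Ideal (MvPolynomial σ K)} (hI : IsHomogeneousIdeal I)
    (hJ : IsHomogeneousIdeal J) : IsHomogeneousIdeal (I ⊔ J) := by
  intro f hf m
  obtain ⟨a, ha, b, hb, rfl⟩ := Submodule.mem_sup.1 hf
  rw [map_add]
  exact Submodule.add_mem_sup (hI a ha m) (hJ b hb m)

theorem isHomogeneousIdeal_span_singleton {f : MvPolynomial σ K} {k : ℕ}
    (hf : f.IsHomogeneous k) : IsHomogeneousIdeal (Ideal.span {f}) := by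
  let := MvPolynomial.gradedAlgebra (σ := σ) (R := K)
  intro g hg m
  refine homogeneousComponent_mem_of_mem (Ideal.homogeneous_span _ _ ?_) hg m
  rintro _ rfl
  exact ⟨k, hf⟩

theorem homogeneousComponent_aeval {k : ℕ} (hk : k ≠ 0) {F : σ → MvPolynomial τ K}
    (hF : ∀ i, (F i).IsHomogeneous k) (f : MvPolynomial σ K) (m : ℕ) :
    homogeneousComponent (k * m) (aeval F f) = aeval F (homogeneousComponent m f) := by
  have hcomp : ∀ i, homogeneousComponent (k * m) (aeval F (homogeneousComponent i f)) =
      if m = i then aeval F (homogeneousComponent m f) else 0 := by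
    intro i
    rw [homogeneousComponent_of_mem ((homogeneousComponent_isHomogeneous i f).aeval F hF)]
    simp only [Nat.mul_right_inj hk]
    split_ifs with hmi
    exacts [hmi ▸ rfl, rfl]
  conv_lhs => rw [← sum_homogeneousComponent f]
  rw [map_sum, map_sum, Finset.sum_congr rfl fun i _ => hcomp i, Finset.sum_ite_eq]
  split_ifs with hm
  · rfl
  · rw [homogeneousComponent_eq_zero, map_zero]
    simpa using hm

theorem isHomogeneousIdeal_ker_aeval {k : ℕ} (hk : k ≠ 0) {F : σ → MvPolynomial τ K}
    (hF : ∀ i, (F i).IsHomogeneous k) :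
    IsHomogeneousIdeal (RingHom.ker (aeval F : MvPolynomial σ K →ₐ[K] MvPolynomial τ K)) := by
  intro f hf m
  rw [RingHom.mem_ker] at hf ⊢
  rw [← homogeneousComponent_aeval hk hF, hf, map_zero]

/-- The variables, as a basis of the space of linear forms. -/
noncomputable def linearFormsBasis (K σ : Type*) [Field K] :
    Basis σ K (homogeneousSubmodule σ K 1) :=
  (Basis.span (linearIndependent_X σ K)).map
    (LinearEquiv.ofEq _ _ (homogeneousSubmodule_one_eq_span_X).symm)

@[simp]
theorem coe_linearFormsBasis (i : σ) : (linearFormsBasis K σ i : MvPolynomial σ K) = X i := by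
  simp [linearFormsBasis, Basis.span_apply]

theorem finrank_homogeneousSubmodule_one [Fintype σ] :
    finrank K (homogeneousSubmodule σ K 1) = Fintype.card σ :=
  finrank_eq_card_basis (linearFormsBasis K σ)

instance finiteDimensional_homogeneousSubmodule [Finite σ] (m : ℕ) :
    FiniteDimensional K (homogeneousSubmodule σ K m) :=
  Module.Finite.iff_fg.2 (homogeneousSubmodule_fg σ K m)

theorem pow_mul_eq_of_mem_homogeneousSubmodule {A : Type*} [CommRing A] [Algebra K A]
    (f g : MvPolynomial σ K →ₐ[K] A) {a b : A}
    (h : ∀ P ∈ homogeneousSubmodule σ K 1, a * f P = b * g P) {m : ℕ} {P : MvPolynomial σ K}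
    (hP : P ∈ homogeneousSubmodule σ K m) : a ^ m * f P = b ^ m * g P := by
  rw [← homogeneousSubmodule_one_pow] at hP
  induction hP using Submodule.pow_induction_on_left' with
  | algebraMap r => simp
  | add x y i _ _ hx hy => simp only [map_add, mul_add, hx, hy]
  | mem_mul x hx i y _ hy =>
    simp only [map_mul, Nat.succ_eq_add_one, pow_succ]
    linear_combination (a ^ i * f y) * h x hx + b * g x * hy

theorem prime_of_isHomogeneous_one {v : MvPolynomial σ K} (hv : v.IsHomogeneous 1) (hv0 : v ≠ 0) :
    Prime v := by
  refine (irreducible_of_totalDegree_eq_one (hv.totalDegree hv0) fun x hx => ?_).prime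
  rw [isUnit_iff_ne_zero]
  rintro rfl
  exact hv0 (MvPolynomial.ext _ _ fun i => zero_dvd_iff.1 (hx i))

theorem exists_isPlane_ideal_eq_span (hn : 1 ≤ n) {v : MvPolynomial (Fin (n + 1)) K}
    (hv : v ∈ homogeneousSubmodule (Fin (n + 1)) K 1) (hv0 : v ≠ 0) :
    ∃ Z : ClosedSubscheme K n, Z.IsPlane (n - 1) ∧ Z.ideal = Ideal.span {v} := by
  have hprime := prime_of_isHomogeneous_one hv hv0
  obtain ⟨j, hj⟩ : ∃ j, ¬ v ∣ X j := by
    by_contra! hdvd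
    have hass : ∀ j, Associated v (X j) := fun j => hprime.associated_of_dvd X_prime (hdvd j)
    have : Nontrivial (Fin (n + 1)) := Fin.nontrivial_iff_two_le.2 (by omega)
    obtain ⟨i, j, hij⟩ := exists_pair_ne (Fin (n + 1))
    exact hij (X_dvd_X.1 ((hass i).symm.trans (hass j)).dvd)
  refine ⟨⟨Ideal.span {v}, isHomogeneousIdeal_span_singleton hv, fun f hf => ?_⟩,
    ⟨K ∙ v, ?_, ?_, (Submodule.span_span_of_tower ..).symm⟩, rfl⟩
  · obtain ⟨N, hN⟩ := hf j
    rw [Ideal.mem_span_singleton] at hN ⊢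
    exact (hprime.dvd_or_dvd hN).resolve_left fun h => hj (hprime.dvd_of_dvd_pow h)
  · rwa [Submodule.span_singleton_le_iff_mem]
  · rw [finrank_span_singleton hv0]
    omega

end HomogeneousIdeals

section BinaryForms

variable {K : Type*} [Field K]

/-- The monomial `s ^ (m - j) * t ^ j` in the variables `s = X 0` and `t = X 1`. -/
noncomputable def binaryMonomial (K : Type*) [Field K] (m j : ℕ) : MvPolynomial (Fin 2) K :=
  X 0 ^ (m - j) * X 1 ^ j

theorem binaryMonomial_eq_monomial (m j : ℕ) : binaryMonomial K m j =
    monomial (Finsupp.single 0 (m - j) + Finsupp.single 1 j) 1 := by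
  rw [binaryMonomial, X_pow_eq_monomial, X_pow_eq_monomial, monomial_mul, one_mul]

theorem isHomogeneous_binaryMonomial {m j : ℕ} (hj : j ≤ m) :
    (binaryMonomial K m j).IsHomogeneous m := by
  have := (isHomogeneous_X_pow (R := K) (0 : Fin 2) (m - j)).mul (isHomogeneous_X_pow 1 j)
  rwa [Nat.sub_add_cancel hj] at this

theorem linearIndependent_binaryMonomial (m : ℕ) :
    LinearIndependent K fun j : Fin (m + 1) => binaryMonomial K m j := by
  have hinj : Function.Injective fun j : Fin (m + 1) =>
      (Finsupp.single 0 (m - (j : ℕ)) + Finsupp.single 1 (j : ℕ) : Fin 2 →₀ ℕ) := fun i j hij => by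
    simpa [Fin.val_inj] using DFunLike.congr_fun hij 1
  simpa only [Function.comp_def, coe_basisMonomials, ← binaryMonomial_eq_monomial] using
    (basisMonomials (Fin 2) K).linearIndependent.comp _ hinj

theorem span_binaryMonomial (m : ℕ) :
    Submodule.span K (Set.range fun j : Fin (m + 1) => binaryMonomial K m j) =
      homogeneousSubmodule (Fin 2) K m := by
  refine le_antisymm (Submodule.span_le.2 ?_) fun f hf => ?_
  · rintro _ ⟨j, rfl⟩
    exact isHomogeneous_binaryMonomial (by omega)
  · rw [f.as_sum]
    refine Submodule.sum_mem _ fun d hd => ?_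
    have hdm : d 0 + d 1 = m := by
      simpa [Finsupp.weight_apply, Finsupp.sum_fintype] using hf (mem_support_iff.1 hd)
    have hmon : monomial d (coeff d f) = coeff d f • binaryMonomial K m (d 1) := by
      rw [binaryMonomial_eq_monomial, smul_monomial, smul_eq_mul, mul_one]
      congr 2
      ext i
      fin_cases i
      · simp; omega
      · simp
    rw [hmon]
    exact Submodule.smul_mem _ _ (Submodule.subset_span ⟨⟨d 1, by omega⟩, rfl⟩)

/-- The monomials `s ^ (m - j) * t ^ j` as a basis of the binary forms of degree `m`. -/
noncomputable def binaryFormsBasis (K : Type*) [Field K] (m : ℕ) :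
    Basis (Fin (m + 1)) K (homogeneousSubmodule (Fin 2) K m) :=
  (Basis.span (linearIndependent_binaryMonomial m)).map
    (LinearEquiv.ofEq _ _ (span_binaryMonomial m))

@[simp]
theorem coe_binaryFormsBasis (m : ℕ) (j : Fin (m + 1)) :
    (binaryFormsBasis K m j : MvPolynomial (Fin 2) K) = binaryMonomial K m j := by
  simp [binaryFormsBasis, Basis.span_apply]

theorem finrank_binaryForms (m : ℕ) : finrank K (homogeneousSubmodule (Fin 2) K m) = m + 1 := by
  rw [finrank_eq_card_basis (binaryFormsBasis K m), Fintype.card_fin]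

end BinaryForms

section RationalNormalCurves

variable {K : Type*} [Field K] {n : ℕ}

theorem ClosedSubscheme.IsRationalNormalCurve.hilbertFunction_le {C : ClosedSubscheme K n}
    (hC : C.IsRationalNormalCurve) (q : ℕ) : C.hilbertFunction q ≤ n * q + 1 := by
  obtain ⟨F, hF⟩ := hC
  let a : MvPolynomial (Fin (n + 1)) K →ₐ[K] MvPolynomial (Fin 2) K :=
    aeval fun i => (F i : MvPolynomial (Fin 2) K)
  let b : (MvPolynomial (Fin (n + 1)) K ⧸ C.ideal) →ₐ[K] MvPolynomial (Fin 2) K :=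
    Ideal.Quotient.liftₐ C.ideal a fun x hx => by rw [hF] at hx; exact hx
  have hb : Function.Injective b := by
    rw [injective_iff_map_eq_zero]
    intro x hx
    obtain ⟨x, rfl⟩ := Ideal.Quotient.mk_surjective x
    rw [Ideal.Quotient.eq_zero_iff_mem, hF]
    exact hx
  have hle : ((homogeneousSubmodule (Fin (n + 1)) K q).map
      (Ideal.Quotient.mkₐ K C.ideal).toLinearMap).map b.toLinearMap ≤
      homogeneousSubmodule (Fin 2) K (n * q) := by
    rintro _ ⟨_, ⟨x, hx, rfl⟩, rfl⟩
    exact IsHomogeneous.aeval hx (fun i => (F i : MvPolynomial (Fin 2) K)) fun i => (F i).2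
  calc C.hilbertFunction q = _ := (Submodule.equivMapOfInjective b.toLinearMap hb _).finrank_eq
    _ ≤ finrank K (homogeneousSubmodule (Fin 2) K (n * q)) := Submodule.finrank_mono hle
    _ = n * q + 1 := finrank_binaryForms _

theorem exists_rationalNormalCurve_of_basis (hn : n ≠ 0)
    (b : Basis (Fin (n + 1)) K (homogeneousSubmodule (Fin (n + 1)) K 1)) :
    ∃ C : ClosedSubscheme K n, C.IsRationalNormalCurve ∧
      ∃ a : MvPolynomial (Fin (n + 1)) K →ₐ[K] MvPolynomial (Fin 2) K,
        C.ideal = RingHom.ker a ∧ ∀ i, a (b i) = binaryMonomial K n i := by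
  let e := b.equiv (binaryFormsBasis K n) (Equiv.refl _)
  let F := (linearFormsBasis K (Fin (n + 1))).map e
  let a : MvPolynomial (Fin (n + 1)) K →ₐ[K] MvPolynomial (Fin 2) K :=
    aeval fun i => (F i : MvPolynomial (Fin 2) K)
  have ha : a.toLinearMap ∘ₗ Submodule.subtype _ = Submodule.subtype _ ∘ₗ e.toLinearMap :=
    (linearFormsBasis K _).ext fun i => by simp [a, F]
  refine ⟨⟨RingHom.ker a, isHomogeneousIdeal_ker_aeval hn fun i => (F i).2, fun f hf => ?_⟩,
    ⟨F, rfl⟩, a, rfl, fun i => ?_⟩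
  · obtain ⟨N, hN⟩ := hf 0
    rw [RingHom.mem_ker, map_mul, map_pow, aeval_X] at hN
    exact (mul_eq_zero.1 hN).resolve_left (pow_ne_zero _ (Subtype.coe_ne_coe.2 (F.ne_zero 0)))
  · simpa [e] using LinearMap.congr_fun ha (b i)

section Relations

variable {A : Type*} [CommRing A] {v : ℕ → A}

theorem pow_mul_eq_of_mul_eq_mul (hrel : ∀ i < n, ∀ j < n, v i * v (j + 1) = v (i + 1) * v j)
    {j : ℕ} (hj : j ≤ n) : v 0 ^ n * v j = v 0 * (v 0 ^ (n - j) * v 1 ^ j) := by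
  have hpow : ∀ j ≤ n, v 0 ^ j * v j = v 0 * v 1 ^ j := by
    intro j
    induction j with
    | zero => intro _; simp
    | succ j ih =>
      intro hj
      rw [pow_succ, pow_succ]
      linear_combination v 0 ^ j * hrel 0 (by omega) j hj + v 1 * ih (by omega)
  obtain ⟨k, rfl⟩ := Nat.exists_eq_add_of_le hj
  rw [Nat.add_sub_cancel_left, pow_add]
  linear_combination v 0 ^ k * hpow j hj

theorem pow_mul_eq_of_mul_eq_mul' (hrel : ∀ i < n, ∀ j < n, v i * v (j + 1) = v (i + 1) * v j)
    {j : ℕ} (hj : j ≤ n) : v n ^ n * v j = v n * (v (n - 1) ^ (n - j) * v n ^ j) := by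
  have hrev := pow_mul_eq_of_mul_eq_mul (v := fun j => v (n - j)) (n := n) (fun i hi j hj => by
    have := hrel (n - (j + 1)) (by omega) (n - (i + 1)) (by omega)
    rw [show n - (i + 1) + 1 = n - i by omega, show n - (j + 1) + 1 = n - j by omega] at this
    linear_combination this) (Nat.sub_le n j)
  simp only [Nat.sub_zero, Nat.sub_sub_self hj] at hrev
  rw [hrev, mul_comm (v n ^ j)]

theorem isCoprime_of_mul_eq_mul (hrel : ∀ i < n, ∀ j < n, v i * v (j + 1) = v (i + 1) * v j)
    (h1 : 1 ∈ Ideal.span (Set.range fun i : Fin (n + 1) => v i)) : IsCoprime (v 0) (v n) := by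
  rw [← Ideal.isCoprime_span_singleton_iff, Ideal.isCoprime_iff_sup_eq]
  by_contra hne
  obtain ⟨M, hM, hle⟩ := Ideal.exists_le_maximal _ hne
  have hmem : ∀ j < n, v j ∈ M := by
    intro j
    induction j with
    | zero => exact fun _ => hle (Ideal.mem_sup_left (Ideal.mem_span_singleton_self _))
    | succ j ih =>
      intro hj
      refine hM.isPrime.mem_of_pow_mem 2 ?_
      rw [pow_two, ← hrel j (by omega) (j + 1) hj]
      exact M.mul_mem_right _ (ih (by omega))
  refine hM.ne_top ((Ideal.eq_top_iff_one _).2 (Ideal.span_le.2 ?_ h1))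
  rintro _ ⟨i, rfl⟩
  rcases i.is_le.lt_or_eq with hi | hi
  · exact hmem i hi
  · simpa only [hi, SetLike.mem_coe] using
      hle (Ideal.mem_sup_right (Ideal.mem_span_singleton_self _))

variable [Algebra K A] {f : MvPolynomial (Fin (n + 1)) K →ₐ[K] A}

theorem exists_linearForms_basis
    (hv : ∀ i ≤ n, v i ∈ (homogeneousSubmodule (Fin (n + 1)) K 1).map f.toLinearMap)
    (hli : LinearIndependent K fun i : Fin (n + 1) => v i) :
    ∃ b : Basis (Fin (n + 1)) K (homogeneousSubmodule (Fin (n + 1)) K 1), ∀ i, f (b i) = v i := by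
  have hu : ∀ i : Fin (n + 1), ∃ u : homogeneousSubmodule (Fin (n + 1)) K 1, f u = v i := by
    intro i
    obtain ⟨u, hu, hfu⟩ := hv i i.is_le
    exact ⟨⟨u, hu⟩, hfu⟩
  choose u hu using hu
  have huli : LinearIndependent K u :=
    .of_comp (f.toLinearMap ∘ₗ Submodule.subtype _) (by simpa [Function.comp_def, hu] using hli)
  exact ⟨basisOfLinearIndependentOfCardEqFinrank huli finrank_homogeneousSubmodule_one.symm,
    fun i => by simp [hu]⟩

-- On the open sets where `v 0` and `v n` are invertible, the relations make `v` proportional to the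
-- monomials `s ^ (n - j) * t ^ j` for `(s, t) = (v 0, v 1)` and `(s, t) = (v (n - 1), v n)`.
theorem exists_rationalNormalCurve_of_mul_eq_mul (hn : n ≠ 0)
    (hv : ∀ i ≤ n, v i ∈ (homogeneousSubmodule (Fin (n + 1)) K 1).map f.toLinearMap)
    (hli : LinearIndependent K fun i : Fin (n + 1) => v i)
    (h1 : 1 ∈ (homogeneousSubmodule (Fin (n + 1)) K 1).map f.toLinearMap)
    (hrel : ∀ i < n, ∀ j < n, v i * v (j + 1) = v (i + 1) * v j) :
    ∃ C : ClosedSubscheme K n, C.IsRationalNormalCurve ∧ C.ideal ≤ RingHom.ker f := by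
  obtain ⟨b, hb⟩ := exists_linearForms_basis hv hli
  obtain ⟨C, hC, a, hCa, ha⟩ := exists_rationalNormalCurve_of_basis hn b
  have hcop : IsCoprime (v 0) (v n) := by
    refine isCoprime_of_mul_eq_mul hrel ?_
    obtain ⟨w, hw, hw1⟩ := h1
    have hsum := congrArg (f.toLinearMap ∘ₗ Submodule.subtype _) (b.sum_repr ⟨w, hw⟩)
    rw [map_sum] at hsum
    refine (hsum.trans hw1) ▸ Ideal.sum_mem _ fun i _ => ?_
    rw [map_smul]
    exact Submodule.smul_of_tower_mem _ _ (Submodule.subset_span ⟨i, (hb i).symm⟩)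
  have hlin : ∀ c d s t : A, (∀ j ≤ n, c * v j = d * (s ^ (n - j) * t ^ j)) →
      ∀ P ∈ homogeneousSubmodule (Fin (n + 1)) K 1,
        c * f P = d * ((aeval ![s, t]).comp a) P := by
    intro c d s t h P hP
    have hext : LinearMap.mulLeft K c ∘ₗ f.toLinearMap ∘ₗ Submodule.subtype _ =
        LinearMap.mulLeft K d ∘ₗ ((aeval ![s, t]).comp a).toLinearMap ∘ₗ
          Submodule.subtype (homogeneousSubmodule (Fin (n + 1)) K 1) :=
      b.ext fun i => by simp [hb, ha, binaryMonomial, h i i.is_le]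
    exact LinearMap.congr_fun hext ⟨P, hP⟩
  refine ⟨C, hC, fun P hP => ?_⟩
  rw [RingHom.mem_ker, ← sum_homogeneousComponent P, map_sum]
  refine Finset.sum_eq_zero fun m _ => ?_
  have hPm : a (homogeneousComponent m P) = 0 := RingHom.mem_ker.1 (hCa ▸ C.homogeneous P hP m)
  have h₀ := pow_mul_eq_of_mem_homogeneousSubmodule _ _
    (hlin _ _ (v 0) (v 1) fun j hj => pow_mul_eq_of_mul_eq_mul hrel hj)
    (homogeneousComponent_mem m P)
  have hₙ := pow_mul_eq_of_mem_homogeneousSubmodule _ _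
    (hlin _ _ (v (n - 1)) (v n) fun j hj => pow_mul_eq_of_mul_eq_mul' hrel hj)
    (homogeneousComponent_mem m P)
  rw [AlgHom.comp_apply, hPm, map_zero, mul_zero, ← pow_mul] at h₀ hₙ
  obtain ⟨x, y, hxy⟩ := hcop.pow (m := n * m) (n := n * m)
  rw [← one_mul (f _), ← hxy, add_mul, mul_assoc, mul_assoc, h₀, hₙ, mul_zero, mul_zero, add_zero]

end Relations

end RationalNormalCurves

section Homotopy

variable {K : Type*} [Field K] {n p : ℕ}

/-- A cochain as a function on all sets of indices, which is zero on those of the wrong size. -/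
noncomputable def extendCochain (c : (Fin (p + 1) ↪o Fin (n + 1)) → Laurent K n)
    (S : Finset (Fin (n + 1))) : Laurent K n :=
  if h : S.card = p + 1 then c (S.orderEmbOfFin h) else 0

/-- The sign with which a face omitting, or a cone adding, the vertex `i` of `S` occurs. -/
def positionSign (K : Type*) [Field K] (i : Fin (n + 1)) (S : Finset (Fin (n + 1))) : K :=
  (-1) ^ (S.filter (· < i)).card

theorem positionSign_mul_self (i : Fin (n + 1)) (S : Finset (Fin (n + 1))) :
    positionSign K i S * positionSign K i S = 1 := by
  rw [positionSign, ← mul_pow, neg_one_mul, neg_neg, one_pow]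

theorem positionSign_erase_self (i : Fin (n + 1)) (S : Finset (Fin (n + 1))) :
    positionSign K i (S.erase i) = positionSign K i S := by
  rw [positionSign, positionSign, Finset.filter_erase, Finset.erase_eq_of_notMem (by simp)]

theorem positionSign_insert_self (i : Fin (n + 1)) (S : Finset (Fin (n + 1))) :
    positionSign K i (insert i S) = positionSign K i S := by
  rw [positionSign, positionSign, Finset.filter_insert, if_neg (lt_irrefl i)]

theorem positionSign_mul_insert {i k : Fin (n + 1)} {S : Finset (Fin (n + 1))} (hi : i ∈ S)
    (hk : k ∉ S) : positionSign K k S * positionSign K i (insert k S) =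
      -(positionSign K i S * positionSign K k (S.erase i)) := by
  simp only [positionSign, Finset.filter_insert, Finset.filter_erase]
  rcases lt_trichotomy i k with h | rfl | h
  · rw [if_neg (asymm h)]
    have hmem : i ∈ S.filter (· < k) := by simp [hi, h]
    rw [← Finset.card_erase_add_one hmem, pow_succ]
    ring
  · exact absurd hi hk
  · rw [if_pos h, Finset.card_insert_of_notMem (by simp [hk]),
      Finset.erase_eq_of_notMem (by simp [h.le]), pow_succ]
    ring

theorem card_map_toEmbedding (s : Fin p ↪o Fin (n + 1)) :
    (Finset.univ.map s.toEmbedding).card = p := by simp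

theorem extendCochain_map_toEmbedding (c : (Fin (p + 1) ↪o Fin (n + 1)) → Laurent K n)
    (s : Fin (p + 1) ↪o Fin (n + 1)) : extendCochain c (Finset.univ.map s.toEmbedding) = c s := by
  rw [extendCochain, dif_pos (card_map_toEmbedding s)]
  congr 1
  exact (Finset.orderEmbOfFin_unique' _ fun x => by simp).symm

theorem exists_map_toEmbedding_eq {S : Finset (Fin (n + 1))} (h : S.card = p) :
    ∃ s : Fin p ↪o Fin (n + 1), Finset.univ.map s.toEmbedding = S :=
  ⟨S.orderEmbOfFin h, by ext; simp⟩

theorem coboundary_apply (c : (Fin (p + 1) ↪o Fin (n + 1)) → Laurent K n)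
    (s : Fin (p + 2) ↪o Fin (n + 1)) : coboundary K n p c s =
      ∑ i ∈ Finset.univ.map s.toEmbedding, positionSign K i (Finset.univ.map s.toEmbedding) •
        extendCochain c ((Finset.univ.map s.toEmbedding).erase i) := by
  rw [Finset.sum_map]
  simp only [coboundary, LinearMap.pi_apply, LinearMap.sum_apply, LinearMap.smul_apply,
    LinearMap.proj_apply]
  refine Finset.sum_congr rfl fun k _ => ?_
  congr 1
  · rw [positionSign]
    congr 1
    rw [Finset.filter_map, Finset.card_map]
    have hbelow : Finset.univ.filter ((· < s.toEmbedding k) ∘ s.toEmbedding) = Finset.Iio k := by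
      ext j
      simp
    rw [hbelow, Fin.card_Iio]
  · refine (extendCochain_map_toEmbedding c _).symm.trans ?_
    congr 1
    ext x
    simp only [Finset.mem_map, Finset.mem_univ, true_and, Finset.mem_erase]
    constructor
    · rintro ⟨j, rfl⟩
      exact ⟨fun e => Fin.succAbove_ne k j (s.injective e), _, rfl⟩
    · rintro ⟨hx, j, rfl⟩
      obtain ⟨i, rfl⟩ := Fin.exists_succAbove_eq (x := j) (y := k) (fun e => hx (by rw [e]))
      exact ⟨i, rfl⟩

theorem extendCochain_coboundary (c : (Fin (p + 1) ↪o Fin (n + 1)) → Laurent K n)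
    {S : Finset (Fin (n + 1))} (h : S.card = p + 2) : extendCochain (coboundary K n p c) S =
      ∑ i ∈ S, positionSign K i S • extendCochain c (S.erase i) := by
  obtain ⟨s, rfl⟩ := exists_map_toEmbedding_eq h
  rw [extendCochain_map_toEmbedding, coboundary_apply]

/-- The cone construction with vertex `k` on cochains. -/
noncomputable def contraction (k : Fin (n + 1)) (c : (Fin (p + 2) ↪o Fin (n + 1)) → Laurent K n) :
    (Fin (p + 1) ↪o Fin (n + 1)) → Laurent K n := fun s =>
  if k ∈ Finset.univ.map s.toEmbedding then 0 else
    positionSign K k (Finset.univ.map s.toEmbedding) •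
      extendCochain c (insert k (Finset.univ.map s.toEmbedding))

theorem extendCochain_contraction (k : Fin (n + 1))
    (c : (Fin (p + 2) ↪o Fin (n + 1)) → Laurent K n) {S : Finset (Fin (n + 1))}
    (h : S.card = p + 1) : extendCochain (contraction k c) S =
      if k ∈ S then 0 else positionSign K k S • extendCochain c (insert k S) := by
  obtain ⟨s, rfl⟩ := exists_map_toEmbedding_eq h
  rw [extendCochain_map_toEmbedding, contraction]

@[simp]
theorem contraction_zero (k : Fin (n + 1)) :
    contraction k (0 : (Fin (p + 2) ↪o Fin (n + 1)) → Laurent K n) = 0 := by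
  ext1 s
  simp [contraction, extendCochain]

theorem coboundary_contraction_add (k : Fin (n + 1))
    (c : (Fin (p + 2) ↪o Fin (n + 1)) → Laurent K n) :
    coboundary K n p (contraction k c) + contraction k (coboundary K n (p + 1) c) = c := by
  ext1 s
  rw [Pi.add_apply, coboundary_apply, contraction, ← extendCochain_map_toEmbedding c s]
  have hcard := card_map_toEmbedding s
  set S := Finset.univ.map s.toEmbedding
  by_cases hk : k ∈ S
  · rw [if_pos hk, add_zero, Finset.sum_eq_single_of_mem k hk]
    · rw [extendCochain_contraction k c (by rw [Finset.card_erase_of_mem hk]; omega),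
        if_neg (by simp), Finset.insert_erase hk, smul_smul, positionSign_erase_self,
        positionSign_mul_self, one_smul]
    · intro i hi hik
      rw [extendCochain_contraction k c (by rw [Finset.card_erase_of_mem hi]; omega),
        if_pos (by simp [hk, hik.symm]), smul_zero]
  · rw [if_neg hk, extendCochain_coboundary c (by rw [Finset.card_insert_of_notMem hk]; omega),
      Finset.sum_insert hk, Finset.erase_insert hk, positionSign_insert_self, smul_add, smul_smul,
      positionSign_mul_self, one_smul, Finset.smul_sum, add_comm, add_assoc,
      ← Finset.sum_add_distrib, Finset.sum_eq_zero, add_zero]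
    intro i hi
    have hne : k ≠ i := fun e => hk (e ▸ hi)
    rw [extendCochain_contraction k c (by rw [Finset.card_erase_of_mem hi]; omega),
      if_neg (by simp [hk]), smul_smul, smul_smul, ← Finset.erase_insert_of_ne hne,
      positionSign_mul_insert hi hk, neg_smul, neg_add_cancel]

theorem coboundary_comp (f : Laurent K n →ₗ[K] Laurent K n)
    (c : (Fin (p + 1) ↪o Fin (n + 1)) → Laurent K n) :
    coboundary K n p (fun s => f (c s)) = fun s => f (coboundary K n p c s) := by
  ext1 s
  simp [coboundary]

end Homotopy

section LaurentPolynomials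

variable {K : Type*} [Field K] {n : ℕ}

/-- The total degree of a Laurent monomial, as a function of its exponents. -/
noncomputable def expDegree (n : ℕ) : (Fin (n + 1) → ℤ) →+ ℤ where
  toFun e := ∑ i, e i
  map_zero' := by simp
  map_add' a b := by simp [Finset.sum_add_distrib]

/-- The homogeneous Laurent polynomials of degree `m`. -/
noncomputable abbrev laurentDegree (K : Type*) [Field K] (n : ℕ) (m : ℤ) :
    Submodule K (Laurent K n) :=
  AddMonoidAlgebra.gradeBy K (expDegree n) m

theorem mul_mem_laurentDegree {a b : ℤ} {f g : Laurent K n} (hf : f ∈ laurentDegree K n a)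
    (hg : g ∈ laurentDegree K n b) : f * g ∈ laurentDegree K n (a + b) :=
  SetLike.mul_mem_graded hf hg

theorem pow_mem_laurentDegree {a : ℤ} {f : Laurent K n} (hf : f ∈ laurentDegree K n a) (N : ℕ) :
    f ^ N ∈ laurentDegree K n (N * a) :=
  nsmul_eq_mul N a ▸ SetLike.pow_mem_graded N hf

theorem x_mem_laurentDegree (i : Fin (n + 1)) : Laurent.x K i ∈ laurentDegree K n 1 := by
  have hdeg : expDegree n (Pi.single i 1) = 1 := by simp [expDegree]
  exact hdeg ▸ AddMonoidAlgebra.single_mem_gradeBy (R := K) (expDegree n) (Pi.single i 1) 1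

/-- The inverse of the variable `xᵢ`. -/
noncomputable def Laurent.xInv (K : Type*) [Field K] {n : ℕ} (i : Fin (n + 1)) : Laurent K n :=
  AddMonoidAlgebra.single (-Pi.single i 1) 1

theorem x_mul_xInv (i : Fin (n + 1)) : Laurent.x K i * Laurent.xInv K i = 1 := by
  rw [Laurent.x, Laurent.xInv, AddMonoidAlgebra.single_mul_single, add_neg_cancel, mul_one]
  rfl

theorem xInv_mem_laurentDegree (i : Fin (n + 1)) : Laurent.xInv K i ∈ laurentDegree K n (-1) := by
  have hdeg : expDegree n (-Pi.single i 1) = -1 := by simp [expDegree]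
  exact hdeg ▸ AddMonoidAlgebra.single_mem_gradeBy (R := K) (expDegree n) (-Pi.single i 1) 1

/-- The inclusion of the exponents of monomials into those of Laurent monomials. -/
def expCast (n : ℕ) : (Fin (n + 1) →₀ ℕ) →+ (Fin (n + 1) → ℤ) where
  toFun d i := d i
  map_zero' := by ext; simp
  map_add' a b := by ext; simp

theorem expCast_injective : Function.Injective (expCast n) := by
  intro a b h
  ext i
  exact Int.ofNat_injective (congrFun h i)

theorem toLaurent_X (i : Fin (n + 1)) : toLaurent K n (X i) = Laurent.x K i := by
  simp [toLaurent]

theorem toLaurent_eq_mapDomain (g : MvPolynomial (Fin (n + 1)) K) :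
    toLaurent K n g = AddMonoidAlgebra.mapDomain (expCast n) g := by
  have hmap : toLaurent K n = AddMonoidAlgebra.mapDomainAlgHom K K (expCast n) := by
    refine MvPolynomial.algHom_ext fun i => ?_
    rw [toLaurent_X, X, monomial]
    change _ = AddMonoidAlgebra.mapDomain (expCast n) (AddMonoidAlgebra.single _ _)
    rw [AddMonoidAlgebra.mapDomain_single, Laurent.x]
    congr 1
    ext j
    simp [expCast, Finsupp.single_apply, Pi.single_apply, eq_comm]
  rw [hmap]
  rfl

theorem toLaurent_injective : Function.Injective (toLaurent K n) := by
  intro a b h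
  rw [toLaurent_eq_mapDomain, toLaurent_eq_mapDomain] at h
  exact AddMonoidAlgebra.mapDomain_injective expCast_injective h

theorem exists_of_mem_support_toLaurent {g : MvPolynomial (Fin (n + 1)) K} {e : Fin (n + 1) → ℤ}
    (he : e ∈ (toLaurent K n g).coeff.support) : ∃ d ∈ g.support, expCast n d = e := by
  classical
  rw [toLaurent_eq_mapDomain] at he
  exact Finset.mem_image.1 (Finsupp.mapDomain_support he)

theorem expDegree_expCast (d : Fin (n + 1) →₀ ℕ) : expDegree n (expCast n d) = d.degree := by
  simp [expDegree, expCast, Finsupp.degree_eq_sum]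

theorem toLaurent_mem_laurentDegree {g : MvPolynomial (Fin (n + 1)) K} {m : ℕ}
    (hg : g.IsHomogeneous m) : toLaurent K n g ∈ laurentDegree K n m := by
  intro e he
  obtain ⟨d, hd, rfl⟩ := exists_of_mem_support_toLaurent he
  rw [expDegree_expCast, ← hg (mem_support_iff.1 hd), Finsupp.degree_eq_weight_one]
  rfl

theorem coeff_toLaurent (g : MvPolynomial (Fin (n + 1)) K) (d : Fin (n + 1) →₀ ℕ) :
    (toLaurent K n g).coeff (expCast n d) = coeff d g := by
  rw [toLaurent_eq_mapDomain]
  exact Finsupp.mapDomain_apply expCast_injective _ _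

theorem isHomogeneous_of_toLaurent_mem {g : MvPolynomial (Fin (n + 1)) K} {m : ℕ}
    (hg : toLaurent K n g ∈ laurentDegree K n m) : g.IsHomogeneous m := by
  intro d hd
  have hdeg := hg (expCast n d) (Finsupp.mem_support_iff.2 ((coeff_toLaurent g d).trans_ne hd))
  rw [expDegree_expCast, Nat.cast_inj] at hdeg
  rwa [Finsupp.degree_eq_weight_one] at hdeg

theorem eq_zero_of_toLaurent_mem {g : MvPolynomial (Fin (n + 1)) K} {m : ℤ} (hm : m < 0)
    (hg : toLaurent K n g ∈ laurentDegree K n m) : g = 0 := by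
  ext d
  by_contra hd
  have hdeg := hg (expCast n d) (Finsupp.mem_support_iff.2 ((coeff_toLaurent g d).trans_ne hd))
  rw [expDegree_expCast] at hdeg
  lia

theorem single_eq_toLaurent {e : Fin (n + 1) → ℤ} (he : ∀ i, 0 ≤ e i) (a : K) :
    (AddMonoidAlgebra.single e a : Laurent K n) =
      toLaurent K n (monomial (Finsupp.equivFunOnFinite.symm fun i => (e i).toNat) a) := by
  rw [toLaurent_eq_mapDomain, monomial]
  change _ = AddMonoidAlgebra.mapDomain (expCast n) (AddMonoidAlgebra.single _ _)
  rw [AddMonoidAlgebra.mapDomain_single]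
  congr 1
  ext i
  simp [expCast, he i]

theorem laurent_eq_sum (f : Laurent K n) :
    f = ∑ e ∈ f.coeff.support, AddMonoidAlgebra.single e (f.coeff e) := by
  apply AddMonoidAlgebra.coeff_injective
  rw [AddMonoidAlgebra.coeff_sum]
  exact (Finsupp.sum_single f.coeff).symm

theorem exists_toLaurent_eq {f : Laurent K n} (hf : ∀ e ∈ f.coeff.support, ∀ i, 0 ≤ e i) :
    ∃ g, toLaurent K n g = f := by
  have : f ∈ (toLaurent K n).range := by
    rw [laurent_eq_sum f]
    refine sum_mem fun e he => ?_
    rw [single_eq_toLaurent (hf e he)]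
    exact ⟨_, rfl⟩
  exact this

end LaurentPolynomials

section Localized

variable {K : Type*} [Field K] {n : ℕ} {I : Ideal (MvPolynomial (Fin (n + 1)) K)}
  {S T : Finset (Fin (n + 1))} {f g : Laurent K n} {m k : ℤ}

theorem toLaurent_prod_X (S : Finset (Fin (n + 1))) :
    toLaurent K n (∏ i ∈ S, X i) = ∏ i ∈ S, Laurent.x K i := by
  simp [toLaurent]

/-- The localization of `I` at the product of the variables in `S`, inside the Laurent polynomials;
that is, the sections of all `ℐ(m)` over the open set where these variables do not vanish. -/
noncomputable def localized (I : Ideal (MvPolynomial (Fin (n + 1)) K)) (S : Finset (Fin (n + 1))) :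
    Submodule K (Laurent K n) where
  carrier := {f | ∃ N : ℕ, ∃ g ∈ I, (∏ i ∈ S, Laurent.x K i) ^ N * f = toLaurent K n g}
  zero_mem' := ⟨0, 0, I.zero_mem, by simp⟩
  add_mem' := by
    rintro f₁ f₂ ⟨N₁, g₁, hg₁, e₁⟩ ⟨N₂, g₂, hg₂, e₂⟩
    refine ⟨N₁ + N₂, (∏ i ∈ S, X i) ^ N₂ * g₁ + (∏ i ∈ S, X i) ^ N₁ * g₂,
      I.add_mem (I.mul_mem_left _ hg₁) (I.mul_mem_left _ hg₂), ?_⟩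
    rw [map_add, map_mul, map_mul, map_pow, map_pow, toLaurent_prod_X, ← e₁, ← e₂]
    ring
  smul_mem' := by
    rintro a f ⟨N, g, hg, e⟩
    refine ⟨N, a • g, ?_, ?_⟩
    · rw [smul_eq_C_mul]
      exact I.mul_mem_left _ hg
    · rw [map_smul, ← e, mul_smul_comm]

theorem mul_mem_localized (hf : f ∈ localized ⊤ S) (hg : g ∈ localized I S) :
    f * g ∈ localized I S := by
  obtain ⟨N, a, -, ha⟩ := hf
  obtain ⟨M, b, hb, hb'⟩ := hg
  refine ⟨N + M, a * b, I.mul_mem_left _ hb, ?_⟩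
  rw [map_mul, ← ha, ← hb']
  ring

theorem mul_mem_localized' (hf : f ∈ localized I S) (hg : g ∈ localized ⊤ S) :
    f * g ∈ localized I S := by
  rw [mul_comm]; exact mul_mem_localized hg hf

theorem localized_mono_ideal {J : Ideal (MvPolynomial (Fin (n + 1)) K)} (h : I ≤ J) :
    localized I S ≤ localized J S := fun _ ⟨N, g, hg, e⟩ => ⟨N, g, h hg, e⟩

theorem toLaurent_mem_localized {a : MvPolynomial (Fin (n + 1)) K} (ha : a ∈ I) :
    toLaurent K n a ∈ localized I S := ⟨0, a, ha, by simp⟩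

theorem toLaurent_mem_localized_top (a : MvPolynomial (Fin (n + 1)) K) :
    toLaurent K n a ∈ localized ⊤ S := toLaurent_mem_localized trivial

theorem one_mem_localized_top : (1 : Laurent K n) ∈ localized ⊤ S := by
  simpa using toLaurent_mem_localized_top (K := K) (n := n) (S := S) 1

theorem pow_mem_localized_top (hf : f ∈ localized ⊤ S) (N : ℕ) : f ^ N ∈ localized ⊤ S := by
  induction N with
  | zero => simpa using one_mem_localized_top
  | succ N ih => rw [pow_succ]; exact mul_mem_localized ih hf

theorem pow_sub_one_mem_localized (hf : f ∈ localized ⊤ S) (h : f - 1 ∈ localized I S) (N : ℕ) :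
    f ^ N - 1 ∈ localized I S := by
  rw [← geom_sum_mul]
  exact mul_mem_localized (Submodule.sum_mem _ fun k _ => pow_mem_localized_top hf k) h

theorem localized_mono (h : S ⊆ T) : localized I S ≤ localized I T := by
  rintro f ⟨N, g, hg, e⟩
  refine ⟨N, (∏ i ∈ T \ S, X i) ^ N * g, I.mul_mem_left _ hg, ?_⟩
  rw [map_mul, map_pow, toLaurent_prod_X, ← e, ← Finset.prod_sdiff h]
  ring

theorem xInv_mem_localized {i : Fin (n + 1)} (hi : i ∈ S) :
    Laurent.xInv K i ∈ localized ⊤ S := by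
  refine localized_mono (Finset.singleton_subset_iff.2 hi) ⟨1, 1, trivial, ?_⟩
  simp [x_mul_xInv]

theorem mem_localized_singleton_iff {i : Fin (n + 1)} {a : MvPolynomial (Fin (n + 1)) K} :
    toLaurent K n a ∈ localized I {i} ↔ ∃ N : ℕ, X i ^ N * a ∈ I := by
  constructor
  · rintro ⟨N, g, hg, e⟩
    refine ⟨N, ?_⟩
    rw [Finset.prod_singleton, ← toLaurent_X, ← map_pow, ← map_mul] at e
    rwa [toLaurent_injective e]
  · rintro ⟨N, hN⟩
    refine ⟨N, _, hN, ?_⟩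
    rw [Finset.prod_singleton, map_mul, map_pow, toLaurent_X]

theorem exists_pow_mul_mem_localized {i : Fin (n + 1)} (hf : f ∈ localized I (insert i S)) :
    ∃ N₀ : ℕ, ∀ N ≥ N₀, Laurent.x K i ^ N * f ∈ localized I S := by
  by_cases hi : i ∈ S
  · rw [Finset.insert_eq_of_mem hi] at hf
    refine ⟨0, fun N _ => mul_mem_localized ?_ hf⟩
    rw [← toLaurent_X, ← map_pow]
    exact toLaurent_mem_localized_top _
  obtain ⟨N₀, g, hg, e⟩ := hf
  refine ⟨N₀, fun N hN => ⟨N₀, X i ^ (N - N₀) * g, I.mul_mem_left _ hg, ?_⟩⟩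
  rw [map_mul, map_pow, toLaurent_X, ← e, Finset.prod_insert hi]
  obtain ⟨k, rfl⟩ := Nat.exists_eq_add_of_le hN
  rw [Nat.add_sub_cancel_left]
  ring

theorem prod_x_pow (S : Finset (Fin (n + 1))) (N : ℕ) : (∏ i ∈ S, Laurent.x K i) ^ N =
    (AddMonoidAlgebra.single (fun i => if i ∈ S then (N : ℤ) else 0) 1 : Laurent K n) := by
  have hprod : ∏ i ∈ S, Laurent.x K i =
      (AddMonoidAlgebra.single (∑ i ∈ S, Pi.single i 1) 1 : Laurent K n) := by
    simp only [Laurent.x, AddMonoidAlgebra.prod_single, Finset.prod_const_one]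
  rw [hprod, AddMonoidAlgebra.single_pow, one_pow]
  congr 1
  ext j
  simp [Finset.sum_apply, Pi.single_apply]

theorem nonneg_of_mem_localized_top (hf : f ∈ localized ⊤ S) {e : Fin (n + 1) → ℤ}
    (he : e ∈ f.coeff.support) {i : Fin (n + 1)} (hi : i ∉ S) : 0 ≤ e i := by
  obtain ⟨N, g, -, hg⟩ := hf
  rw [prod_x_pow] at hg
  set a : Fin (n + 1) → ℤ := fun i => if i ∈ S then (N : ℤ) else 0
  have hcoeff : (toLaurent K n g).coeff (a + e) = f.coeff e := by
    rw [← hg]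
    refine (AddMonoidAlgebra.coeff_single_mul_eq_mul_coeff e fun _ _ => ?_).trans (one_mul _)
    exact add_right_inj _
  obtain ⟨d, -, hd⟩ := exists_of_mem_support_toLaurent (g := g) (e := a + e)
    (Finsupp.mem_support_iff.2 (hcoeff.trans_ne (Finsupp.mem_support_iff.1 he)))
  have hdi := congrFun hd i
  simp only [Pi.add_apply, a, if_neg hi, zero_add] at hdi
  exact hdi ▸ Int.natCast_nonneg _

theorem single_mem_localized_top {e : Fin (n + 1) → ℤ} (he : ∀ i, i ∉ S → 0 ≤ e i) (a : K) :
    (AddMonoidAlgebra.single e a : Laurent K n) ∈ localized ⊤ S := by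
  let N : ℕ := ∑ j, (e j).natAbs
  have hN : ∀ i, 0 ≤ ((fun i => if i ∈ S then (N : ℤ) else 0) + e) i := by
    intro i
    by_cases hi : i ∈ S
    · have hle : (e i).natAbs ≤ N := Finset.single_le_sum (f := fun j => (e j).natAbs)
        (fun _ _ => Nat.zero_le _) (Finset.mem_univ i)
      simp only [Pi.add_apply, if_pos hi]
      omega
    · simpa [hi] using he i hi
  obtain ⟨g, hg⟩ : ∃ g, toLaurent K n g = AddMonoidAlgebra.single _ a :=
    ⟨_, (single_eq_toLaurent hN a).symm⟩
  refine ⟨N, g, Submodule.mem_top, ?_⟩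
  rw [hg, prod_x_pow, AddMonoidAlgebra.single_mul_single, one_mul]

theorem mem_localized_top_iff :
    f ∈ localized (⊤ : Ideal (MvPolynomial (Fin (n + 1)) K)) S ↔
      ∀ e ∈ f.coeff.support, ∀ i, i ∉ S → 0 ≤ e i := by
  refine ⟨fun hf e he i hi => nonneg_of_mem_localized_top hf he hi, fun h => ?_⟩
  rw [laurent_eq_sum f]
  exact Submodule.sum_mem _ fun e he => single_mem_localized_top (h e he) _

theorem exists_toLaurent_eq_of_mem_localized (hn : 1 ≤ n)
    (hf : ∀ i, f ∈ localized (⊤ : Ideal (MvPolynomial (Fin (n + 1)) K)) {i}) :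
    ∃ g, toLaurent K n g = f := by
  refine exists_toLaurent_eq fun e he i => ?_
  have : Nontrivial (Fin (n + 1)) := Fin.nontrivial_iff_two_le.2 (by omega)
  obtain ⟨j, hj⟩ := exists_ne i
  exact mem_localized_top_iff.1 (hf j) e he i (by simpa using hj.symm)

end Localized

section Cech

variable {K : Type*} [Field K] {n p : ℕ} {I : Ideal (MvPolynomial (Fin (n + 1)) K)} {m : ℤ}

theorem extendCochain_comp (f : Laurent K n →ₗ[K] Laurent K n)
    (c : (Fin (p + 1) ↪o Fin (n + 1)) → Laurent K n) (S : Finset (Fin (n + 1))) :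
    extendCochain (fun s => f (c s)) S = f (extendCochain c S) := by
  unfold extendCochain
  split_ifs <;> simp

theorem extendCochain_mem {D : Finset (Fin (n + 1)) → Submodule K (Laurent K n)}
    {c : (Fin (p + 1) ↪o Fin (n + 1)) → Laurent K n}
    (hc : ∀ s, c s ∈ D (Finset.univ.map s.toEmbedding)) (S : Finset (Fin (n + 1))) :
    extendCochain c S ∈ D S := by
  by_cases h : S.card = p + 1
  · obtain ⟨s, rfl⟩ := exists_map_toEmbedding_eq h
    rw [extendCochain_map_toEmbedding]
    exact hc s
  · rw [extendCochain, dif_neg h]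
    exact zero_mem _

theorem coboundary_mem {D : Finset (Fin (n + 1)) → Submodule K (Laurent K n)} (hD : Monotone D)
    {c : (Fin (p + 1) ↪o Fin (n + 1)) → Laurent K n}
    (hc : ∀ s, c s ∈ D (Finset.univ.map s.toEmbedding)) (s : Fin (p + 2) ↪o Fin (n + 1)) :
    coboundary K n p c s ∈ D (Finset.univ.map s.toEmbedding) := by
  rw [coboundary_apply]
  exact Submodule.sum_mem _ fun i _ => Submodule.smul_mem _ _
    (hD (Finset.erase_subset _ _) (extendCochain_mem hc _))

theorem sections_mono_set : Monotone (sections I m) :=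
  fun _ _ h _ hf => ⟨hf.1, localized_mono h hf.2⟩

theorem localized_mono_set : Monotone (localized I) := fun _ _ h => localized_mono h

theorem mem_cochains {c : (Fin (p + 1) ↪o Fin (n + 1)) → Laurent K n} :
    c ∈ cochains I m p ↔ ∀ s, c s ∈ sections I m (Finset.univ.map s.toEmbedding) := by
  simp [cochains, Submodule.mem_pi]

theorem coboundary_mem_cochains {c : (Fin (p + 1) ↪o Fin (n + 1)) → Laurent K n}
    (hc : c ∈ cochains I m p) : coboundary K n p c ∈ cochains I m (p + 1) :=
  mem_cochains.2 (coboundary_mem sections_mono_set (mem_cochains.1 hc))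

theorem cochains_le_top : cochains I m p ≤ cochains ⊤ m p :=
  fun _ hc => mem_cochains.2 fun s =>
    ⟨(mem_cochains.1 hc s).1, localized_mono_ideal le_top (mem_cochains.1 hc s).2⟩

theorem positionSign_mul_erase {i k : Fin (n + 1)} {S : Finset (Fin (n + 1))} (hi : i ∈ S)
    (hk : k ∈ S) (hik : i ≠ k) : positionSign K i S * positionSign K k (S.erase i) =
      -(positionSign K k S * positionSign K i (S.erase k)) := by
  have h := positionSign_mul_insert (K := K) (i := i) (k := k) (S := S.erase k) (by simp [hi, hik])
    (by simp)
  rw [Finset.insert_erase hk, positionSign_erase_self, Finset.erase_right_comm,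
    positionSign_erase_self] at h
  have h1 := positionSign_mul_self (K := K) k S
  have h2 := positionSign_mul_self (K := K) k (S.erase i)
  linear_combination (positionSign K k S * positionSign K k (S.erase i)) * h -
    (positionSign K i S * positionSign K k (S.erase i)) * h1 -
    (positionSign K i (S.erase k) * positionSign K k S) * h2

theorem coboundary_coboundary (c : (Fin (p + 1) ↪o Fin (n + 1)) → Laurent K n) :
    coboundary K n (p + 1) (coboundary K n p c) = 0 := by
  ext1 s
  rw [coboundary_apply]
  have hcard := card_map_toEmbedding s
  set S := Finset.univ.map s.toEmbedding
  rw [Finset.sum_congr rfl fun i hi => by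
    rw [extendCochain_coboundary c (by rw [Finset.card_erase_of_mem hi]; omega), Finset.smul_sum],
    Finset.sum_sigma']
  refine Finset.sum_involution (fun a _ => ⟨a.2, a.1⟩) ?_ ?_ ?_ ?_
  · rintro ⟨i, j⟩ h
    simp only [Finset.mem_sigma, Finset.mem_erase] at h
    simp only [smul_smul]
    rw [positionSign_mul_erase h.1 h.2.2 h.2.1.symm, Finset.erase_right_comm, neg_smul,
      neg_add_cancel]
  · rintro ⟨i, j⟩ h - e
    simp only [Finset.mem_sigma, Finset.mem_erase] at h
    simp only [Sigma.mk.injEq] at e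
    exact h.2.1 e.1
  · rintro ⟨i, j⟩ h
    simp only [Finset.mem_sigma, Finset.mem_erase] at h ⊢
    exact ⟨h.2.2, h.2.1.symm, h.1⟩
  · exact fun _ _ => rfl

open Classical in
/-- The part of a Laurent polynomial with exponents satisfying a predicate. -/
noncomputable def filterExp (P : (Fin (n + 1) → ℤ) → Prop) : Laurent K n →ₗ[K] Laurent K n where
  toFun f := AddMonoidAlgebra.ofCoeff (f.coeff.filter P)
  map_add' f g := by
    apply AddMonoidAlgebra.coeff_injective
    exact Finsupp.filter_add
  map_smul' a f := by
    apply AddMonoidAlgebra.coeff_injective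
    exact Finsupp.filter_smul

open Classical in
theorem coeff_filterExp (P : (Fin (n + 1) → ℤ) → Prop) (f : Laurent K n) (e : Fin (n + 1) → ℤ) :
    (filterExp P f).coeff e = if P e then f.coeff e else 0 :=
  Finsupp.filter_apply _ _ _

theorem mem_support_filterExp {P : (Fin (n + 1) → ℤ) → Prop} {f : Laurent K n}
    {e : Fin (n + 1) → ℤ} (he : e ∈ (filterExp P f).coeff.support) :
    P e ∧ e ∈ f.coeff.support := by
  classical
  rw [Finsupp.mem_support_iff, coeff_filterExp] at he
  by_cases h : P e
  · rw [if_pos h] at he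
    exact ⟨h, Finsupp.mem_support_iff.2 he⟩
  · simp [h] at he

/-- The index of the first nonnegative exponent is `k`. -/
def FirstNonneg (k : Fin (n + 1)) (e : Fin (n + 1) → ℤ) : Prop :=
  0 ≤ e k ∧ ∀ j < k, e j < 0

theorem sum_filterExp_firstNonneg {f : Laurent K n} (hf : ∀ e ∈ f.coeff.support, ∃ k, 0 ≤ e k) :
    ∑ k, filterExp (FirstNonneg k) f = f := by
  classical
  apply AddMonoidAlgebra.coeff_injective
  ext e
  rw [AddMonoidAlgebra.coeff_sum, Finsupp.finsetSum_apply]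
  simp only [coeff_filterExp]
  by_cases he : e ∈ f.coeff.support
  · obtain ⟨k, hk, hmin⟩ := WellFounded.has_min (wellFounded_lt (α := Fin (n + 1)))
      {k | 0 ≤ e k} (hf e he)
    have hk' : FirstNonneg k e := ⟨hk, fun j hj => by
      by_contra h
      exact hmin j (not_lt.1 h) hj⟩
    rw [Finset.sum_eq_single k, if_pos hk']
    · intro j _ hjk
      refine if_neg fun hj => hjk ?_
      rcases lt_trichotomy j k with h | h | h
      · exact absurd (hk'.2 j h) (not_lt.2 hj.1)
      · exact h
      · exact absurd (hj.2 k h) (not_lt.2 hk)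
    · simp
  · rw [Finsupp.notMem_support_iff.1 he]
    simp

theorem exists_nonneg_of_mem_support (h : -(n : ℤ) ≤ m ∨ p + 1 ≠ n)
    {s : Fin (p + 2) ↪o Fin (n + 1)} {f : Laurent K n}
    (hf : f ∈ sections ⊤ m (Finset.univ.map s.toEmbedding)) {e : Fin (n + 1) → ℤ}
    (he : e ∈ f.coeff.support) : ∃ k, 0 ≤ e k := by
  by_contra! hneg
  have huniv : Finset.univ.map s.toEmbedding = Finset.univ := by
    refine Finset.eq_univ_iff_forall.2 fun i => ?_
    by_contra hi
    exact (hneg i).not_ge (nonneg_of_mem_localized_top hf.2 he hi)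
  have hcard : n + 1 = p + 2 := by simpa [huniv] using card_map_toEmbedding s
  have hsum : m ≤ -(n + 1) :=
    calc m = ∑ i, e i := (hf.1 e he).symm
      _ ≤ ∑ _i : Fin (n + 1), (-1 : ℤ) := Finset.sum_le_sum fun i _ => by have := hneg i; omega
      _ = -(n + 1) := by simp
  omega

theorem contraction_filterExp_mem_cochains (k : Fin (n + 1))
    {c : (Fin (p + 2) ↪o Fin (n + 1)) → Laurent K n} (hc : c ∈ cochains ⊤ m (p + 1)) :
    contraction k (fun s => filterExp (FirstNonneg k) (c s)) ∈ cochains ⊤ m p := by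
  refine mem_cochains.2 fun s => ?_
  rw [contraction]
  split_ifs with hk
  · exact zero_mem _
  refine Submodule.smul_mem _ _ ?_
  rw [extendCochain_comp]
  obtain ⟨hdeg, hloc⟩ := extendCochain_mem (mem_cochains.1 hc)
    (insert k (Finset.univ.map s.toEmbedding))
  refine ⟨fun e he => hdeg e (mem_support_filterExp he).2,
    mem_localized_top_iff.2 fun e he i hi => ?_⟩
  obtain ⟨hfirst, hsupp⟩ := mem_support_filterExp he
  rcases eq_or_ne i k with rfl | hik
  · exact hfirst.1
  · exact nonneg_of_mem_localized_top hloc hsupp (by simpa [hik] using hi)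

theorem coboundary_contraction (k : Fin (n + 1)) {c : (Fin (p + 2) ↪o Fin (n + 1)) → Laurent K n}
    (hc : coboundary K n (p + 1) c = 0) : coboundary K n p (contraction k c) = c := by
  simpa [hc] using coboundary_contraction_add k c

-- The complex of `𝒪(m)` splits according to the index of the first nonnegative exponent, and on the
-- part with index `k` the cone with vertex `xₖ` is a contracting homotopy.
theorem exists_coboundary_eq_of_top (h : -(n : ℤ) ≤ m ∨ p + 1 ≠ n)
    {c : (Fin (p + 2) ↪o Fin (n + 1)) → Laurent K n} (hc : c ∈ cochains ⊤ m (p + 1))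
    (hd : coboundary K n (p + 1) c = 0) : ∃ b ∈ cochains ⊤ m p, coboundary K n p b = c := by
  have hpart : ∀ k, coboundary K n p (contraction k fun s => filterExp (FirstNonneg k) (c s)) =
      fun s => filterExp (FirstNonneg k) (c s) := fun k => by
    refine coboundary_contraction k ?_
    rw [coboundary_comp, hd]
    exact funext fun _ => map_zero _
  refine ⟨∑ k, contraction k fun s => filterExp (FirstNonneg k) (c s),
    Submodule.sum_mem _ fun k _ => contraction_filterExp_mem_cochains k hc, ?_⟩
  ext1 s
  rw [map_sum, Finset.sum_apply, Finset.sum_congr rfl fun k _ => congrFun (hpart k) s]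
  exact sum_filterExp_firstNonneg fun e he =>
    exists_nonneg_of_mem_support h (mem_cochains.1 hc s) he

theorem exists_eq_monomial_mul_pow {N : ℕ} {d : Fin (n + 1) →₀ ℕ}
    (hd : d.degree = (n + 1) * N) (r : K) :
    ∃ k, ∃ a : MvPolynomial (Fin (n + 1)) K,
      a.IsHomogeneous (n * N) ∧ monomial d r = a * X k ^ N := by
  obtain ⟨k, hk⟩ : ∃ k, N ≤ d k := by
    by_contra! hlt
    have hsum : ∑ i, d i < ∑ _i : Fin (n + 1), N :=
      Finset.sum_lt_sum_of_nonempty Finset.univ_nonempty fun i _ => hlt i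
    rw [← Finsupp.degree_eq_sum, hd] at hsum
    simp at hsum
  have hcancel := tsub_add_cancel_of_le (Finsupp.single_le_iff.2 hk)
  refine ⟨k, monomial (d - Finsupp.single k N) r, isHomogeneous_monomial _ ?_, ?_⟩
  · have hdeg := congrArg Finsupp.degree hcancel
    rw [map_add, Finsupp.degree_single, hd] at hdeg
    linarith
  · rw [X_pow_eq_monomial, monomial_mul, mul_one, hcancel]

theorem exists_eq_sum_mul_pow {N : ℕ} {P : MvPolynomial (Fin (n + 1)) K}
    (hP : P.IsHomogeneous ((n + 1) * N)) : ∃ a : Fin (n + 1) → MvPolynomial (Fin (n + 1)) K,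
      (∀ k, (a k).IsHomogeneous (n * N)) ∧ P = ∑ k, a k * X k ^ N := by
  rw [P.as_sum]
  refine Finset.sum_induction _ (fun P => ∃ a : Fin (n + 1) → MvPolynomial (Fin (n + 1)) K,
    (∀ k, (a k).IsHomogeneous (n * N)) ∧ P = ∑ k, a k * X k ^ N) ?_ ?_ fun d hd => ?_
  · rintro _ _ ⟨a, ha, rfl⟩ ⟨b, hb, rfl⟩
    exact ⟨a + b, fun k => (ha k).add (hb k), by simp [add_mul, Finset.sum_add_distrib]⟩
  · exact ⟨0, fun _ => isHomogeneous_zero _ _ _, by simp⟩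
  · have hdeg : d.degree = (n + 1) * N := by
      rw [Finsupp.degree_eq_weight_one]
      exact hP (mem_support_iff.1 hd)
    obtain ⟨k, a, ha, hk⟩ := exists_eq_monomial_mul_pow hdeg (coeff d P)
    refine ⟨Pi.single k a, fun j => ?_, ?_⟩
    · rcases eq_or_ne j k with rfl | hj
      · rwa [Pi.single_eq_same]
      · rw [Pi.single_eq_of_ne hj]
        exact isHomogeneous_zero _ _ _
    · rw [hk, Finset.sum_eq_single_of_mem k (Finset.mem_univ k), Pi.single_eq_same]
      intro j _ hj
      rw [Pi.single_eq_of_ne hj, zero_mul]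

theorem exists_pow_mul_extendCochain_mem {c : (Fin (p + 1) ↪o Fin (n + 1)) → Laurent K n}
    (hc : c ∈ cochains I m p) : ∃ N₀ : ℕ, ∀ N ≥ N₀, ∀ k S,
      Laurent.x K k ^ N * extendCochain c (insert k S) ∈ localized I S := by
  choose N₀ hN₀ using fun q : Fin (n + 1) × Finset (Fin (n + 1)) =>
    exists_pow_mul_mem_localized (i := q.1) (S := q.2)
      (extendCochain_mem (mem_cochains.1 hc) (insert q.1 q.2)).2
  exact ⟨Finset.univ.sup N₀, fun N hN k S =>
    hN₀ (k, S) N ((Finset.le_sup (f := N₀) (Finset.mem_univ (k, S))).trans hN)⟩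

theorem mul_contraction_mem_localized {k : Fin (n + 1)} {f g : Laurent K n}
    (hf : f ∈ localized ⊤ ∅) {c : (Fin (p + 2) ↪o Fin (n + 1)) → Laurent K n}
    (hc : ∀ S, g * extendCochain c (insert k S) ∈ localized I S)
    (s : Fin (p + 1) ↪o Fin (n + 1)) :
    f * g * contraction k c s ∈ localized I (Finset.univ.map s.toEmbedding) := by
  rw [contraction]
  split_ifs
  · rw [mul_zero]
    exact zero_mem _
  · rw [mul_smul_comm, mul_assoc]
    exact Submodule.smul_mem _ _
      (mul_mem_localized (localized_mono (Finset.empty_subset _) hf) (hc _))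

theorem contraction_mem_laurentDegree {k : Fin (n + 1)}
    {c : (Fin (p + 2) ↪o Fin (n + 1)) → Laurent K n} (hc : c ∈ cochains I m (p + 1))
    (s : Fin (p + 1) ↪o Fin (n + 1)) : contraction k c s ∈ laurentDegree K n m := by
  rw [contraction]
  split_ifs
  · exact zero_mem _
  · exact Submodule.smul_mem _ _ (extendCochain_mem (mem_cochains.1 hc) _).1

theorem coboundary_sum_mul {ι : Type*} (t : Finset ι) (A : ι → Laurent K n)
    (c : ι → (Fin (p + 1) ↪o Fin (n + 1)) → Laurent K n) :
    coboundary K n p (fun s => ∑ k ∈ t, A k * c k s) =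
      fun s => ∑ k ∈ t, A k * coboundary K n p (c k) s := by
  have hsum : (fun s => ∑ k ∈ t, A k * c k s) =
      ∑ k ∈ t, fun s => LinearMap.mulLeft K (A k) (c k s) := by
    ext1 s
    simp
  ext1 s
  rw [hsum, map_sum, Finset.sum_apply]
  exact Finset.sum_congr rfl fun k _ => by rw [coboundary_comp]; rfl

-- Every monomial of large degree contains a high power of some `xₖ`, which clears the denominators
-- of the cone with vertex `xₖ`.
theorem exists_pow_mul_sub_coboundary_mem {L : MvPolynomial (Fin (n + 1)) K}
    (hL : L.IsHomogeneous 1) {b : (Fin (p + 2) ↪o Fin (n + 1)) → Laurent K n}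
    (hb : b ∈ cochains ⊤ m (p + 1)) (hd : coboundary K n (p + 1) b ∈ cochains I m (p + 2)) :
    ∃ M : ℕ, ∃ a ∈ cochains ⊤ (M + m) p, ∀ s, toLaurent K n L ^ M * b s - coboundary K n p a s ∈
      localized I (Finset.univ.map s.toEmbedding) := by
  obtain ⟨N₁, hN₁⟩ := exists_pow_mul_extendCochain_mem hb
  obtain ⟨N₂, hN₂⟩ := exists_pow_mul_extendCochain_mem hd
  let N := max N₁ N₂
  obtain ⟨a, ha, hLa⟩ := exists_eq_sum_mul_pow (N := N) (P := L ^ ((n + 1) * N))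
    (by simpa using hL.pow ((n + 1) * N))
  let A : Fin (n + 1) → Laurent K n := fun k => toLaurent K n (a k) * Laurent.x K k ^ N
  have hLA : toLaurent K n L ^ ((n + 1) * N) = ∑ k, A k := by
    simp only [← map_pow, hLa, map_sum, map_mul, A]
    simp only [map_pow, toLaurent_X]
  have hAdeg : ∀ k, A k ∈ laurentDegree K n ((n + 1) * N : ℕ) := fun k => by
    have hmul := mul_mem_laurentDegree (toLaurent_mem_laurentDegree (ha k))
      (pow_mem_laurentDegree (x_mem_laurentDegree (K := K) k) N)
    have hdeg : ((n * N : ℕ) : ℤ) + (N : ℤ) * 1 = ((n + 1) * N : ℕ) := by push_cast; ring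
    rwa [hdeg] at hmul
  refine ⟨(n + 1) * N, fun s => ∑ k, A k * contraction k b s, mem_cochains.2 fun s => ⟨?_, ?_⟩,
    fun s => ?_⟩
  · exact Submodule.sum_mem _ fun k _ =>
      mul_mem_laurentDegree (hAdeg k) (contraction_mem_laurentDegree hb s)
  · exact Submodule.sum_mem _ fun k _ => mul_contraction_mem_localized
      (toLaurent_mem_localized_top _) (hN₁ N (le_max_left _ _) k) s
  · rw [coboundary_sum_mul, hLA, Finset.sum_mul, ← Finset.sum_sub_distrib]
    refine Submodule.sum_mem _ fun k _ => ?_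
    have hcone : b s - coboundary K n p (contraction k b) s =
        contraction k (coboundary K n (p + 1) b) s :=
      sub_eq_of_eq_add' (congrFun (coboundary_contraction_add k b) s).symm
    rw [← mul_sub, hcone]
    exact mul_contraction_mem_localized (toLaurent_mem_localized_top _)
      (hN₂ N (le_max_right _ _) k) s

theorem mem_map_toEmbedding_zero (s : Fin (p + 1) ↪o Fin (n + 1)) :
    s 0 ∈ Finset.univ.map s.toEmbedding :=
  Finset.mem_map.2 ⟨0, Finset.mem_univ _, rfl⟩

/-- The linear form `L` has no zeros on the subscheme defined by `I`: on every chart it is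
invertible modulo `I`, with inverse `θ i`. -/
structure IsNowhereZero (I : Ideal (MvPolynomial (Fin (n + 1)) K))
    (L : MvPolynomial (Fin (n + 1)) K) (θ : Fin (n + 1) → Laurent K n) : Prop where
  isHomogeneous : L.IsHomogeneous 1
  mem_degree : ∀ i, θ i ∈ laurentDegree K n (-1)
  mem_localized : ∀ i, θ i ∈ localized ⊤ {i}
  mul_sub_one_mem : ∀ i, toLaurent K n L * θ i - 1 ∈ localized I {i}

namespace IsNowhereZero

variable {L : MvPolynomial (Fin (n + 1)) K} {θ : Fin (n + 1) → Laurent K n}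

theorem pow_mul_pow_sub_one_mem (h : IsNowhereZero I L θ) (i : Fin (n + 1)) (M : ℕ) :
    toLaurent K n L ^ M * θ i ^ M - 1 ∈ localized I {i} := by
  rw [← mul_pow]
  exact pow_sub_one_mem_localized
    (mul_mem_localized (toLaurent_mem_localized_top _) (h.mem_localized i)) (h.mul_sub_one_mem i) M

theorem pow_mul_pow_mul_sub_mem (h : IsNowhereZero I L θ) {i : Fin (n + 1)} (M : ℕ)
    {S : Finset (Fin (n + 1))} (hi : i ∈ S) {f : Laurent K n} (hf : f ∈ localized ⊤ S) :
    toLaurent K n L ^ M * (θ i ^ M * f) - f ∈ localized I S := by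
  have hsplit : toLaurent K n L ^ M * (θ i ^ M * f) - f =
      (toLaurent K n L ^ M * θ i ^ M - 1) * f := by ring
  rw [hsplit]
  exact mul_mem_localized' (localized_mono (Finset.singleton_subset_iff.2 hi)
    (h.pow_mul_pow_sub_one_mem i M)) hf

theorem sub_pow_mul_mem (h : IsNowhereZero I L θ) {i : Fin (n + 1)} (M : ℕ)
    {S : Finset (Fin (n + 1))} (hi : i ∈ S) {f g : Laurent K n} (hf : f ∈ localized ⊤ S)
    (hfg : toLaurent K n L ^ M * f - g ∈ localized I S) : f - θ i ^ M * g ∈ localized I S := by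
  have hθ : θ i ^ M ∈ localized ⊤ S := pow_mem_localized_top
    (localized_mono (Finset.singleton_subset_iff.2 hi) (h.mem_localized i)) M
  have hsplit : f - θ i ^ M * g = θ i ^ M * (toLaurent K n L ^ M * f - g) -
      (toLaurent K n L ^ M * (θ i ^ M * f) - f) := by ring
  rw [hsplit]
  exact sub_mem (mul_mem_localized hθ hfg) (h.pow_mul_pow_mul_sub_mem M hi hf)

theorem mem_of_pow_mul_mem (h : IsNowhereZero I L θ) {i : Fin (n + 1)} (M : ℕ)
    {S : Finset (Fin (n + 1))} (hi : i ∈ S) {f : Laurent K n} (hf : f ∈ localized ⊤ S)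
    (hLf : toLaurent K n L ^ M * f ∈ localized I S) : f ∈ localized I S := by
  rw [← sub_zero (f : Laurent K n), ← mul_zero (θ i ^ M)]
  exact h.sub_pow_mul_mem M hi hf (by rwa [sub_zero])

theorem pow_mul_mem_cochains (h : IsNowhereZero I L θ) (M : ℕ)
    {a : (Fin (p + 1) ↪o Fin (n + 1)) → Laurent K n} (ha : a ∈ cochains ⊤ (M + m) p) :
    (fun s => θ (s 0) ^ M * a s) ∈ cochains ⊤ m p := by
  refine mem_cochains.2 fun s => ⟨?_, ?_⟩
  · have hmul := mul_mem_laurentDegree (pow_mem_laurentDegree (h.mem_degree (s 0)) M)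
      (mem_cochains.1 ha s).1
    have hdeg : (M : ℤ) * -1 + (M + m) = m := by ring
    rwa [hdeg] at hmul
  · exact mul_mem_localized (pow_mem_localized_top (localized_mono
      (Finset.singleton_subset_iff.2 (mem_map_toEmbedding_zero s)) (h.mem_localized _)) M)
      (mem_cochains.1 ha s).2

theorem exists_sub_coboundary_mem (h : IsNowhereZero I L θ)
    {b : (Fin (p + 2) ↪o Fin (n + 1)) → Laurent K n} (hb : b ∈ cochains ⊤ m (p + 1))
    (hd : coboundary K n (p + 1) b ∈ cochains I m (p + 2)) :
    ∃ a ∈ cochains ⊤ m p, b - coboundary K n p a ∈ cochains I m (p + 1) := by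
  obtain ⟨M, a, ha, hba⟩ := exists_pow_mul_sub_coboundary_mem h.isHomogeneous hb hd
  let a' : (Fin (p + 1) ↪o Fin (n + 1)) → Laurent K n := fun s => θ (s 0) ^ M * a s
  have ha' : a' ∈ cochains ⊤ m p := h.pow_mul_mem_cochains M ha
  refine ⟨a', ha', mem_cochains.2 fun s => ?_⟩
  obtain ⟨hdeg, hloc⟩ :=
    mem_cochains.1 (sub_mem hb (coboundary_mem_cochains ha')) s
  refine ⟨hdeg, h.mem_of_pow_mul_mem M (mem_map_toEmbedding_zero s) hloc ?_⟩
  have hdiff : coboundary K n p (fun s => LinearMap.mulLeft K (toLaurent K n L ^ M) (a' s)) s -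
      coboundary K n p a s ∈ localized I (Finset.univ.map s.toEmbedding) := by
    rw [← Pi.sub_apply, ← map_sub]
    exact coboundary_mem localized_mono_set (fun t => h.pow_mul_pow_mul_sub_mem M
      (mem_map_toEmbedding_zero t) (mem_cochains.1 ha t).2) s
  have hsplit : toLaurent K n L ^ M * (b - coboundary K n p a') s =
      (toLaurent K n L ^ M * b s - coboundary K n p a s) -
      (coboundary K n p (fun s => LinearMap.mulLeft K (toLaurent K n L ^ M) (a' s)) s -
        coboundary K n p a s) := by
    rw [coboundary_comp, Pi.sub_apply, mul_sub]
    simp only [LinearMap.mulLeft_apply]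
    ring
  rw [hsplit]
  exact sub_mem (hba s) hdiff

theorem subsingleton_cohomology (h : IsNowhereZero I L θ) (hm : -(n : ℤ) ≤ m ∨ p + 2 ≠ n) :
    Subsingleton (cohomology I m (p + 2)) := by
  rw [Submodule.Quotient.subsingleton_iff, Submodule.submoduleOf,
    Submodule.comap_subtype_eq_top]
  rintro c ⟨hc, hdc⟩
  obtain ⟨b, hb, rfl⟩ := exists_coboundary_eq_of_top hm (cochains_le_top hc) hdc
  obtain ⟨a, -, hba⟩ := h.exists_sub_coboundary_mem hb hc
  exact ⟨_, hba, by rw [map_sub, coboundary_coboundary, sub_zero]⟩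

end IsNowhereZero

end Cech

section ZeroCochains

variable {K : Type*} [Field K] {n : ℕ} {I : Ideal (MvPolynomial (Fin (n + 1)) K)} {m : ℤ}

/-- The `0`-cochain with given values on the charts. -/
def zeroCochain (β : Fin (n + 1) → Laurent K n) : (Fin (0 + 1) ↪o Fin (n + 1)) → Laurent K n :=
  fun s => β (s 0)

theorem map_toEmbedding_one (s : Fin (0 + 1) ↪o Fin (n + 1)) :
    Finset.univ.map s.toEmbedding = {s 0} := by
  ext x; simp

theorem exists_orderEmb_one (i : Fin (n + 1)) : ∃ s : Fin (0 + 1) ↪o Fin (n + 1), s 0 = i := by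
  obtain ⟨s, hs⟩ :=
    exists_map_toEmbedding_eq (S := ({i} : Finset (Fin (n + 1)))) (p := 0 + 1) (by simp)
  rw [map_toEmbedding_one] at hs
  exact ⟨s, Finset.singleton_injective hs⟩

theorem exists_zeroCochain_eq (b : (Fin (0 + 1) ↪o Fin (n + 1)) → Laurent K n) :
    ∃ β, b = zeroCochain β := by
  choose s hs using exists_orderEmb_one (n := n)
  refine ⟨fun i => b (s i), funext fun t => ?_⟩
  change b t = b (s (t 0))
  congr 1
  refine DFunLike.ext _ _ fun j => ?_
  have hj : j = 0 := Subsingleton.elim (α := Fin 1) j 0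
  rw [hj, hs]

theorem zeroCochain_mem_cochains {β : Fin (n + 1) → Laurent K n} :
    zeroCochain β ∈ cochains I m 0 ↔ ∀ i, β i ∈ sections I m {i} := by
  rw [mem_cochains]
  constructor
  · intro h i
    obtain ⟨s, rfl⟩ := exists_orderEmb_one i
    have hs := h s
    rwa [map_toEmbedding_one] at hs
  · intro h s
    rw [map_toEmbedding_one]
    exact h _

theorem coboundary_zeroCochain (β : Fin (n + 1) → Laurent K n) (s : Fin (0 + 2) ↪o Fin (n + 1)) :
    coboundary K n 0 (zeroCochain β) s = β (s 1) - β (s 0) := by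
  simp [coboundary, Fin.sum_univ_two, zeroCochain, sub_eq_add_neg]

theorem map_toEmbedding_two (s : Fin (0 + 2) ↪o Fin (n + 1)) :
    Finset.univ.map s.toEmbedding = {s 0, s 1} := by
  ext x; simp [Fin.exists_fin_two, eq_comm]

theorem exists_orderEmb_two {i j : Fin (n + 1)} (h : i < j) :
    ∃ s : Fin (0 + 2) ↪o Fin (n + 1), s 0 = i ∧ s 1 = j := by
  refine ⟨OrderEmbedding.ofStrictMono ![i, j] ?_, rfl, rfl⟩
  rw [Fin.strictMono_iff_lt_succ]
  intro k
  rw [Subsingleton.elim k 0]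
  exact h

theorem zeroCochain_mem_quotientCocycles {β : Fin (n + 1) → Laurent K n} :
    zeroCochain β ∈ quotientCocycles I m ↔
      (∀ i, β i ∈ sections ⊤ m {i}) ∧ ∀ i j, β j - β i ∈ localized I {i, j} := by
  rw [quotientCocycles, Submodule.mem_inf, zeroCochain_mem_cochains, Submodule.mem_comap,
    mem_cochains]
  refine and_congr_right fun hβ => ⟨fun h i j => ?_, fun h s => ?_⟩
  · rcases lt_trichotomy i j with hij | rfl | hij
    · obtain ⟨s, rfl, rfl⟩ := exists_orderEmb_two hij
      have hmem : coboundary K n 0 (zeroCochain β) s ∈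
        localized I (Finset.univ.map s.toEmbedding) := (h s).2
      rwa [coboundary_zeroCochain, map_toEmbedding_two] at hmem
    · rw [sub_self]; exact zero_mem _
    · obtain ⟨s, rfl, rfl⟩ := exists_orderEmb_two hij
      have hmem : coboundary K n 0 (zeroCochain β) s ∈
        localized I (Finset.univ.map s.toEmbedding) := (h s).2
      rw [coboundary_zeroCochain, map_toEmbedding_two] at hmem
      rw [← neg_sub, Finset.pair_comm]
      exact neg_mem hmem
  · rw [coboundary_zeroCochain, map_toEmbedding_two]
    exact ⟨(laurentDegree K n m).sub_mem (hβ _).1 (hβ _).1, h _ _⟩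

-- A section of `𝒪_Z(m)`, given by functions `β i` on the charts, lifts to a section `f` of `𝒪(m)`.
theorem subsingleton_cohomology_one_iff (hn : n ≠ 1) :
    Subsingleton (cohomology I m 1) ↔ ∀ β : Fin (n + 1) → Laurent K n,
      (∀ i, β i ∈ sections ⊤ m {i}) → (∀ i j, β j - β i ∈ localized I {i, j}) →
      ∃ f : Laurent K n, (∀ i, f ∈ sections ⊤ m {i}) ∧ ∀ i, β i - f ∈ localized I {i} := by
  rw [Submodule.Quotient.subsingleton_iff, Submodule.submoduleOf, Submodule.comap_subtype_eq_top]
  constructor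
  · intro h β hβ hβ'
    have hmem := zeroCochain_mem_quotientCocycles.2 ⟨hβ, hβ'⟩
    obtain ⟨b, hb, hγβ⟩ := h ⟨hmem.2, coboundary_coboundary (zeroCochain β)⟩
    obtain ⟨γ, rfl⟩ := exists_zeroCochain_eq b
    rw [SetLike.mem_coe, zeroCochain_mem_cochains] at hb
    have hconst : ∀ i, β i - γ i = β 0 - γ 0 := by
      intro i
      rcases eq_or_ne i 0 with rfl | hi
      · rfl
      obtain ⟨s, h0, h1⟩ := exists_orderEmb_two (Fin.pos_of_ne_zero hi)
      have heq : coboundary K n 0 (zeroCochain γ) s = coboundary K n 0 (zeroCochain β) s :=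
        congrFun hγβ s
      rw [coboundary_zeroCochain, coboundary_zeroCochain, h0, h1] at heq
      linear_combination -heq
    refine ⟨β 0 - γ 0, fun i => ?_, fun i => ?_⟩
    · rw [← hconst i]
      exact sub_mem (hβ i) ⟨(hb i).1, localized_mono_ideal le_top (hb i).2⟩
    · rw [← hconst i, sub_sub_cancel]
      exact (hb i).2
  · rintro h c ⟨hc, hdc⟩
    obtain ⟨b, hb, rfl⟩ := exists_coboundary_eq_of_top (p := 0) (Or.inr hn.symm)
      (cochains_le_top hc) hdc
    obtain ⟨β, rfl⟩ := exists_zeroCochain_eq b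
    obtain ⟨hβ, hβ'⟩ := zeroCochain_mem_quotientCocycles.1
      (⟨hb, hc⟩ : zeroCochain β ∈ quotientCocycles I m)
    obtain ⟨f, hf, hβf⟩ := h β hβ hβ'
    refine ⟨zeroCochain fun i => β i - f, zeroCochain_mem_cochains.2 fun i =>
      ⟨(laurentDegree K n m).sub_mem (hβ i).1 (hf i).1, hβf i⟩, ?_⟩
    ext1 s
    rw [coboundary_zeroCochain, coboundary_zeroCochain, sub_sub_sub_cancel_right]

end ZeroCochains

section Dehomogenization

variable {K : Type*} [Field K] {n : ℕ} {I : Ideal (MvPolynomial (Fin (n + 1)) K)}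
  {L : MvPolynomial (Fin (n + 1)) K} {i : Fin (n + 1)} {τ : Laurent K n}

/-- Evaluation of polynomials at the functions `xⱼ τ`, for a section `τ` of `𝒪(-1)` on a chart. -/
noncomputable def evalChart (τ : Laurent K n) : MvPolynomial (Fin (n + 1)) K →ₐ[K] Laurent K n :=
  aeval fun j => Laurent.x K j * τ

theorem evalChart_of_homogeneous {m : ℕ} {f : MvPolynomial (Fin (n + 1)) K}
    (hf : f.IsHomogeneous m) : evalChart τ f = τ ^ m * toLaurent K n f := by
  have hlin : (evalChart τ).toLinearMap ∘ₗ Submodule.subtype _ =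
      LinearMap.mulLeft K τ ∘ₗ (toLaurent K n).toLinearMap ∘ₗ Submodule.subtype _ :=
    (linearFormsBasis K (Fin (n + 1))).ext fun j => by
      simp [evalChart, toLaurent_X, mul_comm]
  simpa using pow_mul_eq_of_mem_homogeneousSubmodule (evalChart τ) (toLaurent K n) (a := 1) (b := τ)
    (fun P hP => (one_mul _).trans (LinearMap.congr_fun hlin ⟨P, hP⟩)) hf

theorem evalChart_mem_laurentDegree (hτ : τ ∈ laurentDegree K n (-1))
    (f : MvPolynomial (Fin (n + 1)) K) : evalChart τ f ∈ laurentDegree K n 0 := by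
  induction f using MvPolynomial.induction_on with
  | C a =>
    rw [evalChart, aeval_C, Algebra.algebraMap_eq_smul_one]
    exact Submodule.smul_mem _ _ (SetLike.one_mem_graded _)
  | add p q hp hq => rw [map_add]; exact add_mem hp hq
  | mul_X p j hp =>
    have hmul := mul_mem_laurentDegree hp (mul_mem_laurentDegree (x_mem_laurentDegree j) hτ)
    simpa [evalChart] using hmul

theorem evalChart_mem_localized (hτ : τ ∈ localized ⊤ {i}) (f : MvPolynomial (Fin (n + 1)) K) :
    evalChart τ f ∈ localized ⊤ {i} := by
  induction f using MvPolynomial.induction_on with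
  | C a =>
    rw [evalChart, aeval_C, Algebra.algebraMap_eq_smul_one]
    exact Submodule.smul_mem _ _ one_mem_localized_top
  | add p q hp hq => rw [map_add]; exact add_mem hp hq
  | mul_X p j hp =>
    rw [map_mul]
    refine mul_mem_localized hp ?_
    rw [evalChart, aeval_X, ← toLaurent_X]
    exact mul_mem_localized (toLaurent_mem_localized_top _) hτ

theorem evalChart_mem_of_mem (hI : IsHomogeneousIdeal I) (hτ : τ ∈ localized ⊤ {i})
    {f : MvPolynomial (Fin (n + 1)) K} (hf : f ∈ I) : evalChart τ f ∈ localized I {i} := by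
  rw [← sum_homogeneousComponent f, map_sum]
  refine Submodule.sum_mem _ fun m _ => ?_
  rw [evalChart_of_homogeneous (homogeneousComponent_isHomogeneous m f)]
  exact mul_mem_localized (pow_mem_localized_top hτ m) (toLaurent_mem_localized (hI f hf m))

theorem evalChart_mem_of_mem_span (hτ : τ ∈ localized ⊤ {i}) (hL : L.IsHomogeneous 1)
    (hLτ : toLaurent K n L * τ - 1 ∈ localized I {i}) {f : MvPolynomial (Fin (n + 1)) K}
    (hf : f ∈ Ideal.span {L - 1}) : evalChart τ f ∈ localized I {i} := by
  obtain ⟨c, rfl⟩ := Ideal.mem_span_singleton'.1 hf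
  rw [map_mul, map_sub, map_one, evalChart_of_homogeneous hL, pow_one, mul_comm τ]
  exact mul_mem_localized (evalChart_mem_localized hτ c) hLτ

theorem evalChart_mem_of_mem_sup (hI : IsHomogeneousIdeal I) (hτ : τ ∈ localized ⊤ {i})
    (hL : L.IsHomogeneous 1) (hLτ : toLaurent K n L * τ - 1 ∈ localized I {i})
    {f : MvPolynomial (Fin (n + 1)) K} (hf : f ∈ I ⊔ Ideal.span {L - 1}) :
    evalChart τ f ∈ localized I {i} := by
  obtain ⟨a, ha, b, hb, rfl⟩ := Submodule.mem_sup.1 hf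
  rw [map_add]
  exact add_mem (evalChart_mem_of_mem hI hτ ha) (evalChart_mem_of_mem_span hτ hL hLτ hb)

theorem one_sub_pow_mem_span (L : MvPolynomial (Fin (n + 1)) K) (M : ℕ) :
    1 - L ^ M ∈ Ideal.span {L - 1} := by
  rw [Ideal.mem_span_singleton, ← dvd_neg, neg_sub]
  exact sub_one_dvd_pow_sub_one L M

theorem exists_homogeneous_sub_mem_span (hL : L.IsHomogeneous 1)
    (f : MvPolynomial (Fin (n + 1)) K) :
    ∃ (M : ℕ) (F : MvPolynomial (Fin (n + 1)) K), F.IsHomogeneous M ∧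
      f - F ∈ Ideal.span {L - 1} := by
  refine ⟨f.totalDegree, ∑ m ∈ Finset.range (f.totalDegree + 1),
    homogeneousComponent m f * L ^ (f.totalDegree - m), ?_, ?_⟩
  · refine IsHomogeneous.sum _ _ _ fun m hm => ?_
    have hmul := (homogeneousComponent_isHomogeneous m f).mul (hL.pow (f.totalDegree - m))
    rwa [one_mul, Nat.add_sub_cancel' (Finset.mem_range_succ_iff.1 hm)] at hmul
  · nth_rw 1 [← sum_homogeneousComponent f]
    rw [← Finset.sum_sub_distrib]
    refine Ideal.sum_mem _ fun m _ => ?_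
    rw [← mul_one_sub]
    exact Ideal.mul_mem_left _ _ (one_sub_pow_mem_span L _)

theorem toLaurent_mem_of_evalChart_mem (hτ : τ ∈ localized ⊤ {i}) (hL : L.IsHomogeneous 1)
    (hLτ : toLaurent K n L * τ - 1 ∈ localized I {i}) {f F : MvPolynomial (Fin (n + 1)) K} {m : ℕ}
    (hF : F.IsHomogeneous m) (hfF : f - F ∈ Ideal.span {L - 1})
    (hf : evalChart τ f ∈ localized I {i}) : toLaurent K n F ∈ localized I {i} := by
  have hFτ : τ ^ m * toLaurent K n F ∈ localized I {i} := by
    have hsub := sub_mem hf (evalChart_mem_of_mem_span hτ hL hLτ hfF)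
    rwa [← map_sub, sub_sub_cancel, evalChart_of_homogeneous hF] at hsub
  have hpow := pow_sub_one_mem_localized
    (mul_mem_localized (toLaurent_mem_localized_top L) hτ) hLτ m
  have hsplit : toLaurent K n F = toLaurent K n (L ^ m) * (τ ^ m * toLaurent K n F) -
      ((toLaurent K n L * τ) ^ m - 1) * toLaurent K n F := by
    rw [map_pow]
    ring
  rw [hsplit]
  exact sub_mem (mul_mem_localized (toLaurent_mem_localized_top _) hFτ)
    (mul_mem_localized' hpow (toLaurent_mem_localized_top _))

theorem mem_sup_span_of_pow_mul_mem {f F : MvPolynomial (Fin (n + 1)) K} {M : ℕ}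
    (hfF : f - F ∈ Ideal.span {L - 1}) (hF : L ^ M * F ∈ I) : f ∈ I ⊔ Ideal.span {L - 1} := by
  have hsplit : f = L ^ M * F + (f - F + F * (1 - L ^ M)) := by ring
  rw [hsplit]
  exact Submodule.add_mem_sup hF
    (add_mem hfF (Ideal.mul_mem_left _ _ (one_sub_pow_mem_span L M)))

end Dehomogenization

section FormsImage

variable {K σ : Type*} [Field K] {𝔞 𝔟 : Ideal (MvPolynomial σ K)}

/-- The image of the forms of degree `m` in a quotient of the polynomial ring. For
`𝔞 = I ⊔ Ideal.span {L - 1}` it consists of the functions `F / L ^ m` on the subscheme of the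
affine space `L ≠ 0` defined by `I`. -/
noncomputable def formsImage (𝔞 : Ideal (MvPolynomial σ K)) (m : ℕ) :
    Submodule K (MvPolynomial σ K ⧸ 𝔞) :=
  (homogeneousSubmodule σ K m).map (Ideal.Quotient.mkₐ K 𝔞).toLinearMap

instance finiteDimensional_formsImage [Finite σ] (m : ℕ) :
    FiniteDimensional K (formsImage 𝔞 m) :=
  Module.Finite.map _ _

theorem formsImage_one_pow (m : ℕ) : formsImage 𝔞 1 ^ m = formsImage 𝔞 m := by
  rw [formsImage, formsImage, ← Submodule.map_pow, homogeneousSubmodule_one_pow]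

theorem map_formsImage (h : 𝔞 ≤ 𝔟) (m : ℕ) :
    (formsImage 𝔞 m).map (Ideal.Quotient.factorₐ K h).toLinearMap = formsImage 𝔟 m := by
  rw [formsImage, formsImage, ← Submodule.map_comp]
  rfl

theorem one_mem_formsImage {L : MvPolynomial σ K} (hL : L.IsHomogeneous 1) (h : L - 1 ∈ 𝔞) :
    1 ∈ formsImage 𝔞 1 :=
  ⟨L, hL, (Ideal.Quotient.eq (x := L) (y := 1)).2 h⟩

theorem formsImage_mono (h1 : 1 ∈ formsImage 𝔞 1) : Monotone (formsImage 𝔞) := fun l m hlm => by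
  rw [← formsImage_one_pow l, ← formsImage_one_pow m]
  exact pow_le_pow_right₀ (Submodule.one_le.2 h1) hlm

theorem formsImage_eq_top_of_le (h : 𝔞 ≤ 𝔟) {m : ℕ} (hm : formsImage 𝔞 m = ⊤) :
    formsImage 𝔟 m = ⊤ := by
  rw [← map_formsImage h, hm, Submodule.map_top, LinearMap.range_eq_top]
  exact Ideal.Quotient.factor_surjective h

theorem finrank_formsImage_le_of_le [Finite σ] (h : 𝔞 ≤ 𝔟) (m : ℕ) :
    finrank K (formsImage 𝔟 m) ≤ finrank K (formsImage 𝔞 m) := by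
  rw [← map_formsImage h]
  exact Submodule.finrank_map_le _ _

theorem SpansQuotients.formsImage_of_le [IsAlgClosed K] [FiniteDimensional K (MvPolynomial σ K ⧸ 𝔞)]
    {n : ℕ} (h : SpansQuotients (formsImage 𝔞 1) (n + 1)) (hV : finrank K (formsImage 𝔞 1) = n + 1)
    (h1 : 1 ∈ formsImage 𝔞 1) (h𝔟 : 𝔞 ≤ 𝔟) (l : ℕ) :
    SpansQuotients (formsImage 𝔟 l) (n * l + 1) := by
  have hpow := h.pow hV h1 l
  rw [formsImage_one_pow] at hpow
  rw [← map_formsImage h𝔟]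
  exact hpow.map (Ideal.Quotient.factor_surjective h𝔟)

theorem SpansQuotients.exists_rationalNormalCurve [IsAlgClosed K] {n : ℕ}
    {𝔞 : Ideal (MvPolynomial (Fin (n + 1)) K)}
    [FiniteDimensional K (MvPolynomial (Fin (n + 1)) K ⧸ 𝔞)]
    (h : SpansQuotients (formsImage 𝔞 1) (n + 1)) (hV : finrank K (formsImage 𝔞 1) = n + 1)
    (h1 : 1 ∈ formsImage 𝔞 1) {q : ℕ} (hn : 1 ≤ n) (hnq : 2 * n ≤ q) (hq3 : 3 ≤ q)
    (hdim : finrank K (MvPolynomial (Fin (n + 1)) K ⧸ 𝔞) ≤ n * q + n + 1)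
    (hq : formsImage 𝔞 q ≠ ⊤) :
    ∃ (C : ClosedSubscheme K n) (𝔠 : Ideal (MvPolynomial (Fin (n + 1)) K)),
      C.IsRationalNormalCurve ∧ 𝔞 ≤ 𝔠 ∧ C.ideal ≤ 𝔠 ∧
        n * q + 2 ≤ finrank K (MvPolynomial (Fin (n + 1)) K ⧸ 𝔠) := by
  rw [← formsImage_one_pow] at hq
  obtain ⟨J, v, hlen, hv, hli, hrel⟩ :=
    h.exists_quotient_linearIndependent_mul_eq_mul hV h1 hn hnq hq3 hdim hq
  let f := (Ideal.Quotient.mkₐ K J).comp (Ideal.Quotient.mkₐ K 𝔞)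
  have hf : Function.Surjective f :=
    (Ideal.Quotient.mkₐ_surjective K J).comp (Ideal.Quotient.mkₐ_surjective K 𝔞)
  have hmap : (formsImage 𝔞 1).map (Ideal.Quotient.mkₐ K J).toLinearMap =
      (homogeneousSubmodule (Fin (n + 1)) K 1).map f.toLinearMap :=
    (Submodule.map_comp _ _ _).symm
  have h1f : 1 ∈ (homogeneousSubmodule (Fin (n + 1)) K 1).map f.toLinearMap :=
    hmap ▸ ⟨1, h1, map_one (Ideal.Quotient.mkₐ K J)⟩
  obtain ⟨C, hC, hCf⟩ := exists_rationalNormalCurve_of_mul_eq_mul (by omega)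
    (fun i hi => hmap ▸ hv i hi) hli h1f hrel
  refine ⟨C, RingHom.ker f, hC, fun x hx => ?_, hCf, ?_⟩
  · rw [RingHom.mem_ker, AlgHom.comp_apply, Ideal.Quotient.mkₐ_eq_mk K 𝔞,
      Ideal.Quotient.eq_zero_iff_mem.2 hx, map_zero]
  · rwa [(Ideal.quotientKerAlgEquivOfSurjective hf).toLinearEquiv.finrank_eq]

end FormsImage

section ExistsUnit

-- A vector space over an infinite field is not a finite union of proper subspaces, here of the
-- preimages of the finitely many maximal ideals involved.
theorem exists_forall_isUnit_mk {K A ι : Type*} [Field K] [Infinite K] [CommRing A] [Algebra K A]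
    [Finite ι] {J : ι → Ideal A} [∀ i, FiniteDimensional K (A ⧸ J i)] {V : Submodule K A}
    (hV : ∀ i, ∃ v ∈ V, IsUnit (Ideal.Quotient.mk (J i) v)) :
    ∃ v ∈ V, ∀ i, IsUnit (Ideal.Quotient.mk (J i) v) := by
  have hartinian (i : ι) : IsArtinianRing (A ⧸ J i) := IsArtinianRing.of_finite K _
  let H (q : Σ i, MaximalSpectrum (A ⧸ J i)) : Submodule K V :=
    (q.2.asIdeal.restrictScalars K).comap ((Ideal.Quotient.mkₐ K (J q.1)).toLinearMap ∘ₗ V.subtype)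
  have hH (q) : H q ≠ ⊤ := by
    intro hq
    obtain ⟨v, hvV, hv⟩ := hV q.1
    have hmem : (⟨v, hvV⟩ : V) ∈ H q := hq ▸ Submodule.mem_top
    exact q.2.isMaximal.ne_top (Ideal.eq_top_of_isUnit_mem _ hmem hv)
  obtain ⟨v, hv⟩ : ∃ v, ∀ q, v ∉ H q := by
    by_contra! hcover
    obtain ⟨q, hq⟩ := Subspace.exists_eq_top_of_iUnion_eq_univ (p := H)
      (Set.eq_univ_of_forall fun v => Set.mem_iUnion.2 (hcover v))
    exact hH q hq
  refine ⟨v, v.2, fun i => ?_⟩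
  by_contra hunit
  obtain ⟨𝔪, h𝔪, hv𝔪⟩ := exists_max_ideal_of_mem_nonunits hunit
  exact hv ⟨i, ⟨𝔪, h𝔪⟩⟩ hv𝔪

end ExistsUnit

section Existence

variable {K : Type*} [Field K] {n : ℕ} {I : Ideal (MvPolynomial (Fin (n + 1)) K)}

theorem toLaurent_X_mul_xInv_sub_one_mem (i : Fin (n + 1)) :
    toLaurent K n (X i) * Laurent.xInv K i - 1 ∈ localized I {i} := by
  rw [toLaurent_X, x_mul_xInv, sub_self]
  exact zero_mem _

theorem evalChart_xInv_mem_iff (hI : IsHomogeneousIdeal I) {i : Fin (n + 1)}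
    {f : MvPolynomial (Fin (n + 1)) K} :
    evalChart (Laurent.xInv K i) f ∈ localized I {i} ↔ f ∈ I ⊔ Ideal.span {X i - 1} := by
  have hxInv : Laurent.xInv K i ∈ localized ⊤ {i} :=
    xInv_mem_localized (Finset.mem_singleton_self i)
  refine ⟨fun hf => ?_, evalChart_mem_of_mem_sup hI hxInv (isHomogeneous_X K i)
    (toLaurent_X_mul_xInv_sub_one_mem i)⟩
  obtain ⟨M, F, hF, hfF⟩ := exists_homogeneous_sub_mem_span (isHomogeneous_X K i) f
  obtain ⟨N, hN⟩ := mem_localized_singleton_iff.1 (toLaurent_mem_of_evalChart_mem hxInv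
    (isHomogeneous_X K i) (toLaurent_X_mul_xInv_sub_one_mem i) hF hfF hf)
  exact mem_sup_span_of_pow_mul_mem hfF hN

theorem finiteDimensional_quotient_sup_X_sub_one (hI : IsHomogeneousIdeal I) (i : Fin (n + 1))
    (hfin : FiniteDimensional K (sections (⊤ : Ideal (MvPolynomial (Fin (n + 1)) K)) 0 {i} ⧸
      (sections I 0 {i}).submoduleOf (sections ⊤ 0 {i}))) :
    FiniteDimensional K (MvPolynomial (Fin (n + 1)) K ⧸ (I ⊔ Ideal.span {X i - 1})) := by
  have hdeg (f) : evalChart (Laurent.xInv K i) f ∈ laurentDegree K n 0 :=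
    evalChart_mem_laurentDegree (xInv_mem_laurentDegree i) f
  let E : MvPolynomial (Fin (n + 1)) K →ₗ[K]
      sections (⊤ : Ideal (MvPolynomial (Fin (n + 1)) K)) 0 {i} :=
    (evalChart (Laurent.xInv K i)).toLinearMap.codRestrict _ fun f =>
      ⟨hdeg f, evalChart_mem_localized (xInv_mem_localized (Finset.mem_singleton_self i)) f⟩
  let Q := (sections I 0 {i}).submoduleOf (sections ⊤ 0 {i})
  have hker : LinearMap.ker (Q.mkQ ∘ₗ E) = (I ⊔ Ideal.span {X i - 1}).restrictScalars K := by
    ext f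
    rw [LinearMap.mem_ker, LinearMap.comp_apply, Submodule.mkQ_apply,
      Submodule.Quotient.mk_eq_zero, Submodule.restrictScalars_mem, ← evalChart_xInv_mem_iff hI]
    exact and_iff_right (hdeg f)
  have hquot : FiniteDimensional K (MvPolynomial (Fin (n + 1)) K ⧸ LinearMap.ker (Q.mkQ ∘ₗ E)) :=
    (LinearMap.quotKerEquivRange (Q.mkQ ∘ₗ E)).symm.finiteDimensional
  rw [hker] at hquot
  exact (Submodule.Quotient.restrictScalarsEquiv K (I ⊔ Ideal.span {X i - 1})).finiteDimensional

theorem exists_isNowhereZero [Infinite K] (hI : IsHomogeneousIdeal I)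
    (hfin : ∀ i : Fin (n + 1),
      FiniteDimensional K (MvPolynomial (Fin (n + 1)) K ⧸ (I ⊔ Ideal.span {X i - 1}))) :
    ∃ L θ, IsNowhereZero I L θ := by
  have hX (i : Fin (n + 1)) :
      IsUnit (Ideal.Quotient.mk (I ⊔ Ideal.span {X i - 1}) (X i : MvPolynomial _ K)) := by
    have hone : Ideal.Quotient.mk (I ⊔ Ideal.span {X i - 1}) (X i : MvPolynomial _ K) = 1 := by
      rw [← map_one (Ideal.Quotient.mk _), Ideal.Quotient.eq]
      exact Ideal.mem_sup_right (Ideal.mem_span_singleton_self _)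
    exact hone ▸ isUnit_one
  obtain ⟨L, hL, hLunit⟩ := exists_forall_isUnit_mk (V := homogeneousSubmodule (Fin (n + 1)) K 1)
    fun i => ⟨X i, isHomogeneous_X K i, hX i⟩
  have hinverse (i : Fin (n + 1)) : ∃ u, u * L - 1 ∈ I ⊔ Ideal.span {X i - 1} := by
    obtain ⟨v, hv⟩ := (hLunit i).exists_left_inv
    obtain ⟨u, rfl⟩ := Ideal.Quotient.mk_surjective v
    exact ⟨u, Ideal.Quotient.eq.1 (by rw [map_mul, hv, map_one])⟩
  choose u hu using hinverse
  have hxInv (i : Fin (n + 1)) : Laurent.xInv K i ∈ localized ⊤ {i} :=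
    xInv_mem_localized (Finset.mem_singleton_self i)
  refine ⟨L, fun i => evalChart (Laurent.xInv K i) (u i) * Laurent.xInv K i,
    hL, fun i => ?_, fun i => ?_, fun i => ?_⟩
  · have hmul := mul_mem_laurentDegree
      (evalChart_mem_laurentDegree (xInv_mem_laurentDegree i) (u i)) (xInv_mem_laurentDegree i)
    rwa [zero_add] at hmul
  · exact mul_mem_localized (evalChart_mem_localized (hxInv i) _) (hxInv i)
  · have hmem := (evalChart_xInv_mem_iff hI).2 (hu i)
    rw [map_sub, map_mul, map_one, evalChart_of_homogeneous hL, pow_one] at hmem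
    convert hmem using 1
    ring

theorem exists_pow_mul_mem {L : MvPolynomial (Fin (n + 1)) K} (hL : L.IsHomogeneous 1)
    {F : MvPolynomial (Fin (n + 1)) K} (hF : ∀ i, ∃ N : ℕ, X i ^ N * F ∈ I) :
    ∃ M : ℕ, L ^ M * F ∈ I := by
  choose N hN using hF
  obtain ⟨a, -, ha⟩ := exists_eq_sum_mul_pow (N := Finset.univ.sup N)
    (P := L ^ ((n + 1) * Finset.univ.sup N)) (by simpa only [one_mul] using hL.pow _)
  refine ⟨(n + 1) * Finset.univ.sup N, ?_⟩
  rw [ha, Finset.sum_mul]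
  refine Ideal.sum_mem _ fun k _ => ?_
  rw [mul_assoc, ← pow_sub_mul_pow (X k) (Finset.le_sup (f := N) (Finset.mem_univ k)), mul_assoc]
  exact Ideal.mul_mem_left _ _ (Ideal.mul_mem_left _ _ (hN k))

end Existence

namespace IsNowhereZero

variable {K : Type*} [Field K] {n : ℕ} {I : Ideal (MvPolynomial (Fin (n + 1)) K)}
  {L : MvPolynomial (Fin (n + 1)) K} {θ : Fin (n + 1) → Laurent K n}

theorem mono (h : IsNowhereZero I L θ) {J : Ideal (MvPolynomial (Fin (n + 1)) K)} (hIJ : I ≤ J) :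
    IsNowhereZero J L θ :=
  ⟨h.isHomogeneous, h.mem_degree, h.mem_localized,
    fun i => localized_mono_ideal hIJ (h.mul_sub_one_mem i)⟩

theorem mem_localized_of_mem (h : IsNowhereZero I L θ) {i : Fin (n + 1)}
    {S : Finset (Fin (n + 1))} (hi : i ∈ S) : θ i ∈ localized ⊤ S :=
  localized_mono (Finset.singleton_subset_iff.2 hi) (h.mem_localized i)

theorem mul_sub_one_mem_of_mem (h : IsNowhereZero I L θ) {i : Fin (n + 1)}
    {S : Finset (Fin (n + 1))} (hi : i ∈ S) : toLaurent K n L * θ i - 1 ∈ localized I S :=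
  localized_mono (Finset.singleton_subset_iff.2 hi) (h.mul_sub_one_mem i)

theorem sub_mem_localized (h : IsNowhereZero I L θ) (i j : Fin (n + 1)) :
    θ j - θ i ∈ localized I {i, j} := by
  have hi : i ∈ ({i, j} : Finset (Fin (n + 1))) := by simp
  have hj : j ∈ ({i, j} : Finset (Fin (n + 1))) := by simp
  have hsplit : θ j - θ i =
      θ i * (toLaurent K n L * θ j - 1) - θ j * (toLaurent K n L * θ i - 1) := by ring
  rw [hsplit]
  exact sub_mem (mul_mem_localized (h.mem_localized_of_mem hi) (h.mul_sub_one_mem_of_mem hj))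
    (mul_mem_localized (h.mem_localized_of_mem hj) (h.mul_sub_one_mem_of_mem hi))

theorem pow_sub_pow_mem (h : IsNowhereZero I L θ) (i j : Fin (n + 1)) (m : ℕ) :
    θ j ^ m - θ i ^ m ∈ localized I {i, j} := by
  have hi := h.mem_localized_of_mem (i := i) (S := {i, j}) (by simp)
  have hj := h.mem_localized_of_mem (i := j) (S := {i, j}) (by simp)
  rw [← Commute.mul_geom_sum₂ (Commute.all _ _)]
  refine mul_mem_localized' (h.sub_mem_localized i j) (Submodule.sum_mem _ fun k _ => ?_)
  exact mul_mem_localized (pow_mem_localized_top hj k) (pow_mem_localized_top hi _)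

theorem evalChart_sub_mem (h : IsNowhereZero I L θ) (i j : Fin (n + 1))
    (f : MvPolynomial (Fin (n + 1)) K) :
    evalChart (θ j) f - evalChart (θ i) f ∈ localized I {i, j} := by
  rw [← sum_homogeneousComponent f, map_sum, map_sum, ← Finset.sum_sub_distrib]
  refine Submodule.sum_mem _ fun m _ => ?_
  rw [evalChart_of_homogeneous (homogeneousComponent_isHomogeneous m f),
    evalChart_of_homogeneous (homogeneousComponent_isHomogeneous m f), ← sub_mul]
  exact mul_mem_localized' (h.pow_sub_pow_mem i j m) (toLaurent_mem_localized_top _)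

theorem evalChart_mem_sections (h : IsNowhereZero I L θ) (i : Fin (n + 1))
    (f : MvPolynomial (Fin (n + 1)) K) : evalChart (θ i) f ∈ sections ⊤ 0 {i} :=
  ⟨evalChart_mem_laurentDegree (h.mem_degree i) f, evalChart_mem_localized (h.mem_localized i) f⟩

theorem mem_sup_iff (h : IsNowhereZero I L θ) (hI : IsHomogeneousIdeal I)
    {f : MvPolynomial (Fin (n + 1)) K} :
    f ∈ I ⊔ Ideal.span {L - 1} ↔ ∀ i, evalChart (θ i) f ∈ localized I {i} := by
  refine ⟨fun hf i => evalChart_mem_of_mem_sup hI (h.mem_localized i) h.isHomogeneous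
    (h.mul_sub_one_mem i) hf, fun hf => ?_⟩
  obtain ⟨M, F, hF, hfF⟩ := exists_homogeneous_sub_mem_span h.isHomogeneous f
  obtain ⟨N, hN⟩ := exists_pow_mul_mem h.isHomogeneous fun i => mem_localized_singleton_iff.1
    (toLaurent_mem_of_evalChart_mem (h.mem_localized i) h.isHomogeneous (h.mul_sub_one_mem i)
      hF hfF (hf i))
  exact mem_sup_span_of_pow_mul_mem hfF hN

theorem exists_pow_mul_eq_toLaurent {β : Fin (n + 1) → Laurent K n}
    (hβ : ∀ i, β i ∈ sections ⊤ 0 {i}) (hβI : ∀ i j, β j - β i ∈ localized I {i, j}) :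
    ∃ (N : ℕ) (g : Fin (n + 1) → MvPolynomial (Fin (n + 1)) K), ∀ k, (g k).IsHomogeneous N ∧
      toLaurent K n (g k) = Laurent.x K k ^ N * β k ∧
      ∀ i, Laurent.x K k ^ N * (β k - β i) ∈ localized I {i} := by
  have hbound (q : Fin (n + 1) × Fin (n + 1)) : ∃ N₀ : ℕ, ∀ N ≥ N₀,
      Laurent.x K q.2 ^ N * β q.2 ∈ localized ⊤ ∅ ∧
      Laurent.x K q.2 ^ N * (β q.2 - β q.1) ∈ localized I {q.1} := by
    obtain ⟨N₁, hN₁⟩ := exists_pow_mul_mem_localized (S := ∅) (i := q.2)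
      (by rw [insert_empty_eq]; exact (hβ q.2).2)
    obtain ⟨N₂, hN₂⟩ := exists_pow_mul_mem_localized (S := {q.1}) (i := q.2)
      (by rw [Finset.pair_comm]; exact hβI q.1 q.2)
    exact ⟨max N₁ N₂, fun N hN => ⟨hN₁ N (le_of_max_le_left hN), hN₂ N (le_of_max_le_right hN)⟩⟩
  choose N₀ hN₀ using hbound
  have hN (i k) := hN₀ (i, k) (Finset.univ.sup N₀) (Finset.le_sup (Finset.mem_univ (i, k)))
  have hpoly (k) : ∃ g, toLaurent K n g = Laurent.x K k ^ Finset.univ.sup N₀ * β k := by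
    obtain ⟨_, g, _, hg⟩ := (hN k k).1
    exact ⟨g, by simpa using hg.symm⟩
  choose g hg using hpoly
  refine ⟨Finset.univ.sup N₀, g, fun k => ⟨isHomogeneous_of_toLaurent_mem ?_, hg k,
    fun i => (hN i k).2⟩⟩
  have hmul := mul_mem_laurentDegree
    (pow_mem_laurentDegree (x_mem_laurentDegree (K := K) k) (Finset.univ.sup N₀)) (hβ k).1
  rwa [mul_one, add_zero, ← hg k] at hmul

-- Writing `L ^ M = ∑ a k * x k ^ N`, the form `∑ a k * (x k ^ N * β k)` restricts to each
-- `L ^ M * β i`.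
theorem exists_pow_mul_sub_toLaurent_mem (h : IsNowhereZero I L θ) {β : Fin (n + 1) → Laurent K n}
    (hβ : ∀ i, β i ∈ sections ⊤ 0 {i}) (hβI : ∀ i j, β j - β i ∈ localized I {i, j}) :
    ∃ (M : ℕ) (F : MvPolynomial (Fin (n + 1)) K), F.IsHomogeneous M ∧
      ∀ i, toLaurent K n L ^ M * β i - toLaurent K n F ∈ localized I {i} := by
  obtain ⟨N, g, hg⟩ := exists_pow_mul_eq_toLaurent hβ hβI
  obtain ⟨a, ha, hLa⟩ := exists_eq_sum_mul_pow (N := N) (P := L ^ ((n + 1) * N))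
    (by simpa only [one_mul] using h.isHomogeneous.pow _)
  refine ⟨(n + 1) * N, ∑ k, a k * g k, IsHomogeneous.sum _ _ _ fun k _ => ?_, fun i => ?_⟩
  · have hmul := (ha k).mul (hg k).1
    rwa [← Nat.succ_mul] at hmul
  · rw [← neg_mem_iff, neg_sub, ← map_pow, hLa, map_sum, map_sum, Finset.sum_mul,
      ← Finset.sum_sub_distrib]
    refine Submodule.sum_mem _ fun k _ => ?_
    rw [map_mul, map_mul, (hg k).2.1, map_pow, toLaurent_X, mul_assoc, ← mul_sub, ← mul_sub]
    exact mul_mem_localized (toLaurent_mem_localized_top _) ((hg k).2.2 i)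

theorem exists_evalChart_sub_mem (h : IsNowhereZero I L θ) {β : Fin (n + 1) → Laurent K n}
    (hβ : ∀ i, β i ∈ sections ⊤ 0 {i}) (hβI : ∀ i j, β j - β i ∈ localized I {i, j}) :
    ∃ f, ∀ i, β i - evalChart (θ i) f ∈ localized I {i} := by
  obtain ⟨M, F, hF, hβF⟩ := h.exists_pow_mul_sub_toLaurent_mem hβ hβI
  refine ⟨F, fun i => ?_⟩
  rw [evalChart_of_homogeneous hF]
  exact h.sub_pow_mul_mem M (Finset.mem_singleton_self i) (hβ i).2 (hβF i)

-- Over `L ≠ 0` the functions on the subscheme defined by `I` are the polynomials modulo `L - 1`,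
-- and a finite subscheme missing `L = 0` has no other global functions.
theorem finrank_quotient_eq_length (h : IsNowhereZero I L θ) (hI : IsHomogeneousIdeal I) :
    finrank K (MvPolynomial (Fin (n + 1)) K ⧸ (I ⊔ Ideal.span {L - 1})) = length I := by
  let E : MvPolynomial (Fin (n + 1)) K →ₗ[K] quotientCocycles I 0 :=
    (LinearMap.pi fun s : Fin (0 + 1) ↪o Fin (n + 1) =>
      (evalChart (θ (s 0))).toLinearMap).codRestrict _ fun f =>
        zeroCochain_mem_quotientCocycles.2
          ⟨fun i => h.evalChart_mem_sections i f, fun i j => h.evalChart_sub_mem i j f⟩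
  let Q := (cochains I 0 0).submoduleOf (quotientCocycles I 0)
  have hker : LinearMap.ker (Q.mkQ ∘ₗ E) = (I ⊔ Ideal.span {L - 1}).restrictScalars K := by
    ext f
    rw [LinearMap.mem_ker, LinearMap.comp_apply, Submodule.mkQ_apply,
      Submodule.Quotient.mk_eq_zero, Submodule.restrictScalars_mem, h.mem_sup_iff hI]
    change zeroCochain (fun i => evalChart (θ i) f) ∈ cochains I 0 0 ↔ _
    rw [zeroCochain_mem_cochains]
    exact forall_congr' fun i => and_iff_right (h.evalChart_mem_sections i f).1
  have hsurj : Function.Surjective (Q.mkQ ∘ₗ E) := by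
    intro x
    obtain ⟨⟨b, hb⟩, rfl⟩ := Q.mkQ_surjective x
    obtain ⟨β, rfl⟩ := exists_zeroCochain_eq b
    obtain ⟨hβ, hβI⟩ := zeroCochain_mem_quotientCocycles.1 hb
    obtain ⟨f, hf⟩ := h.exists_evalChart_sub_mem hβ hβI
    refine ⟨f, Eq.symm ((Submodule.Quotient.eq Q).2 ?_)⟩
    exact zeroCochain_mem_cochains.2 fun i =>
      ⟨(laurentDegree K n 0).sub_mem (hβ i).1 (h.evalChart_mem_sections i f).1, hf i⟩
  rw [length, ← (LinearMap.quotKerEquivOfSurjective _ hsurj).finrank_eq, hker]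
  exact ((Submodule.Quotient.restrictScalarsEquiv K (I ⊔ Ideal.span {L - 1})).finrank_eq).symm

theorem mem_of_inverse_pow_mul_mem (h : IsNowhereZero I L θ) {i : Fin (n + 1)} (M : ℕ)
    {S : Finset (Fin (n + 1))} (hi : i ∈ S) {f : Laurent K n} (hf : f ∈ localized ⊤ S)
    (hθf : θ i ^ M * f ∈ localized I S) : f ∈ localized I S := by
  have hsplit : f = toLaurent K n (L ^ M) * (θ i ^ M * f) -
      (toLaurent K n L ^ M * (θ i ^ M * f) - f) := by
    rw [map_pow]
    ring
  rw [hsplit]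
  exact sub_mem (mul_mem_localized (toLaurent_mem_localized_top _) hθf)
    (h.pow_mul_pow_mul_sub_mem M hi hf)

theorem formsImage_eq_top_of_subsingleton_cohomology (h : IsNowhereZero I L θ)
    (hI : IsHomogeneousIdeal I) (hn : 2 ≤ n) {m : ℕ}
    (hcohomology : Subsingleton (cohomology I m 1)) :
    formsImage (I ⊔ Ideal.span {L - 1}) m = ⊤ := by
  rw [subsingleton_cohomology_one_iff (by lia)] at hcohomology
  refine eq_top_iff.2 fun x _ => ?_
  obtain ⟨f, rfl⟩ := Ideal.Quotient.mk_surjective x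
  have hsections (i) : toLaurent K n L ^ m * evalChart (θ i) f ∈ sections ⊤ m {i} := by
    rw [← map_pow]
    refine ⟨?_, mul_mem_localized (toLaurent_mem_localized_top _) (h.evalChart_mem_sections i f).2⟩
    have hmul := mul_mem_laurentDegree (toLaurent_mem_laurentDegree (h.isHomogeneous.pow m))
      (h.evalChart_mem_sections i f).1
    rwa [one_mul, add_zero] at hmul
  have hglue (i j) : toLaurent K n L ^ m * evalChart (θ j) f -
      toLaurent K n L ^ m * evalChart (θ i) f ∈ localized I {i, j} := by
    rw [← mul_sub, ← map_pow]
    exact mul_mem_localized (toLaurent_mem_localized_top _) (h.evalChart_sub_mem i j f)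
  obtain ⟨g, hg, hgf⟩ := hcohomology _ hsections hglue
  obtain ⟨r, rfl⟩ := exists_toLaurent_eq_of_mem_localized (by lia) fun i => (hg i).2
  have hr : r.IsHomogeneous m := isHomogeneous_of_toLaurent_mem (hg 0).1
  refine ⟨r, hr, Eq.symm (Ideal.Quotient.eq.2 ((h.mem_sup_iff hI).2 fun i => ?_))⟩
  rw [map_sub, evalChart_of_homogeneous hr]
  exact h.sub_pow_mul_mem m (Finset.mem_singleton_self i) (h.evalChart_mem_sections i f).2 (hgf i)

theorem inverse_pow_mul_mem_sections (h : IsNowhereZero I L θ) {i : Fin (n + 1)} {m : ℕ}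
    {f : Laurent K n} (hf : f ∈ sections ⊤ m {i}) : θ i ^ m * f ∈ sections ⊤ 0 {i} := by
  refine ⟨?_, mul_mem_localized (pow_mem_localized_top (h.mem_localized i) m) hf.2⟩
  have hmul := mul_mem_laurentDegree (pow_mem_laurentDegree (h.mem_degree i) m) hf.1
  rwa [mul_neg_one, neg_add_cancel] at hmul

theorem inverse_pow_mul_sub_mem (h : IsNowhereZero I L θ) {i j : Fin (n + 1)} (m : ℕ)
    {f g : Laurent K n} (hf : f ∈ localized ⊤ {i}) (hgf : g - f ∈ localized I {i, j}) :
    θ j ^ m * g - θ i ^ m * f ∈ localized I {i, j} := by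
  have hsplit : θ j ^ m * g - θ i ^ m * f = θ j ^ m * (g - f) + (θ j ^ m - θ i ^ m) * f := by ring
  rw [hsplit]
  exact add_mem
    (mul_mem_localized (pow_mem_localized_top (h.mem_localized_of_mem (by simp)) m) hgf)
    (mul_mem_localized' (h.pow_sub_pow_mem i j m) (localized_mono (by simp) hf))

theorem subsingleton_cohomology_of_formsImage_eq_top (h : IsNowhereZero I L θ)
    (hI : IsHomogeneousIdeal I) (hn : n ≠ 1) {m : ℕ}
    (htop : formsImage (I ⊔ Ideal.span {L - 1}) m = ⊤) : Subsingleton (cohomology I m 1) := by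
  refine (subsingleton_cohomology_one_iff hn).2 fun β hβ hβI => ?_
  obtain ⟨f, hf⟩ := h.exists_evalChart_sub_mem (fun i => h.inverse_pow_mul_mem_sections (hβ i))
    fun i j => h.inverse_pow_mul_sub_mem m (hβ i).2 (hβI i j)
  obtain ⟨r, hr, hrf⟩ : Ideal.Quotient.mk _ f ∈ formsImage (I ⊔ Ideal.span {L - 1}) m :=
    htop ▸ Submodule.mem_top
  refine ⟨toLaurent K n r, fun i =>
    ⟨toLaurent_mem_laurentDegree hr, toLaurent_mem_localized_top _⟩, fun i => ?_⟩
  refine h.mem_of_inverse_pow_mul_mem m (Finset.mem_singleton_self i)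
    (sub_mem (hβ i).2 (toLaurent_mem_localized_top _)) ?_
  have hfr := (h.mem_sup_iff hI).1 (Ideal.Quotient.eq.1 hrf.symm) i
  rw [map_sub, evalChart_of_homogeneous hr] at hfr
  rw [mul_sub, ← sub_add_sub_cancel _ (evalChart (θ i) f)]
  exact add_mem (hf i) hfr

theorem subsingleton_cohomology_one (h : IsNowhereZero I L θ) (hI : IsHomogeneousIdeal I)
    (hn : 2 ≤ n) {m : ℕ} :
    Subsingleton (cohomology I m 1) ↔ formsImage (I ⊔ Ideal.span {L - 1}) m = ⊤ :=
  ⟨h.formsImage_eq_top_of_subsingleton_cohomology hI hn,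
    h.subsingleton_cohomology_of_formsImage_eq_top hI (by lia)⟩

theorem eq_top_of_subsingleton_cohomology_one (h : IsNowhereZero I L θ) (hI : IsHomogeneousIdeal I)
    (hn : 2 ≤ n) {m : ℤ} (hm : m < 0) (hcohomology : Subsingleton (cohomology I m 1)) :
    I ⊔ Ideal.span {L - 1} = ⊤ := by
  rw [subsingleton_cohomology_one_iff (by lia)] at hcohomology
  obtain ⟨k, rfl⟩ : ∃ k : ℕ, m = -k := ⟨m.natAbs, by lia⟩
  have hdeg (i) : θ i ^ k ∈ laurentDegree K n (-k) := by
    have hpow := pow_mem_laurentDegree (h.mem_degree i) k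
    rwa [mul_neg_one] at hpow
  obtain ⟨f, hf, hθf⟩ := hcohomology (fun i => θ i ^ k)
    (fun i => ⟨hdeg i, pow_mem_localized_top (h.mem_localized i) k⟩)
    fun i j => h.pow_sub_pow_mem i j k
  obtain ⟨r, rfl⟩ := exists_toLaurent_eq_of_mem_localized (by lia) fun i => (hf i).2
  rw [Ideal.eq_top_iff_one, h.mem_sup_iff hI]
  intro i
  have hθ := hθf i
  rw [eq_zero_of_toLaurent_mem hm (hf 0).1, map_zero, sub_zero] at hθ
  rw [map_one]
  exact h.mem_of_inverse_pow_mul_mem k (Finset.mem_singleton_self i) one_mem_localized_top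
    (by rwa [mul_one])

end IsNowhereZero

section Geometry

variable {K : Type*} [Field K] {n : ℕ} {Γ : ClosedSubscheme K n}
  {L : MvPolynomial (Fin (n + 1)) K} {θ : Fin (n + 1) → Laurent K n}

theorem ClosedSubscheme.InLinearlyGeneralPosition.interDegree_le
    (hΓ : Γ.InLinearlyGeneralPosition) (hn : 1 ≤ n) {Z : ClosedSubscheme K n}
    (hZ : Z.IsPlane (n - 1)) : Γ.interDegree Z ≤ n := by
  by_contra! hlt
  have hlt_secantIndex : n - 1 < Γ.secantIndex := by
    rw [hΓ]
    lia
  exact Nat.notMem_of_lt_sInf hlt_secantIndex ⟨Z, hZ, by lia⟩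

namespace IsNowhereZero

theorem finrank_quotient_eq_degree (h : IsNowhereZero Γ.ideal L θ) :
    finrank K (MvPolynomial (Fin (n + 1)) K ⧸ (Γ.ideal ⊔ Ideal.span {L - 1})) = Γ.degree :=
  h.finrank_quotient_eq_length Γ.homogeneous

theorem finrank_quotient_eq_interDegree (h : IsNowhereZero Γ.ideal L θ)
    (Z : ClosedSubscheme K n) :
    finrank K (MvPolynomial (Fin (n + 1)) K ⧸ (Γ.ideal ⊔ Z.ideal ⊔ Ideal.span {L - 1})) =
      Γ.interDegree Z :=
  (h.mono le_sup_left).finrank_quotient_eq_length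
    (IsHomogeneousIdeal.sup Γ.homogeneous Z.homogeneous)

theorem finiteDimensional_quotient (h : IsNowhereZero Γ.ideal L θ) (hd : 0 < Γ.degree) :
    FiniteDimensional K (MvPolynomial (Fin (n + 1)) K ⧸ (Γ.ideal ⊔ Ideal.span {L - 1})) :=
  Module.finite_of_finrank_pos (by rwa [h.finrank_quotient_eq_degree])

theorem one_mem_formsImage_one (h : IsNowhereZero Γ.ideal L θ) :
    1 ∈ formsImage (Γ.ideal ⊔ Ideal.span {L - 1}) 1 :=
  one_mem_formsImage h.isHomogeneous (Ideal.mem_sup_right (Ideal.mem_span_singleton_self _))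

theorem interDegree_le_degree (h : IsNowhereZero Γ.ideal L θ) (hd : 0 < Γ.degree)
    (Z : ClosedSubscheme K n) : Γ.interDegree Z ≤ Γ.degree := by
  have := h.finiteDimensional_quotient hd
  rw [← h.finrank_quotient_eq_degree, ← h.finrank_quotient_eq_interDegree]
  exact finrank_quotient_le_of_le (sup_le_sup_right le_sup_left _)

theorem bddAbove_interDegree (h : IsNowhereZero Γ.ideal L θ) (hd : 0 < Γ.degree) :
    BddAbove {k | ∃ C : ClosedSubscheme K n, C.IsRationalNormalCurve ∧ Γ.interDegree C = k} :=
  ⟨Γ.degree, by rintro _ ⟨C, -, rfl⟩; exact h.interDegree_le_degree hd C⟩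

theorem interDegree_le_rho (h : IsNowhereZero Γ.ideal L θ) (hd : 0 < Γ.degree)
    {C : ClosedSubscheme K n} (hC : C.IsRationalNormalCurve) : Γ.interDegree C ≤ Γ.rho :=
  le_csSup (h.bddAbove_interDegree hd) ⟨C, hC, rfl⟩

theorem exists_interDegree_eq_rho (h : IsNowhereZero Γ.ideal L θ) (hd : 0 < Γ.degree)
    (hrho : Γ.rho ≠ 0) :
    ∃ C : ClosedSubscheme K n, C.IsRationalNormalCurve ∧ Γ.interDegree C = Γ.rho :=
  Nat.sSup_mem (Set.nonempty_iff_ne_empty.2 fun hempty => hrho (by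
    rw [ClosedSubscheme.rho, hempty, csSup_empty, bot_eq_zero])) (h.bddAbove_interDegree hd)

theorem mem_of_isHomogeneous_of_mem_sup (h : IsNowhereZero Γ.ideal L θ) {m : ℕ}
    {f : MvPolynomial (Fin (n + 1)) K} (hf : f.IsHomogeneous m)
    (hfL : f ∈ Γ.ideal ⊔ Ideal.span {L - 1}) : f ∈ Γ.ideal := by
  rw [h.mem_sup_iff Γ.homogeneous] at hfL
  exact Γ.saturated f fun i => mem_localized_singleton_iff.1
    (toLaurent_mem_of_evalChart_mem (h.mem_localized i) h.isHomogeneous (h.mul_sub_one_mem i) hf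
      (by rw [sub_self]; exact zero_mem _) (hfL i))

theorem isSubscheme_of_degree_le (h : IsNowhereZero Γ.ideal L θ) (hd : 0 < Γ.degree)
    {Z : ClosedSubscheme K n} (hZ : Γ.degree ≤ Γ.interDegree Z) : Γ.IsSubscheme Z := by
  have := h.finiteDimensional_quotient hd
  rw [← h.finrank_quotient_eq_degree, ← h.finrank_quotient_eq_interDegree] at hZ
  have hle := le_of_finrank_quotient_le (sup_le_sup_right le_sup_left _) hZ
  intro f hf
  rw [← sum_homogeneousComponent f]
  exact Ideal.sum_mem _ fun m _ =>
    h.mem_of_isHomogeneous_of_mem_sup (homogeneousComponent_isHomogeneous m f)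
      (hle (Ideal.mem_sup_left (Ideal.mem_sup_right (Z.homogeneous f hf m))))

theorem finrank_formsImage_eq_hilbertFunction (h : IsNowhereZero Γ.ideal L θ) (m : ℕ) :
    finrank K (formsImage (Γ.ideal ⊔ Ideal.span {L - 1}) m) = Γ.hilbertFunction m :=
  finrank_map_eq_of_forall fun x hx => by
    change Ideal.Quotient.mk _ x = 0 ↔ Ideal.Quotient.mk _ x = 0
    rw [Ideal.Quotient.eq_zero_iff_mem, Ideal.Quotient.eq_zero_iff_mem]
    exact ⟨h.mem_of_isHomogeneous_of_mem_sup hx, fun hxΓ => Ideal.mem_sup_left hxΓ⟩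

theorem finrank_quotient_span_singleton_le (h : IsNowhereZero Γ.ideal L θ)
    (hΓ : Γ.InLinearlyGeneralPosition) (hn : 1 ≤ n) {v : MvPolynomial (Fin (n + 1)) K}
    (hv : v.IsHomogeneous 1) (hv0 : v ≠ 0) :
    finrank K ((MvPolynomial (Fin (n + 1)) K ⧸ (Γ.ideal ⊔ Ideal.span {L - 1})) ⧸
      Ideal.span {Ideal.Quotient.mkₐ K (Γ.ideal ⊔ Ideal.span {L - 1}) v}) ≤ n := by
  obtain ⟨Z, hZ, hZv⟩ := exists_isPlane_ideal_eq_span hn hv hv0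
  have hle := hΓ.interDegree_le hn hZ
  rwa [← h.finrank_quotient_eq_interDegree, hZv, sup_right_comm,
    ← (DoubleQuot.quotQuotEquivQuotSupₐ K _ _).toLinearEquiv.finrank_eq, Ideal.map_span,
    Set.image_singleton] at hle

theorem eq_zero_of_mem_sup (h : IsNowhereZero Γ.ideal L θ)
    (hΓ : Γ.InLinearlyGeneralPosition) (hn : 1 ≤ n) (hd : n < Γ.degree)
    {v : MvPolynomial (Fin (n + 1)) K} (hv : v.IsHomogeneous 1)
    (hvL : v ∈ Γ.ideal ⊔ Ideal.span {L - 1}) : v = 0 := by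
  by_contra hv0
  have hle := h.finrank_quotient_span_singleton_le hΓ hn hv hv0
  rw [Ideal.Quotient.mkₐ_eq_mk, Ideal.Quotient.eq_zero_iff_mem.2 hvL,
    Ideal.span_singleton_eq_bot.2 rfl, finrank_quotient_bot, h.finrank_quotient_eq_degree] at hle
  exact hd.not_ge hle

theorem finrank_formsImage_one (h : IsNowhereZero Γ.ideal L θ)
    (hΓ : Γ.InLinearlyGeneralPosition) (hn : 1 ≤ n) (hd : n < Γ.degree) :
    finrank K (formsImage (Γ.ideal ⊔ Ideal.span {L - 1}) 1) = n + 1 := by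
  have hmap := finrank_map_eq_of_forall (W := homogeneousSubmodule (Fin (n + 1)) K 1)
    (f := (Ideal.Quotient.mkₐ K (Γ.ideal ⊔ Ideal.span {L - 1})).toLinearMap) (g := LinearMap.id)
    fun v hv => ⟨fun hv0 => h.eq_zero_of_mem_sup hΓ hn hd hv (Ideal.Quotient.eq_zero_iff_mem.1 hv0),
      fun hv0 : v = 0 => by rw [hv0, map_zero]⟩
  rwa [Submodule.map_id, finrank_homogeneousSubmodule_one, Fintype.card_fin] at hmap

theorem spansQuotients [IsAlgClosed K] (h : IsNowhereZero Γ.ideal L θ)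
    (hΓ : Γ.InLinearlyGeneralPosition) (hn : 1 ≤ n) (hd : n < Γ.degree) :
    SpansQuotients (formsImage (Γ.ideal ⊔ Ideal.span {L - 1}) 1) (n + 1) := by
  have := h.finiteDimensional_quotient (by lia)
  have hV := h.finrank_formsImage_one hΓ hn hd
  have hspans := spansQuotients_finrank
    (V := formsImage (Γ.ideal ⊔ Ideal.span {L - 1}) 1) (by rwa [hV, h.finrank_quotient_eq_degree])
    (by
      rintro _ ⟨v, hv, rfl⟩ hv0
      rw [hV, Nat.lt_succ_iff]
      exact h.finrank_quotient_span_singleton_le hΓ hn hv fun hv' => hv0 (by rw [hv', map_zero]))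
  exact hspans.mono le_rfl hV.ge

theorem formsImage_eq_top_of_degree_le [IsAlgClosed K] (h : IsNowhereZero Γ.ideal L θ)
    (hΓ : Γ.InLinearlyGeneralPosition) (hn : 1 ≤ n) (hd : n < Γ.degree) {l : ℕ}
    (hl : Γ.degree ≤ n * l + 1) : formsImage (Γ.ideal ⊔ Ideal.span {L - 1}) l = ⊤ := by
  have := h.finiteDimensional_quotient (by lia)
  exact ((h.spansQuotients hΓ hn hd).formsImage_of_le (h.finrank_formsImage_one hΓ hn hd)
    h.one_mem_formsImage_one le_rfl l).eq_top (by rwa [h.finrank_quotient_eq_degree])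

theorem isRegular_add_one_iff (h : IsNowhereZero Γ.ideal L θ) (hn : 2 ≤ n) {m : ℕ} :
    Γ.IsRegular (m + 1) ↔ formsImage (Γ.ideal ⊔ Ideal.span {L - 1}) m = ⊤ := by
  rw [← h.subsingleton_cohomology_one Γ.homogeneous hn]
  have hshift : (m : ℤ) + 1 - (1 : ℕ) = m := by lia
  refine ⟨fun hreg => hshift ▸ hreg 1 le_rfl, fun hcohomology i hi => ?_⟩
  obtain rfl | ⟨p, rfl⟩ : i = 1 ∨ ∃ p, i = p + 2 := hi.eq_or_lt.imp Eq.symm Nat.exists_eq_add_of_le'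
  · rwa [hshift]
  · exact h.subsingleton_cohomology (by lia)

theorem one_le_of_isRegular (h : IsNowhereZero Γ.ideal L θ) (hn : 2 ≤ n) (hd : 0 < Γ.degree)
    {p : ℤ} (hp : Γ.IsRegular p) : 1 ≤ p := by
  by_contra! hlt
  have htop := h.eq_top_of_subsingleton_cohomology_one Γ.homogeneous hn (by lia) (hp 1 le_rfl)
  rw [← h.finrank_quotient_eq_degree, htop, finrank_quotient_top] at hd
  exact hd.false

theorem reg_eq_iff [IsAlgClosed K] (h : IsNowhereZero Γ.ideal L θ)
    (hΓ : Γ.InLinearlyGeneralPosition) (hn : 2 ≤ n) (hd : n < Γ.degree) {q : ℕ}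
    (hq : Γ.degree ≤ n * (q + 1) + 1) :
    Γ.reg = q + 2 ↔ formsImage (Γ.ideal ⊔ Ideal.span {L - 1}) q ≠ ⊤ := by
  have hone_le (p) (hp : Γ.IsRegular p) : 1 ≤ p := h.one_le_of_isRegular hn (by lia) hp
  have hreg : Γ.IsRegular ((q + 1 : ℕ) + 1) :=
    (h.isRegular_add_one_iff hn).2 (h.formsImage_eq_top_of_degree_le hΓ (by lia) hd hq)
  constructor
  · intro hreg_eq htop
    have hle : Γ.reg ≤ q + 1 := csInf_le ⟨1, hone_le⟩ ((h.isRegular_add_one_iff hn).2 htop)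
    lia
  · intro hne
    refine le_antisymm ((csInf_le ⟨1, hone_le⟩ hreg).trans (by lia)) ?_
    refine le_csInf ⟨_, hreg⟩ fun p (hp : Γ.IsRegular p) => ?_
    by_contra! hlt
    obtain ⟨m, rfl⟩ : ∃ m : ℕ, p = m + 1 := ⟨(p - 1).toNat, by have := hone_le p hp; lia⟩
    rw [h.isRegular_add_one_iff hn] at hp
    exact hne (top_le_iff.1 (hp.ge.trans (formsImage_mono h.one_mem_formsImage_one (by lia))))

theorem formsImage_ne_top_of_le_interDegree (h : IsNowhereZero Γ.ideal L θ)
    {C : ClosedSubscheme K n} (hC : C.IsRationalNormalCurve) {q : ℕ}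
    (hq : n * q + 2 ≤ Γ.interDegree C) : formsImage (Γ.ideal ⊔ Ideal.span {L - 1}) q ≠ ⊤ := by
  intro htop
  have htop' := formsImage_eq_top_of_le (𝔟 := Γ.ideal ⊔ C.ideal ⊔ Ideal.span {L - 1})
    (sup_le_sup_right le_sup_left _) htop
  have hle := finrank_formsImage_le_of_le (le_sup_of_le_left le_sup_right :
    C.ideal ≤ Γ.ideal ⊔ C.ideal ⊔ Ideal.span {L - 1}) q
  rw [htop', finrank_top, h.finrank_quotient_eq_interDegree] at hle
  exact absurd ((hq.trans hle).trans (hC.hilbertFunction_le q)) (by lia)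

theorem exists_le_interDegree [IsAlgClosed K] (h : IsNowhereZero Γ.ideal L θ)
    (hΓ : Γ.InLinearlyGeneralPosition) (hn : 2 ≤ n) {q : ℕ} (hnq : 2 * n ≤ q)
    (hd : n < Γ.degree) (hdq : Γ.degree ≤ n * q + n + 1)
    (hq : formsImage (Γ.ideal ⊔ Ideal.span {L - 1}) q ≠ ⊤) :
    ∃ C : ClosedSubscheme K n, C.IsRationalNormalCurve ∧ n * q + 2 ≤ Γ.interDegree C := by
  have := h.finiteDimensional_quotient (by lia)
  obtain ⟨C, 𝔠, hC, hΓ𝔠, hC𝔠, hdim⟩ :=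
    (h.spansQuotients hΓ (by lia) hd).exists_rationalNormalCurve
      (h.finrank_formsImage_one hΓ (by lia) hd) h.one_mem_formsImage_one (by lia) hnq (by lia)
      (by rwa [h.finrank_quotient_eq_degree]) hq
  have hle : Γ.ideal ⊔ C.ideal ⊔ Ideal.span {L - 1} ≤ 𝔠 :=
    sup_le (sup_le (le_sup_left.trans hΓ𝔠) hC𝔠) (le_sup_right.trans hΓ𝔠)
  have := finiteDimensional_quotient_of_le (K := K) (sup_le_sup_right le_sup_left _ :
    Γ.ideal ⊔ Ideal.span {L - 1} ≤ Γ.ideal ⊔ C.ideal ⊔ Ideal.span {L - 1})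
  exact ⟨C, hC, h.finrank_quotient_eq_interDegree C ▸ hdim.trans (finrank_quotient_le_of_le hle)⟩

theorem formsImage_ne_top_iff [IsAlgClosed K] (h : IsNowhereZero Γ.ideal L θ)
    (hΓ : Γ.InLinearlyGeneralPosition) (hn : 2 ≤ n) {q : ℕ} (hnq : 2 * n ≤ q)
    (hd : n < Γ.degree) (hdq : Γ.degree ≤ n * q + n + 1) :
    formsImage (Γ.ideal ⊔ Ideal.span {L - 1}) q ≠ ⊤ ↔ n * q + 2 ≤ Γ.rho := by
  refine ⟨fun hne => ?_, fun hrho => ?_⟩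
  · obtain ⟨C, hC, hdim⟩ := h.exists_le_interDegree hΓ hn hnq hd hdq hne
    exact hdim.trans (h.interDegree_le_rho (by lia) hC)
  · obtain ⟨C, hC, hCrho⟩ := h.exists_interDegree_eq_rho (by lia) (by lia)
    exact h.formsImage_ne_top_of_le_interDegree hC (hCrho ▸ hrho)

theorem hilbertFunction_eq_min [IsAlgClosed K] (h : IsNowhereZero Γ.ideal L θ)
    (hΓ : Γ.InLinearlyGeneralPosition) (hn : 1 ≤ n) (hd : n < Γ.degree)
    {C Y : ClosedSubscheme K n} (hC : C.IsRationalNormalCurve) (hΓC : Γ.IsSubscheme C)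
    (hY : Y.IsSubscheme Γ) (l : ℕ) : Y.hilbertFunction l = min Y.degree (n * l + 1) := by
  have := h.finiteDimensional_quotient (by lia)
  have hle : Γ.ideal ⊔ Ideal.span {L - 1} ≤ Y.ideal ⊔ Ideal.span {L - 1} := sup_le_sup_right hY _
  have := finiteDimensional_quotient_of_le (K := K) hle
  have hspans := (h.spansQuotients hΓ hn hd).formsImage_of_le (h.finrank_formsImage_one hΓ hn hd)
    h.one_mem_formsImage_one hle l
  rw [← (h.mono hY).finrank_formsImage_eq_hilbertFunction,
    ← (h.mono hY).finrank_quotient_eq_degree]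
  refine le_antisymm (le_min (Submodule.finrank_le _) ?_)
    (min_comm (n * l + 1) _ ▸ hspans.min_finrank_le)
  exact (finrank_formsImage_le_of_le ((hΓC.trans hY).trans le_sup_left) l).trans
    (hC.hilbertFunction_le l)

theorem inUniformPosition [IsAlgClosed K] (h : IsNowhereZero Γ.ideal L θ)
    (hΓ : Γ.InLinearlyGeneralPosition) (hn : 1 ≤ n) (hd : n < Γ.degree) (hfin : Γ.IsFinite)
    {C : ClosedSubscheme K n} (hC : C.IsRationalNormalCurve) (hΓC : Γ.IsSubscheme C) :
    Γ.InUniformPosition := by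
  refine ⟨hfin, fun f hf hfΓ => h.eq_zero_of_mem_sup hΓ hn hd hf (Ideal.mem_sup_left hfΓ),
    fun Y hY l => ?_⟩
  have := h.finiteDimensional_quotient (by lia)
  have hle : Y.degree ≤ Γ.degree := by
    rw [← h.finrank_quotient_eq_degree, ← (h.mono hY).finrank_quotient_eq_degree]
    exact finrank_quotient_le_of_le (sup_le_sup_right hY _)
  rw [h.hilbertFunction_eq_min hΓ hn hd hC hΓC hY, h.hilbertFunction_eq_min hΓ hn hd hC hΓC le_rfl,
    ← min_assoc, min_eq_left hle]

end IsNowhereZero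

theorem ClosedSubscheme.IsFinite.exists_isNowhereZero [Infinite K] (hfin : Γ.IsFinite) :
    ∃ L θ, IsNowhereZero Γ.ideal L θ :=
  ProjSub.exists_isNowhereZero Γ.homogeneous
    fun i => finiteDimensional_quotient_sup_X_sub_one Γ.homogeneous i (hfin i)

end Geometry

theorem ceil_sub_one_div {d n q r : ℕ} (hdqr : d = n * q + r + 2) (hr : r < n) :
    ⌈((d : ℚ) - 1) / n⌉ = q + 1 := by
  have hn : (0 : ℚ) < n := by exact_mod_cast (Nat.zero_le r).trans_lt hr
  have hr' : (r : ℚ) + 1 ≤ n := by exact_mod_cast hr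
  rw [Int.ceil_eq_iff, lt_div_iff₀ hn, div_le_iff₀ hn, hdqr]
  push_cast
  constructor <;> linarith [(r.cast_nonneg : (0 : ℚ) ≤ r)]

end ProjSub

theorem corollary1p4_general {K : Type*} [Field K] [IsAlgClosed K] {n : ℕ} (hn : 2 ≤ n)
    {Γ : ProjSub.ClosedSubscheme K n} (hfin : Γ.IsFinite) (hΓ : Γ.InLinearlyGeneralPosition)
    {d : ℕ} (hdeg : Γ.degree = d) (hd : 2 * n ^ 2 + 2 ≤ d)
    {q r : ℕ} (hdqr : d = n * q + r + 2) (hr : r < n) :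
    (Γ.reg = ⌈((d : ℚ) - 1) / n⌉ + 1 ↔ (d : ℤ) - r ≤ Γ.rho) ∧
    (r = 0 → Γ.reg = ⌈((d : ℚ) - 1) / n⌉ + 1 →
      (∃ C : ProjSub.ClosedSubscheme K n, C.IsRationalNormalCurve ∧ Γ.IsSubscheme C) ∧
      Γ.InUniformPosition) := by
  obtain ⟨L, θ, h⟩ := hfin.exists_isNowhereZero
  have hnq : 2 * n ≤ q := by nlinarith
  have hnd : n < Γ.degree := by nlinarith
  have hdq : Γ.degree ≤ n * q + n + 1 := by lia
  have hreg : Γ.reg = ⌈((d : ℚ) - 1) / n⌉ + 1 ↔ n * q + 2 ≤ Γ.rho := by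
    rw [ProjSub.ceil_sub_one_div hdqr hr, add_assoc, ← h.formsImage_ne_top_iff hΓ hn hnq hnd hdq]
    exact h.reg_eq_iff hΓ hn hnd (hdq.trans_eq (by ring))
  refine ⟨hreg.trans (by lia), ?_⟩
  rintro rfl hmax
  have hrho : Γ.degree ≤ Γ.rho := by
    have := hreg.1 hmax
    lia
  obtain ⟨C, hC, hCrho⟩ := h.exists_interDegree_eq_rho (by lia) (by lia)
  have hΓC : Γ.IsSubscheme C := h.isSubscheme_of_degree_le (by lia) (hCrho ▸ hrho)
  exact ⟨⟨C, hC, hΓC⟩, h.inUniformPosition hΓ (by lia) hnd hfin hC hΓC⟩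

theorem corollary1p4 {K : Type*} [Field K] [IsAlgClosed K] [CharZero K]
    (n : ℕ) (hn : 2 ≤ n) (Γ : ProjSub.ClosedSubscheme K n) (hfin : Γ.IsFinite)
    (hΓ : Γ.InLinearlyGeneralPosition)
    (d : ℕ) (hdeg : Γ.degree = d) (hd : 4 * n ^ 2 + 6 * n + 1 ≤ d)
    (q r : ℕ) (hdqr : d = n * q + r + 2) (hr : r < n) :
    (Γ.reg = ⌈((d : ℚ) - 1) / n⌉ + 1 ↔ (d : ℤ) - r ≤ Γ.rho) ∧
    (r = 0 → Γ.reg = ⌈((d : ℚ) - 1) / n⌉ + 1 →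
      (∃ C : ProjSub.ClosedSubscheme K n, C.IsRationalNormalCurve ∧ Γ.IsSubscheme C) ∧
      Γ.InUniformPosition) := by
  exact corollary1p4_general hn hfin hΓ hdeg (by nlinarith) hdqr hr
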